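/- **Conventions.** All Hilbert spaces are complex; $[S]$ denotes the closed linear span of $S$, and $[AB]=[\{ab : a\in A, b\in B\}]$. For a space $A$ of operators, $A'$ is its commutant. A *$C^*$-base* $\mathfrak b=(\mathfrak K,\mathfrak B,\mathfrak B^\dagger)$ is a Hilbert space $\mathfrak K$ with two commuting nondegenerate $C^*$-algebras $\mathfrak B,\mathfrak B^\dagger\subseteq L(\mathfrak K)$; put $\mathfrak b^\dagger=(\mathfrak K,\mathfrak B^\dagger,\mathfrak B)$. A *$C^*$-$\mathfrak b$-module* $(H,\alpha)$ is a Hilbert space $H$ with a closed subspace $\alpha\subseteq L(\mathfrak K,H)$ such that $[\alpha\mathfrak K]=H$, $[\alpha\mathfrak B]=\alpha$, $[\alpha^*\alpha]=\mathfrak B$; then $\rho_\alpha:\mathfrak B^\dagger\to L(H)$ is the representation with $\rho_\alpha(x)\xi\zeta=\xi x\zeta$ for $\xi\in\alpha$, $\zeta\in\mathfrak K$. A *$C^*$-$(\mathfrak b^\dagger,\mathfrak b,\mathfrak b^\dagger)$-module* $(H,\hat\beta,\alpha,\beta)$ consists of a $C^*$-$\mathfrak b$-module $(H,\alpha)$ and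 $C^*$-$\mathfrak b^\dagger$-modules $(H,\hat\beta)$, $(H,\beta)$ such that for any two distinct $\gamma,\delta$ among $\hat\beta,\alpha,\beta$ one has $[\rho_\gamma(\mathfrak C)\delta]=\delta$, where $\mathfrak C$ is the domain of $\rho_\gamma$. For a $C^*$-$\mathfrak b$-module $(H,\beta)$ and a $C^*$-$\mathfrak b^\dagger$-module $(K,\gamma)$, the relative tensor product $H_\beta\otimes_{\mathfrak b}{}_\gamma K$ is the Hilbert space spanned densely by elements $\xi\otimes\zeta\otimes\eta$ ($\xi\in\beta,\zeta\in\mathfrak K,\eta\in\gamma$) with $\langle\xi\otimes\zeta\otimes\eta\mid\xi'\otimes\zeta'\otimes\eta'\rangle=\langle\zeta\mid\xi^*\xi'\,\eta^*\eta'\zeta'\rangle$. The operators $|\xi\rangle_1:K\to H_\beta\otimes{}_\gamma K$ and $|\eta\rangle_2:H\to H_\beta\otimes{}_\gamma K$ are given by $|\xi\rangle_1\eta\zeta=\xi\otimes\zeta\otimes\eta=|\eta\rangle_2\xi\zeta$, with adjoints $\langle\xi|_1,\langle\eta|_2$. For further module structures $\mu$ on $H$ with $[\rho_\beta(\mathfrak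 B^\dagger)\mu]=\mu$ and $\nu$ on $K$ with $[\rho_\gamma(\mathfrak B)\nu]=\nu$ put $\mu\triangleleft\gamma=[|\gamma\rangle_2\mu]$ and $\beta\triangleright\nu=[|\beta\rangle_1\nu]$. If $z\in L(H)$ commutes with $\rho_\beta(\mathfrak B^\dagger)$, then $z\otimes\mathrm{Id}$ is the operator with $(z\otimes\mathrm{Id})|\eta\rangle_2=|\eta\rangle_2z$; if $y\in L(K)$ commutes with $\rho_\gamma(\mathfrak B)$, then $(\mathrm{Id}\otimes y)|\xi\rangle_1=|\xi\rangle_1y$. A *$C^*$-pseudo-multiplicative unitary* is a unitary $V:H_{\hat\beta}\otimes_{\mathfrak b^\dagger}{}_\alpha H\to H_\alpha\otimes_{\mathfrak b}{}_\beta H$, for a $C^*$-$(\mathfrak b^\dagger,\mathfrak b,\mathfrak b^\dagger)$-module $(H,\hat\beta,\alpha,\beta)$, such that $V(\alpha\triangleleft\alpha)=\alpha\triangleright\alpha$, $V(\hat\beta\triangleright\beta)=\hat\beta\triangleleft\beta$, $V(\hat\beta\triangleright\hat\beta)=\alpha\triangleright\hat\beta$, $V(\beta\triangleleft\alpha)=\beta\triangleleft\beta$,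 and such that the pentagon equation $V_{23}V_{12}=V_{12}V_{13}V_{23}$ holds on the triple relative tensor product $H_{\hat\beta}\otimes{}_\alpha H_{\hat\beta}\otimes{}_\alpha H$, where $V_{13}=\Sigma_{23}(V\otimes\mathrm{Id})(\mathrm{Id}\otimes\Sigma)$ is formed with the flips of the second and third leg. For a module $(H,\alpha)$ let $\alpha^\infty$ be the set of sequences $(\eta_n)_n$ in $\alpha$ for which $\sum_n\eta_n^*\eta_n$ converges (unconditionally) in norm. For $A\subseteq L(H)$, $\xi\in\beta^\infty$ and $\eta\in\alpha^\infty$ let $\omega_{\xi,\eta}:A\to L(\mathfrak K)$, $T\mapsto\sum_n\xi_n^*T\eta_n$, and $\Omega_{\beta,\alpha}(A)=\{\omega_{\xi,\eta}\}$. Put $$\tilde\Omega_{\beta,\alpha}=\Omega_{\beta,\alpha}(\rho_{\hat\beta}(\mathfrak B)'),\qquad \tilde\Omega_{\alpha,\hat\beta}=\Omega_{\alpha,\hat\beta}(\rho_\beta(\mathfrak B)').$$ The linear maps $\hat\pi_V:\tilde\Omega_{\beta,\alpha}\to\rho_\beta(\mathfrak B)'$ and $\pi_V:\tilde\Omega_{\alpha,\hat\beta}\to\rho_{\hat\beta}(\mathfrak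 B)'$ are given by $$\hat\pi_V(\omega_{\xi,\eta})=\sum_n\langle\xi_n|_2V|\eta_n\rangle_2,\qquad \pi_V(\omega_{\eta,\zeta})=\sum_n\langle\eta_n|_1V|\zeta_n\rangle_1 ,$$ and the Fourier algebra and the dual Fourier algebra are $\hat A^0_V=\hat\pi_V(\tilde\Omega_{\beta,\alpha})$ and $A^0_V=\pi_V(\tilde\Omega_{\alpha,\hat\beta})$. For $z\in\rho_{\hat\beta}(\mathfrak B)'$ and $y\in\rho_\beta(\mathfrak B)'$ let $$\Delta_V(z)=V(z\otimes\mathrm{Id})V^*\in(\rho_{\hat\beta}(\mathfrak B)\otimes\rho_{\hat\beta}(\mathfrak B))',\qquad \hat\Delta_V(y)=V^*(\mathrm{Id}\otimes y)V\in(\rho_\beta(\mathfrak B)\otimes\rho_\beta(\mathfrak B))',$$ spaces of operators on $H_\alpha\otimes{}_\beta H$ and on $H_{\hat\beta}\otimes{}_\alpha H$, respectively. For $\omega_{\xi,\eta},\omega_{\xi',\eta'}\in\tilde\Omega_{\beta,\alpha}$ let $\omega_{\xi,\eta}\boxtimes\omega_{\xi',\eta'}=\omega_{\theta,\theta'}$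 on $(\rho_{\hat\beta}(\mathfrak B)\otimes\rho_{\hat\beta}(\mathfrak B))'$, where $\theta_{(m,n)}=|\xi'_n\rangle_2\xi_m\in\beta\triangleleft\beta$ and $\theta'_{(m,n)}=|\eta_m\rangle_1\eta'_n\in\alpha\triangleright\alpha$; for $\omega_{\eta,\zeta},\omega_{\eta',\zeta'}\in\tilde\Omega_{\alpha,\hat\beta}$ let $\omega_{\eta,\zeta}\boxtimes\omega_{\eta',\zeta'}=\omega_{\kappa,\kappa'}$ on $(\rho_\beta(\mathfrak B)\otimes\rho_\beta(\mathfrak B))'$, where $\kappa_{(m,n)}=|\eta'_n\rangle_2\eta_m\in\alpha\triangleleft\alpha$ and $\kappa'_{(m,n)}=|\zeta_m\rangle_1\zeta'_n\in\hat\beta\triangleright\hat\beta$ (index set $\mathbb N\times\mathbb N\cong\mathbb N$). These maps do not depend on the choice of the representing sequences. **Proposition.** Let $V$ be a $C^*$-pseudo-multiplicative unitary as above. There exists a bilinear map $(\,\cdot\,|\,\cdot\,):\hat A^0_V\times A^0_V\to L(\mathfrak K)$ with the following properties. 1. $\omega(\pi_V(\upsilon))=\big(\hat\pi_V(\omega)\,\big|\,\pi_V(\upsilon)\big)=\upsilon(\hat\pi_V(\omega))$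 for all $\omega\in\tilde\Omega_{\beta,\alpha}$, $\upsilon\in\tilde\Omega_{\alpha,\hat\beta}$. 2. It is nondegenerate: for each nonzero $\hat a\in\hat A^0_V$ there is $a'\in A^0_V$ with $(\hat a|a')\neq0$, and for each nonzero $a\in A^0_V$ there is $\hat a'\in\hat A^0_V$ with $(\hat a'|a)\neq0$. 3. For all $\omega,\omega'\in\tilde\Omega_{\beta,\alpha}$, $a\in A^0_V$, $\upsilon,\upsilon'\in\tilde\Omega_{\alpha,\hat\beta}$, $\hat a\in\hat A^0_V$, the products $\hat\pi_V(\omega)\hat\pi_V(\omega')$ and $\pi_V(\upsilon)\pi_V(\upsilon')$ lie in $\hat A^0_V$ and $A^0_V$, respectively, and $$\big(\hat\pi_V(\omega)\hat\pi_V(\omega')\,\big|\,a\big)=(\omega\boxtimes\omega')(\Delta_V(a)),\qquad \big(\hat a\,\big|\,\pi_V(\upsilon)\pi_V(\upsilon')\big)=(\upsilon\boxtimes\upsilon')(\hat\Delta_V(\hat a)).$$ -/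

import Mathlib

open ContinuousLinearMap
open scoped InnerProductSpace InnerProduct
set_option linter.unusedSectionVars false

namespace CPMU

section Operators

variable {X E F G : Type*}
  [NormedAddCommGroup X] [InnerProductSpace ℂ X] [CompleteSpace X]
  [NormedAddCommGroup E] [InnerProductSpace ℂ E] [CompleteSpace E]
  [NormedAddCommGroup F] [InnerProductSpace ℂ F] [CompleteSpace F]
  [NormedAddCommGroup G] [InnerProductSpace ℂ G] [CompleteSpace G]

/-- The closed linear span `[S]` of a subset `S` of a normed space. -/
def clspan {N : Type*} [NormedAddCommGroup N] [NormedSpace ℂ N] (S : Set N) : Submodule ℂ N :=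
  (Submodule.span ℂ S).topologicalClosure

/-- `[J X] = E` for a family `J` of operators from `X` to `E`. -/
def Total {ι : Type*} (J : ι → X →L[ℂ] E) : Prop :=
  clspan {e : E | ∃ i x, J i x = e} = ⊤

theorem Total.induction {ι : Type*} {J : ι → X →L[ℂ] E} (hJ : Total J) {p : E → Prop}
    (hc : IsClosed {e | p e}) (h0 : p 0) (hadd : ∀ x y, p x → p y → p (x + y))
    (hsm : ∀ (c : ℂ) x, p x → p (c • x)) (hmem : ∀ i x, p (J i x)) (e : E) : p e := by
  let S : Submodule ℂ E :=
    { carrier := {e | p e}, add_mem' := fun ha hb => hadd _ _ ha hb, zero_mem' := h0,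
      smul_mem' := fun c x hx => hsm c x hx }
  have h1 : clspan {e : E | ∃ i x, J i x = e} ≤ S := by
    refine Submodule.topologicalClosure_minimal _ (Submodule.span_le.2 ?_) hc
    rintro _ ⟨i, x, rfl⟩
    exact hmem i x
  rw [hJ] at h1
  exact h1 (Submodule.mem_top : e ∈ ⊤)

theorem Total.ext {ι : Type*} {J : ι → X →L[ℂ] E} (hJ : Total J) {S T : E →L[ℂ] F}
    (h : ∀ i, S ∘L J i = T ∘L J i) : S = T := by
  ext e
  refine hJ.induction (p := fun e => S e = T e) (isClosed_eq S.continuous T.continuous)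
    (by simp) (fun x y hx hy => by simp [hx, hy]) (fun c x hx => by simp [hx])
    (fun i x => ?_) e
  exact DFunLike.congr_fun (h i) x

theorem Total.ext₂ {ι κ : Type*} {J : ι → X →L[ℂ] E} (hJ : Total J) {L : κ → G →L[ℂ] F}
    (hL : Total L) {S T : E →L[ℂ] F}
    (h : ∀ i k, (L k)† ∘L S ∘L J i = (L k)† ∘L T ∘L J i) : S = T := by
  refine hJ.ext fun i => ?_
  have : (S ∘L J i)† = (T ∘L J i)† := by
    refine hL.ext fun k => ?_
    have := congrArg adjoint (h i k)
    simpa [adjoint_comp, ContinuousLinearMap.comp_assoc] using this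
  simpa using congrArg adjoint this

theorem Total.comp {ι κ : Type*} {J : ι → X →L[ℂ] E} (hJ : Total J) {L : κ → E →L[ℂ] F}
    (hL : Total L) : Total (fun p : κ × ι => L p.1 ∘L J p.2) := by
  unfold Total
  rw [eq_top_iff]
  rintro f -
  refine hL.induction (p := fun f => f ∈ clspan _) (Submodule.isClosed_topologicalClosure _)
    (Submodule.zero_mem _) (fun _ _ => Submodule.add_mem _) (fun c _ => Submodule.smul_mem _ c)
    (fun k e => ?_) f
  refine hJ.induction (p := fun e => L k e ∈ clspan _)
    ((Submodule.isClosed_topologicalClosure _).preimage (L k).continuous)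
    (by rw [map_zero]; exact Submodule.zero_mem _)
    (fun _ _ h h' => by rw [map_add]; exact Submodule.add_mem _ h h')
    (fun c _ h => by rw [map_smul]; exact Submodule.smul_mem _ c h) (fun i x => ?_) e
  exact Submodule.le_topologicalClosure _ (Submodule.subset_span ⟨(k, i), x, rfl⟩)

theorem Total.range_comp {ι κ : Type*} {J : ι → X →L[ℂ] E} (hJ : Total J) (f : κ → ι)
    (hf : Function.Surjective f) : Total (J ∘ f) := by
  unfold Total at *
  rw [← hJ]
  congr 1
  ext e
  constructor
  · rintro ⟨k, x, rfl⟩; exact ⟨f k, x, rfl⟩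
  · rintro ⟨i, x, rfl⟩; obtain ⟨k, rfl⟩ := hf i; exact ⟨k, x, rfl⟩

/-- Extension of an operator that is given on a total family. -/
theorem Total.exists_extend {ι : Type*} {J : ι → X →L[ℂ] E} (hJ : Total J)
    (L : ι → X →L[ℂ] F) (C : ℝ) (hC : 0 ≤ C)
    (h : ∀ v : ι →₀ X, ‖v.sum fun i x => L i x‖ ≤ C * ‖v.sum fun i x => J i x‖) :
    ∃ T : E →L[ℂ] F, (∀ i, T ∘L J i = L i) ∧ ‖T‖ ≤ C := by
  let f : (ι →₀ X) →ₗ[ℂ] E := Finsupp.lsum ℂ fun i => (J i).toLinearMap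
  let g : (ι →₀ X) →ₗ[ℂ] F := Finsupp.lsum ℂ fun i => (L i).toLinearMap
  have hfg : ∀ v, ‖g v‖ ≤ C * ‖f v‖ := fun v => by simpa [f, g] using h v
  have hker : LinearMap.ker f ≤ LinearMap.ker g := fun v hv => by
    have := hfg v
    rw [LinearMap.mem_ker.1 hv] at this
    simpa using this
  let g0 : LinearMap.range f →ₗ[ℂ] F :=
    ((LinearMap.ker f).liftQ g hker) ∘ₗ f.quotKerEquivRange.symm.toLinearMap
  have hg0 : ∀ v, g0 ⟨f v, v, rfl⟩ = g v := fun v => by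
    have : f.quotKerEquivRange.symm ⟨f v, v, rfl⟩ = Submodule.Quotient.mk v := by
      rw [LinearEquiv.symm_apply_eq]; rfl
    simp only [g0, LinearMap.comp_apply, LinearEquiv.coe_coe, this]
    rfl
  have hb : ∀ x, ‖g0 x‖ ≤ C * ‖x‖ := by
    rintro ⟨_, v, rfl⟩
    rw [hg0]; exact hfg v
  let g1 : LinearMap.range f →L[ℂ] F := g0.mkContinuous C hb
  have hdense : DenseRange (LinearMap.range f).subtypeL := by
    have : (LinearMap.range f).topologicalClosure = ⊤ := by
      rw [eq_top_iff, ← hJ]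
      refine Submodule.topologicalClosure_mono (Submodule.span_le.2 ?_)
      rintro _ ⟨i, x, rfl⟩
      exact ⟨Finsupp.single i x, by simp [f]⟩
    have h2 := (Submodule.dense_iff_topologicalClosure_eq_top).2 this
    have h3 : Set.range (LinearMap.range f).subtypeL = (LinearMap.range f : Set E) :=
      Subtype.range_coe
    rw [DenseRange, h3]
    exact h2
  have hui : IsUniformInducing (LinearMap.range f).subtypeL :=
    isUniformEmbedding_subtype_val.isUniformInducing
  refine ⟨g1.extend (LinearMap.range f).subtypeL, fun i => ?_, ?_⟩
  · ext x
    have := g1.extend_eq hdense hui ⟨f (Finsupp.single i x), _, rfl⟩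
    have h3 : g1 ⟨f (Finsupp.single i x), _, rfl⟩ = L i x := by
      change g0 _ = _
      rw [hg0]; simp [g]
    rw [h3] at this
    simpa [f] using this
  · have := g1.opNorm_extend_le (e := (LinearMap.range f).subtypeL) (N := 1) hdense
      (fun x => by simp)
    refine this.trans ?_
    simpa using g0.mkContinuous_norm_le hC hb

/-- Two total families with the same inner products are related by a unitary. -/
theorem Total.exists_unitary {ι : Type*} {J : ι → X →L[ℂ] E} (hJ : Total J)
    {L : ι → X →L[ℂ] F} (hL : Total L) (h : ∀ i j, (J i)† ∘L J j = (L i)† ∘L L j) :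
    ∃ U : E ≃ₗᵢ[ℂ] F, ∀ i x, U (J i x) = L i x := by
  have key : ∀ v : ι →₀ X, ‖v.sum fun i x => L i x‖ = ‖v.sum fun i x => J i x‖ := by
    intro v
    have : ⟪v.sum fun i x => L i x, v.sum fun i x => L i x⟫_ℂ
        = ⟪v.sum fun i x => J i x, v.sum fun i x => J i x⟫_ℂ := by
      simp only [Finsupp.sum, sum_inner, inner_sum]
      refine Finset.sum_congr rfl fun i _ => Finset.sum_congr rfl fun j _ => ?_
      rw [← adjoint_inner_right, ← adjoint_inner_right]
      have := DFunLike.congr_fun (h j i) (v i)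
      simp only [ContinuousLinearMap.comp_apply] at this
      rw [this]
    rw [@norm_eq_sqrt_re_inner ℂ, @norm_eq_sqrt_re_inner ℂ, this]
  obtain ⟨T, hT, hTn⟩ := hJ.exists_extend L 1 zero_le_one fun v => by rw [key, one_mul]
  obtain ⟨S, hS, hSn⟩ := hL.exists_extend J 1 zero_le_one fun v => by rw [key, one_mul]
  have hST : S ∘L T = ContinuousLinearMap.id ℂ E := hJ.ext fun i => by
    rw [ContinuousLinearMap.comp_assoc, hT, hS, ContinuousLinearMap.id_comp]
  have hTS : T ∘L S = ContinuousLinearMap.id ℂ F := hL.ext fun i => by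
    rw [ContinuousLinearMap.comp_assoc, hS, hT, ContinuousLinearMap.id_comp]
  have h1 : ∀ x, S (T x) = x := fun x => DFunLike.congr_fun hST x
  have h2 : ∀ x, T (S x) = x := fun x => DFunLike.congr_fun hTS x
  have hT1 : ∀ x, ‖T x‖ ≤ ‖x‖ := fun x =>
    (T.le_of_opNorm_le hTn x).trans (by simp)
  have hS1 : ∀ x, ‖S x‖ ≤ ‖x‖ := fun x =>
    (S.le_of_opNorm_le hSn x).trans (by simp)
  let U : E ≃ₗ[ℂ] F := LinearEquiv.ofLinearMap T.toLinearMap S.toLinearMap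
    (by ext x; exact h2 x) (by ext x; exact h1 x)
  refine ⟨⟨U, fun x => le_antisymm (hT1 x) ?_⟩, fun i x => DFunLike.congr_fun (hT i) x⟩
  calc ‖x‖ = ‖S (T x)‖ := by rw [h1]
    _ ≤ ‖T x‖ := hS1 _

theorem norm_comp_le_of_commute (T : X →L[ℂ] E) (D : X →L[ℂ] X) (h : Commute (T† ∘L T) D)
    (x : X) : ‖T (D x)‖ ≤ ‖D‖ * ‖T x‖ := by
  let P : X →L[ℂ] X := T† ∘L T
  have hP : 0 ≤ P := by
    rw [nonneg_iff_isPositive]; exact isPositive_adjoint_comp_self T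
  let C : X →L[ℂ] X := CFC.sqrt P
  have hC0 : 0 ≤ C := CFC.sqrt_nonneg P
  have hCP : C * C = P := CFC.sqrt_mul_sqrt_self P hP
  have hCa : C† = C := (IsSelfAdjoint.of_nonneg hC0).adjoint_eq
  have hCD : Commute C D := h.cfcₙ_nnreal _
  have hn : ∀ y, ‖C y‖ = ‖T y‖ := fun y => by
    have : ⟪C y, C y⟫_ℂ = ⟪T y, T y⟫_ℂ := by
      rw [← adjoint_inner_right C, ← adjoint_inner_right T, hCa]
      exact congrArg (fun z => ⟪y, z⟫_ℂ) (DFunLike.congr_fun hCP y)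
    rw [@norm_eq_sqrt_re_inner ℂ, @norm_eq_sqrt_re_inner ℂ, this]
  rw [← hn, ← hn]
  have : C (D x) = D (C x) := DFunLike.congr_fun hCD.eq x
  rw [this]
  exact D.le_opNorm _

/-- The row operator `(x_i)_i ↦ ∑ J_i x_i` of a finite family. -/
noncomputable def rowOp {ι : Type*} [Fintype ι] (J : ι → X →L[ℂ] E) :
    PiLp 2 (fun _ : ι => X) →L[ℂ] E :=
  ∑ i, J i ∘L (PiLp.proj 2 (fun _ : ι => X) i : PiLp 2 (fun _ : ι => X) →L[ℂ] X)

theorem rowOp_apply {ι : Type*} [Fintype ι] (J : ι → X →L[ℂ] E)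
    (x : PiLp 2 (fun _ : ι => X)) : rowOp J x = ∑ i, J i (x i) := by
  simp [rowOp]

theorem rowOp_adjoint_apply {ι : Type*} [Fintype ι] (J : ι → X →L[ℂ] E) (e : E) (i : ι) :
    (adjoint (rowOp J) e) i = adjoint (J i) e := by
  have : adjoint (rowOp J) e = WithLp.toLp 2 (fun i => adjoint (J i) e) := by
    refine ext_inner_left ℂ fun v => ?_
    rw [adjoint_inner_right, rowOp_apply, sum_inner, PiLp.inner_apply]
    simp [adjoint_inner_right]
  rw [this]

/-- The diagonal operator `(x_i)_i ↦ (z x_i)_i`. -/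
noncomputable def diagOp (ι : Type*) [Fintype ι] (z : X →L[ℂ] E) :
    PiLp 2 (fun _ : ι => X) →L[ℂ] PiLp 2 (fun _ : ι => E) :=
  LinearMap.mkContinuous
    { toFun := fun x => WithLp.toLp 2 (fun i => z (x i))
      map_add' := fun x y => by ext i; simp
      map_smul' := fun c x => by ext i; simp } ‖z‖ (fun x => by
      rw [← sq_le_sq₀ (norm_nonneg _) (by positivity), mul_pow, PiLp.norm_sq_eq_of_L2,
        PiLp.norm_sq_eq_of_L2, Finset.mul_sum]
      refine Finset.sum_le_sum fun i _ => ?_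
      rw [← mul_pow]
      gcongr
      exact z.le_opNorm _)

theorem diagOp_apply {ι : Type*} [Fintype ι] (z : X →L[ℂ] E) (x : PiLp 2 (fun _ : ι => X))
    (i : ι) : diagOp ι z x i = z (x i) := rfl

theorem norm_diagOp_le (ι : Type*) [Fintype ι] (z : X →L[ℂ] E) : ‖diagOp ι z‖ ≤ ‖z‖ :=
  LinearMap.mkContinuous_norm_le _ (norm_nonneg _) _

theorem rowOp_commute_diagOp {ι : Type*} [Fintype ι] (J : ι → X →L[ℂ] E) (z : X →L[ℂ] X)
    (h : ∀ i j, Commute ((J i)† ∘L J j) z) : Commute ((rowOp J)† ∘L rowOp J) (diagOp ι z) := by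
  ext x i
  change adjoint (rowOp J) (rowOp J (diagOp ι z x)) i
    = z (adjoint (rowOp J) (rowOp J x) i)
  rw [rowOp_adjoint_apply, rowOp_adjoint_apply, rowOp_apply, rowOp_apply, map_sum, map_sum,
    map_sum]
  exact Finset.sum_congr rfl fun j _ => DFunLike.congr_fun (h i j).eq (x j)

theorem norm_sum_comp_le {ι : Type*} (J : ι → X →L[ℂ] E) (z : X →L[ℂ] X)
    (h : ∀ i j, Commute ((J i)† ∘L J j) z) (v : ι →₀ X) :
    ‖v.sum fun i x => J i (z x)‖ ≤ ‖z‖ * ‖v.sum fun i x => J i x‖ := by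
  let J' : v.support → X →L[ℂ] E := fun i => J i
  let x : PiLp 2 (fun _ : v.support => X) := WithLp.toLp 2 (fun i => v i)
  have h1 : (v.sum fun i x => J i (z x)) = rowOp J' (diagOp _ z x) := by
    rw [rowOp_apply, Finsupp.sum, ← Finset.sum_coe_sort]; rfl
  have h2 : (v.sum fun i x => J i x) = rowOp J' x := by
    rw [rowOp_apply, Finsupp.sum, ← Finset.sum_coe_sort]
  rw [h1, h2]
  refine (norm_comp_le_of_commute _ _ (rowOp_commute_diagOp J' z fun i j => h _ _) _).trans ?_
  gcongr
  exact norm_diagOp_le _ _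

/-- `amplify J z` is the operator `T` with `T (J i x) = J i (z x)` for all `i` and `x`. -/
noncomputable def amplify {ι : Type*} (J : ι → X →L[ℂ] E) (z : X →L[ℂ] X) : E →L[ℂ] E :=
  Classical.epsilon fun T => ∀ i, T ∘L J i = J i ∘L z

theorem Total.exists_amplify {ι : Type*} {J : ι → X →L[ℂ] E} (hJ : Total J) (z : X →L[ℂ] X)
    (h : ∀ i j, Commute ((J i)† ∘L J j) z) :
    ∃ T : E →L[ℂ] E, (∀ i, T ∘L J i = J i ∘L z) ∧ ‖T‖ ≤ ‖z‖ :=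
  hJ.exists_extend (fun i => J i ∘L z) ‖z‖ (norm_nonneg _) (norm_sum_comp_le J z h)

theorem Total.amplify_comp {ι : Type*} {J : ι → X →L[ℂ] E} (hJ : Total J) (z : X →L[ℂ] X)
    (h : ∀ i j, Commute ((J i)† ∘L J j) z) (i : ι) : amplify J z ∘L J i = J i ∘L z :=
  Classical.epsilon_spec (p := fun T : E →L[ℂ] E => ∀ i, T ∘L J i = J i ∘L z)
    (let ⟨T, hT, _⟩ := hJ.exists_amplify z h; ⟨T, hT⟩) i

theorem Total.norm_amplify_le {ι : Type*} {J : ι → X →L[ℂ] E} (hJ : Total J) (z : X →L[ℂ] X)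
    (h : ∀ i j, Commute ((J i)† ∘L J j) z) : ‖amplify J z‖ ≤ ‖z‖ := by
  obtain ⟨T, hT, hn⟩ := hJ.exists_amplify z h
  have : amplify J z = T := hJ.ext fun i => by rw [hJ.amplify_comp z h, hT]
  rwa [this]

/-- If `L_i* L_j = J_i* J_j z`, then there is an operator that maps `J_i x` to `L_i x`. -/
theorem Total.exists_ket {ι : Type*} {J : ι → X →L[ℂ] E} (hJ : Total J) (L : ι → X →L[ℂ] F)
    (z : X →L[ℂ] X) (h : ∀ i j, Commute ((J i)† ∘L J j) z)
    (hL : ∀ i j, (L i)† ∘L L j = (J i)† ∘L J j ∘L z) :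
    ∃ T : E →L[ℂ] F, ∀ i, T ∘L J i = L i := by
  obtain ⟨A, hA, hn⟩ := hJ.exists_amplify z h
  obtain ⟨T, hT, -⟩ := hJ.exists_extend L (Real.sqrt ‖z‖) (Real.sqrt_nonneg _) fun v => by
    have : ⟪v.sum fun i x => L i x, v.sum fun i x => L i x⟫_ℂ
        = ⟪v.sum fun i x => J i x, A (v.sum fun i x => J i x)⟫_ℂ := by
      simp only [Finsupp.sum, sum_inner, inner_sum, map_sum]
      refine Finset.sum_congr rfl fun i _ => Finset.sum_congr rfl fun j _ => ?_
      rw [← adjoint_inner_right]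
      have h1 := DFunLike.congr_fun (hL j i) (v i)
      have h2 := DFunLike.congr_fun (hA i) (v i)
      simp only [ContinuousLinearMap.comp_apply] at h1 h2
      rw [h1, h2, adjoint_inner_right]
    have h3 : ‖v.sum fun i x => L i x‖ ^ 2 ≤ ‖z‖ * ‖v.sum fun i x => J i x‖ ^ 2 := by
      rw [← @inner_self_eq_norm_sq ℂ, this]
      refine (re_inner_le_norm _ _).trans ?_
      calc _ ≤ ‖v.sum fun i x => J i x‖ * (‖z‖ * ‖v.sum fun i x => J i x‖) := by
            gcongr; exact A.le_of_opNorm_le hn _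
        _ = _ := by ring
    rw [← sq_le_sq₀ (norm_nonneg _) (by positivity), mul_pow, Real.sq_sqrt (norm_nonneg _)]
    exact h3
  exact ⟨T, hT⟩

/-- The Schur product of two mutually commuting positive operator matrices is positive. -/
theorem schur_nonneg {ι : Type*} (J : ι → X →L[ℂ] E) (L : ι → X →L[ℂ] F)
    (h : ∀ i j k l, Commute ((J i)† ∘L J j) ((L k)† ∘L L l)) (v : ι →₀ X) :
    0 ≤ RCLike.re (v.sum fun i x => v.sum fun j y =>
      ⟪((J j)† ∘L J i) (((L j)† ∘L L i) x), y⟫_ℂ) := by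
  classical
  let I := v.support
  let P : PiLp 2 (fun _ : I => X) →L[ℂ] PiLp 2 (fun _ : I => X) :=
    (rowOp fun i : I => J i)† ∘L rowOp fun i : I => J i
  have hP : 0 ≤ P := by
    rw [nonneg_iff_isPositive]; exact isPositive_adjoint_comp_self _
  let C := CFC.sqrt P
  have hC0 : 0 ≤ C := CFC.sqrt_nonneg P
  have hCP : C * C = P := CFC.sqrt_mul_sqrt_self P hP
  have hCa : C† = C := (IsSelfAdjoint.of_nonneg hC0).adjoint_eq
  have hCD : ∀ k l : I, Commute C (diagOp I ((L k)† ∘L L l)) := fun k l =>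
    (rowOp_commute_diagOp (fun i : I => J i) _ fun i j => h _ _ _ _).cfcₙ_nnreal _
  let sg : I → X → PiLp 2 (fun _ : I => X) := fun i x => PiLp.single 2 i x
  let a : I → I → X := fun i k => C (sg i (v i)) k
  have key : ∀ i j : I, ⟪((J j)† ∘L J i) (((L j)† ∘L L i) (v i)), v j⟫_ℂ
      = ∑ k, ⟪L i (a i k), L j (a j k)⟫_ℂ := by
    intro i j
    have e1 : ∀ u, ((J j)† ∘L J i) u = P (sg i u) j := by
      intro u
      change _ = adjoint (rowOp fun i : I => J i) (rowOp (fun i : I => J i) (sg i u)) j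
      rw [rowOp_adjoint_apply, rowOp_apply, Finset.sum_eq_single i]
      · simp [sg]
      · intro k _ hk
        simp [sg, hk]
      · simp
    have e2 : sg i (((L j)† ∘L L i) (v i)) = diagOp I ((L j)† ∘L L i) (sg i (v i)) := by
      ext k
      rw [diagOp_apply]
      by_cases hk : k = i
      · subst hk; simp [sg]
      · simp [sg, hk]
    have e3 : ∀ u : PiLp 2 (fun _ : I => X), ⟪u j, v j⟫_ℂ = ⟪u, sg j (v j)⟫_ℂ := by
      intro u
      rw [PiLp.inner_apply, Finset.sum_eq_single j]
      · simp [sg]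
      · intro k _ hk
        simp [sg, hk]
      · simp
    rw [e1, e3, e2, ← hCP]
    change ⟪C (C _), _⟫_ℂ = _
    rw [← adjoint_inner_right C, hCa]
    have e4 : C (diagOp I ((L j)† ∘L L i) (sg i (v i)))
        = diagOp I ((L j)† ∘L L i) (C (sg i (v i))) :=
      DFunLike.congr_fun (hCD j i).eq _
    rw [e4, PiLp.inner_apply]
    refine Finset.sum_congr rfl fun k _ => ?_
    rw [diagOp_apply]
    change ⟪adjoint (L j) (L i _), _⟫_ℂ = _
    rw [adjoint_inner_left]
  have : (v.sum fun i x => v.sum fun j y => ⟪((J j)† ∘L J i) (((L j)† ∘L L i) x), y⟫_ℂ)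
      = ∑ k : I, ⟪∑ i : I, L i (a i k), ∑ j : I, L j (a j k)⟫_ℂ := by
    have r : ∀ k : I, ⟪∑ i : I, L i (a i k), ∑ j : I, L j (a j k)⟫_ℂ
        = ∑ i : I, ∑ j : I, ⟪L i (a i k), L j (a j k)⟫_ℂ := fun k => by
      rw [sum_inner]
      exact Finset.sum_congr rfl fun i _ => inner_sum _ _ _
    rw [Finset.sum_congr rfl fun k _ => r k, Finset.sum_comm, Finsupp.sum,
      ← Finset.sum_coe_sort]
    refine Finset.sum_congr rfl fun i _ => ?_
    rw [Finset.sum_comm, Finsupp.sum, ← Finset.sum_coe_sort]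
    exact Finset.sum_congr rfl fun j _ => key i j
  rw [this, map_sum]
  exact Finset.sum_nonneg fun k _ => inner_self_nonneg

end Operators

section Modules

variable {𝔎 H K X Y Z : Type*}
  [NormedAddCommGroup 𝔎] [InnerProductSpace ℂ 𝔎] [CompleteSpace 𝔎]
  [NormedAddCommGroup H] [InnerProductSpace ℂ H] [CompleteSpace H]
  [NormedAddCommGroup K] [InnerProductSpace ℂ K] [CompleteSpace K]
  [NormedAddCommGroup X] [InnerProductSpace ℂ X] [CompleteSpace X]
  [NormedAddCommGroup Y] [InnerProductSpace ℂ Y] [CompleteSpace Y]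
  [NormedAddCommGroup Z] [InnerProductSpace ℂ Z] [CompleteSpace Z]

/-- A `C*`-base `(𝔎, 𝔅, 𝔅†)`: two commuting nondegenerate `C*`-algebras of operators on a
Hilbert space `𝔎`. -/
structure CStarBase (𝔎 : Type*) [NormedAddCommGroup 𝔎] [InnerProductSpace ℂ 𝔎]
    [CompleteSpace 𝔎] where
  B : NonUnitalStarSubalgebra ℂ (𝔎 →L[ℂ] 𝔎)
  Bd : NonUnitalStarSubalgebra ℂ (𝔎 →L[ℂ] 𝔎)
  isClosed_B : IsClosed (B : Set (𝔎 →L[ℂ] 𝔎))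
  isClosed_Bd : IsClosed (Bd : Set (𝔎 →L[ℂ] 𝔎))
  nondegenerate_B : clspan {ζ : 𝔎 | ∃ x ∈ B, ∃ ζ' : 𝔎, x ζ' = ζ} = ⊤
  nondegenerate_Bd : clspan {ζ : 𝔎 | ∃ x ∈ Bd, ∃ ζ' : 𝔎, x ζ' = ζ} = ⊤
  commute : ∀ x ∈ B, ∀ y ∈ Bd, Commute x y

/-- The opposite base `𝔟† = (𝔎, 𝔅†, 𝔅)`. -/
abbrev CStarBase.op (b : CStarBase 𝔎) : CStarBase 𝔎 where
  B := b.Bd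
  Bd := b.B
  isClosed_B := b.isClosed_Bd
  isClosed_Bd := b.isClosed_B
  nondegenerate_B := b.nondegenerate_Bd
  nondegenerate_Bd := b.nondegenerate_B
  commute x hx y hy := (b.commute y hy x hx).symm

/-- A `C*`-`𝔟`-module structure `α` on a Hilbert space `H`: a closed subspace
`α ⊆ L(𝔎, H)` with `[α 𝔎] = H`, `[α 𝔅] = α` and `[α* α] = 𝔅`. -/
structure BaseModule (b : CStarBase 𝔎) (H : Type*) [NormedAddCommGroup H]
    [InnerProductSpace ℂ H] [CompleteSpace H] where
  space : Submodule ℂ (𝔎 →L[ℂ] H)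
  isClosed_space : IsClosed (space : Set (𝔎 →L[ℂ] H))
  total_space : Total (fun ξ : space => (ξ : 𝔎 →L[ℂ] H))
  space_base : clspan {x : 𝔎 →L[ℂ] H | ∃ ξ ∈ space, ∃ c ∈ b.B, ξ ∘L c = x} = space
  inner_space : (clspan {x : 𝔎 →L[ℂ] 𝔎 | ∃ ξ ∈ space, ∃ ξ' ∈ space, ξ† ∘L ξ' = x} :
    Set (𝔎 →L[ℂ] 𝔎)) = b.B

variable {a b c d : CStarBase 𝔎}

theorem BaseModule.inner_mem (α : BaseModule b H) (ξ ξ' : α.space) :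
    (ξ : 𝔎 →L[ℂ] H)† ∘L (ξ' : 𝔎 →L[ℂ] H) ∈ b.B := by
  have : (ξ : 𝔎 →L[ℂ] H)† ∘L (ξ' : 𝔎 →L[ℂ] H) ∈ (b.B : Set (𝔎 →L[ℂ] 𝔎)) := by
    rw [← α.inner_space]
    exact Submodule.le_topologicalClosure _
      (Submodule.subset_span ⟨ξ, ξ.2, ξ', ξ'.2, rfl⟩)
  exact this

theorem BaseModule.inner_commute (α : BaseModule b H) {x : 𝔎 →L[ℂ] 𝔎} (hx : x ∈ b.Bd)
    (ξ ξ' : α.space) : Commute ((ξ : 𝔎 →L[ℂ] H)† ∘L (ξ' : 𝔎 →L[ℂ] H)) x :=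
  b.commute _ (α.inner_mem ξ ξ') _ hx

/-- The representation `ρ_α : 𝔅† → L(H)`, `ρ_α(x) ξ ζ = ξ x ζ`. -/
noncomputable def rho (α : BaseModule b H) (x : 𝔎 →L[ℂ] 𝔎) : H →L[ℂ] H :=
  amplify (fun ξ : α.space => (ξ : 𝔎 →L[ℂ] H)) x

theorem rho_comp (α : BaseModule b H) {x : 𝔎 →L[ℂ] 𝔎} (hx : x ∈ b.Bd) (ξ : α.space) :
    rho α x ∘L (ξ : 𝔎 →L[ℂ] H) = (ξ : 𝔎 →L[ℂ] H) ∘L x :=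
  α.total_space.amplify_comp x (α.inner_commute hx) ξ

theorem rho_unique (α : BaseModule b H) {x : 𝔎 →L[ℂ] 𝔎} (hx : x ∈ b.Bd) {T : H →L[ℂ] H}
    (hT : ∀ ξ : α.space, T ∘L (ξ : 𝔎 →L[ℂ] H) = (ξ : 𝔎 →L[ℂ] H) ∘L x) : T = rho α x :=
  α.total_space.ext fun ξ => by rw [hT, rho_comp α hx]

theorem norm_rho_le (α : BaseModule b H) {x : 𝔎 →L[ℂ] 𝔎} (hx : x ∈ b.Bd) :
    ‖rho α x‖ ≤ ‖x‖ :=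
  α.total_space.norm_amplify_le x (α.inner_commute hx)

theorem rho_add (α : BaseModule b H) {x y : 𝔎 →L[ℂ] 𝔎} (hx : x ∈ b.Bd) (hy : y ∈ b.Bd) :
    rho α (x + y) = rho α x + rho α y :=
  (rho_unique α (add_mem hx hy) fun ξ => by
    rw [ContinuousLinearMap.add_comp, rho_comp α hx, rho_comp α hy,
      ContinuousLinearMap.comp_add]).symm

theorem rho_smul (α : BaseModule b H) (r : ℂ) {x : 𝔎 →L[ℂ] 𝔎} (hx : x ∈ b.Bd) :
    rho α (r • x) = r • rho α x :=
  (rho_unique α (SMulMemClass.smul_mem r hx) fun ξ => by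
    rw [ContinuousLinearMap.smul_comp, rho_comp α hx, ContinuousLinearMap.comp_smul]).symm

theorem rho_adjoint (α : BaseModule b H) {x : 𝔎 →L[ℂ] 𝔎} (hx : x ∈ b.Bd) :
    (rho α x)† = rho α (x†) := by
  have hx' : x† ∈ b.Bd := star_mem hx
  refine α.total_space.ext₂ α.total_space fun ξ ξ' => ?_
  rw [rho_comp α hx', ← ContinuousLinearMap.comp_assoc, ← adjoint_comp, rho_comp α hx,
    adjoint_comp, ContinuousLinearMap.comp_assoc]
  exact (α.inner_commute hx' ξ' ξ).eq.symm

/-- `ρ_α` as a bounded linear map on `𝔅†`. -/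
noncomputable def rhoL (α : BaseModule b H) : b.Bd →L[ℂ] (H →L[ℂ] H) :=
  LinearMap.mkContinuous
    { toFun := fun x => rho α x
      map_add' := fun x y => rho_add α x.2 y.2
      map_smul' := fun r x => rho_smul α r x.2 } 1
    (fun x => by rw [one_mul]; exact norm_rho_le α x.2)

/-- `[ρ_α(𝔄†) β] = β` for an `𝔞`-module structure `α` and a `𝔟`-module structure `β` on the
same Hilbert space. -/
def RhoStable (α : BaseModule a H) (β : BaseModule b H) : Prop :=
  clspan {x : 𝔎 →L[ℂ] H | ∃ y ∈ a.Bd, ∃ ξ ∈ β.space, rho α y ∘L ξ = x} = β.space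

theorem RhoStable.mem {α : BaseModule a H} {β : BaseModule b H} (h : RhoStable α β)
    {y : 𝔎 →L[ℂ] 𝔎} (hy : y ∈ a.Bd) (ξ : β.space) : rho α y ∘L (ξ : 𝔎 →L[ℂ] H) ∈ β.space := by
  exact h.le (Submodule.le_topologicalClosure _ (Submodule.subset_span ⟨y, hy, ξ, ξ.2, rfl⟩))

theorem RhoStable.commute {α : BaseModule a H} {β : BaseModule b H} (h : RhoStable α β)
    {x y : 𝔎 →L[ℂ] 𝔎} (hx : x ∈ a.Bd) (hy : y ∈ b.Bd) :
    rho α x ∘L rho β y = rho β y ∘L rho α x := by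
  refine β.total_space.ext fun ξ => ?_
  rw [ContinuousLinearMap.comp_assoc, rho_comp β hy, ContinuousLinearMap.comp_assoc,
    ← ContinuousLinearMap.comp_assoc]
  exact (rho_comp β hy ⟨_, h.mem hx ξ⟩).symm

/-! ### The relative tensor product -/

/-- The inner product of the relative tensor product, as an operator-valued kernel:
`⟨ξ ⊗ ζ ⊗ η, ξ' ⊗ ζ' ⊗ η'⟩ = ⟨ζ, ξ* ξ' η* η' ζ'⟩`. -/
noncomputable def rtKernel (β : BaseModule b H) (γ : BaseModule b.op K) :
    Matrix (β.space × γ.space) (β.space × γ.space) (𝔎 →L[ℂ] 𝔎) :=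
  Matrix.of fun p q => ((p.1 : 𝔎 →L[ℂ] H)† ∘L (q.1 : 𝔎 →L[ℂ] H)) ∘L
    ((p.2 : 𝔎 →L[ℂ] K)† ∘L (q.2 : 𝔎 →L[ℂ] K))

theorem rtKernel_commute (β : BaseModule b H) (γ : BaseModule b.op K) (ξ ξ' : β.space)
    (η η' : γ.space) : Commute ((ξ : 𝔎 →L[ℂ] H)† ∘L (ξ' : 𝔎 →L[ℂ] H))
      ((η : 𝔎 →L[ℂ] K)† ∘L (η' : 𝔎 →L[ℂ] K)) :=
  β.inner_commute (γ.inner_mem η η') ξ ξ'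

instance rtKernel_posSemidef (β : BaseModule b H) (γ : BaseModule b.op K) :
    Fact (rtKernel β γ).PosSemidef := by
  have tf := (RKHS.posSemidef_tfae (K := rtKernel β γ)).out 0 2
  refine ⟨tf.2 ⟨?_, fun v => ?_⟩⟩
  · ext1 p q
    have h := (rtKernel_commute β γ p.1 q.1 p.2 q.2).eq
    change ((q.1 : 𝔎 →L[ℂ] H)† ∘L (p.1 : 𝔎 →L[ℂ] H) ∘L
      ((q.2 : 𝔎 →L[ℂ] K)† ∘L (p.2 : 𝔎 →L[ℂ] K)))† = ((p.1 : 𝔎 →L[ℂ] H)† ∘L (q.1 : 𝔎 →L[ℂ] H)) ∘L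
    ((p.2 : 𝔎 →L[ℂ] K)† ∘L (q.2 : 𝔎 →L[ℂ] K))
    refine Eq.trans ?_ h.symm
    simp only [adjoint_comp, adjoint_adjoint, ContinuousLinearMap.comp_assoc]
    rfl
  · exact schur_nonneg (fun p : β.space × γ.space => (p.1 : 𝔎 →L[ℂ] H))
      (fun p : β.space × γ.space => (p.2 : 𝔎 →L[ℂ] K))
      (fun p q r s => rtKernel_commute β γ p.1 q.1 r.2 s.2) v

/-- The relative tensor product `H_β ⊗_𝔟 _γK = β ⊗ 𝔎 ⊗ γ`: the Hilbert space obtained by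
separated completion from the span of the symbols `ξ ⊗ ζ ⊗ η` with the inner product
`⟨ξ ⊗ ζ ⊗ η, ξ' ⊗ ζ' ⊗ η'⟩ = ⟨ζ, ξ* ξ' η* η' ζ'⟩`. -/
def RT (β : BaseModule b H) (γ : BaseModule b.op K) : Type _ := RKHS.OfKernel (rtKernel β γ)

noncomputable instance (β : BaseModule b H) (γ : BaseModule b.op K) :
    NormedAddCommGroup (RT β γ) :=
  inferInstanceAs (NormedAddCommGroup (RKHS.OfKernel (rtKernel β γ)))

noncomputable instance (β : BaseModule b H) (γ : BaseModule b.op K) :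
    InnerProductSpace ℂ (RT β γ) :=
  inferInstanceAs (InnerProductSpace ℂ (RKHS.OfKernel (rtKernel β γ)))

instance (β : BaseModule b H) (γ : BaseModule b.op K) : CompleteSpace (RT β γ) :=
  inferInstanceAs (CompleteSpace (RKHS.OfKernel (rtKernel β γ)))

/-- The operator `ζ ↦ ξ ⊗ ζ ⊗ η`. -/
noncomputable def rtGen (β : BaseModule b H) (γ : BaseModule b.op K)
    (p : β.space × γ.space) : 𝔎 →L[ℂ] RT β γ :=
  RKHS.kerFun (RKHS.OfKernel (rtKernel β γ)) p

theorem rtGen_adjoint_comp (β : BaseModule b H) (γ : BaseModule b.op K)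
    (p q : β.space × γ.space) : (rtGen β γ p)† ∘L rtGen β γ q =
      ((p.1 : 𝔎 →L[ℂ] H)† ∘L (q.1 : 𝔎 →L[ℂ] H)) ∘L
        ((p.2 : 𝔎 →L[ℂ] K)† ∘L (q.2 : 𝔎 →L[ℂ] K)) := by
  have h := RKHS.kernel_apply (RKHS.OfKernel (rtKernel β γ)) p q
  rw [RKHS.OfKernel.kernel_ofKernel] at h
  exact h.symm

theorem total_rtGen (β : BaseModule b H) (γ : BaseModule b.op K) : Total (rtGen β γ) :=
  RKHS.kerFun_dense (RKHS.OfKernel (rtKernel β γ))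

end Modules

section Kets

variable {𝔎 H K X Y Z : Type*}
  [NormedAddCommGroup 𝔎] [InnerProductSpace ℂ 𝔎] [CompleteSpace 𝔎]
  [NormedAddCommGroup H] [InnerProductSpace ℂ H] [CompleteSpace H]
  [NormedAddCommGroup K] [InnerProductSpace ℂ K] [CompleteSpace K]
  [NormedAddCommGroup X] [InnerProductSpace ℂ X] [CompleteSpace X]
  [NormedAddCommGroup Y] [InnerProductSpace ℂ Y] [CompleteSpace Y]
  [NormedAddCommGroup Z] [InnerProductSpace ℂ Z] [CompleteSpace Z]

variable {a b c d : CStarBase 𝔎}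

theorem exists_ket₁ (β : BaseModule b H) (γ : BaseModule b.op K) (ξ : β.space) :
    ∃ T : K →L[ℂ] RT β γ, ∀ η : γ.space, T ∘L (η : 𝔎 →L[ℂ] K) = rtGen β γ (ξ, η) :=
  γ.total_space.exists_ket _ ((ξ : 𝔎 →L[ℂ] H)† ∘L (ξ : 𝔎 →L[ℂ] H))
    (fun η η' => (rtKernel_commute β γ ξ ξ η η').symm) fun η η' => by
      rw [rtGen_adjoint_comp]
      exact (rtKernel_commute β γ ξ ξ η η').eq

theorem exists_ket₂ (β : BaseModule b H) (γ : BaseModule b.op K) (η : γ.space) :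
    ∃ T : H →L[ℂ] RT β γ, ∀ ξ : β.space, T ∘L (ξ : 𝔎 →L[ℂ] H) = rtGen β γ (ξ, η) :=
  β.total_space.exists_ket _ ((η : 𝔎 →L[ℂ] K)† ∘L (η : 𝔎 →L[ℂ] K))
    (fun ξ ξ' => rtKernel_commute β γ ξ ξ' η η) fun ξ ξ' => by
      rw [rtGen_adjoint_comp, ContinuousLinearMap.comp_assoc]

/-- The operator `|ξ⟩₁ : K → H_β ⊗ _γK`, `η ζ ↦ ξ ⊗ ζ ⊗ η`. -/
noncomputable def ket₁ (β : BaseModule b H) (γ : BaseModule b.op K) (ξ : β.space) :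
    K →L[ℂ] RT β γ :=
  (exists_ket₁ β γ ξ).choose

/-- The operator `|η⟩₂ : H → H_β ⊗ _γK`, `ξ ζ ↦ ξ ⊗ ζ ⊗ η`. -/
noncomputable def ket₂ (β : BaseModule b H) (γ : BaseModule b.op K) (η : γ.space) :
    H →L[ℂ] RT β γ :=
  (exists_ket₂ β γ η).choose

theorem ket₁_comp (β : BaseModule b H) (γ : BaseModule b.op K) (ξ : β.space) (η : γ.space) :
    ket₁ β γ ξ ∘L (η : 𝔎 →L[ℂ] K) = rtGen β γ (ξ, η) :=
  (exists_ket₁ β γ ξ).choose_spec η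

theorem ket₂_comp (β : BaseModule b H) (γ : BaseModule b.op K) (ξ : β.space) (η : γ.space) :
    ket₂ β γ η ∘L (ξ : 𝔎 →L[ℂ] H) = rtGen β γ (ξ, η) :=
  (exists_ket₂ β γ η).choose_spec ξ

theorem total_of_comp {ι κ : Type*} {J : ι → 𝔎 →L[ℂ] X} (hJ : Total J) {L : κ → Y →L[ℂ] X}
    (h : ∀ i, ∃ k, ∃ M : 𝔎 →L[ℂ] Y, J i = L k ∘L M) : Total L := by
  unfold Total
  rw [eq_top_iff, ← hJ]
  refine Submodule.topologicalClosure_mono (Submodule.span_mono ?_)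
  rintro _ ⟨i, x, rfl⟩
  obtain ⟨k, M, hM⟩ := h i
  exact ⟨k, M x, by rw [hM]; rfl⟩

theorem total_ket₁ (β : BaseModule b H) (γ : BaseModule b.op K) : Total (ket₁ β γ) :=
  total_of_comp (total_rtGen β γ) fun p => ⟨p.1, p.2, (ket₁_comp β γ p.1 p.2).symm⟩

theorem total_ket₂ (β : BaseModule b H) (γ : BaseModule b.op K) : Total (ket₂ β γ) :=
  total_of_comp (total_rtGen β γ) fun p => ⟨p.2, p.1, (ket₂_comp β γ p.1 p.2).symm⟩

theorem ket₁_adjoint_comp (β : BaseModule b H) (γ : BaseModule b.op K) (ξ ξ' : β.space) :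
    (ket₁ β γ ξ)† ∘L ket₁ β γ ξ' = rho γ ((ξ : 𝔎 →L[ℂ] H)† ∘L (ξ' : 𝔎 →L[ℂ] H)) := by
  refine γ.total_space.ext₂ γ.total_space fun η η' => ?_
  rw [rho_comp γ (β.inner_mem ξ ξ'), ContinuousLinearMap.comp_assoc, ket₁_comp,
    ← ContinuousLinearMap.comp_assoc, ← adjoint_comp, ket₁_comp, rtGen_adjoint_comp]
  exact (rtKernel_commute β γ ξ ξ' η' η).eq

theorem ket₂_adjoint_comp (β : BaseModule b H) (γ : BaseModule b.op K) (η η' : γ.space) :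
    (ket₂ β γ η)† ∘L ket₂ β γ η' = rho β ((η : 𝔎 →L[ℂ] K)† ∘L (η' : 𝔎 →L[ℂ] K)) := by
  refine β.total_space.ext₂ β.total_space fun ξ ξ' => ?_
  rw [rho_comp β (γ.inner_mem η η'), ContinuousLinearMap.comp_assoc, ket₂_comp,
    ← ContinuousLinearMap.comp_assoc, ← adjoint_comp, ket₂_comp, rtGen_adjoint_comp,
    ContinuousLinearMap.comp_assoc]

theorem clspan_le {N : Type*} [NormedAddCommGroup N] [NormedSpace ℂ N] {S : Set N}
    {P : Submodule ℂ N} (hP : IsClosed (P : Set N)) (h : ∀ x ∈ S, x ∈ P) : clspan S ≤ P :=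
  Submodule.topologicalClosure_minimal _ (Submodule.span_le.2 h) hP

theorem subset_clspan {N : Type*} [NormedAddCommGroup N] [NormedSpace ℂ N] {S : Set N}
    {x : N} (h : x ∈ S) : x ∈ clspan S :=
  Submodule.le_topologicalClosure _ (Submodule.subset_span h)

theorem isClosed_clspan {N : Type*} [NormedAddCommGroup N] [NormedSpace ℂ N] (S : Set N) :
    IsClosed (clspan S : Set N) :=
  Submodule.isClosed_topologicalClosure _

/-- A bounded linear map that sends `S` into a closed subspace sends `[S]` into it. -/
theorem clspan_map {N M : Type*} [NormedAddCommGroup N] [NormedSpace ℂ N]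
    [NormedAddCommGroup M] [NormedSpace ℂ M] (f : N →L[ℂ] M) {S : Set N} {P : Submodule ℂ M}
    (hP : IsClosed (P : Set M)) (h : ∀ x ∈ S, f x ∈ P) {x : N} (hx : x ∈ clspan S) : f x ∈ P :=
  clspan_le (P := P.comap f.toLinearMap) (hP.preimage f.continuous) h hx

theorem clspan_comp_left (f : X →L[ℂ] Y) {S : Set (Z →L[ℂ] X)} {P : Submodule ℂ (Z →L[ℂ] Y)}
    (hP : IsClosed (P : Set (Z →L[ℂ] Y))) (h : ∀ x ∈ S, f ∘L x ∈ P) {x : Z →L[ℂ] X}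
    (hx : x ∈ clspan S) : f ∘L x ∈ P :=
  clspan_map (compL ℂ Z X Y f) hP h hx

theorem clspan_comp_right (f : X →L[ℂ] Y) {S : Set (Y →L[ℂ] Z)} {P : Submodule ℂ (X →L[ℂ] Z)}
    (hP : IsClosed (P : Set (X →L[ℂ] Z))) (h : ∀ x ∈ S, x ∘L f ∈ P) {x : Y →L[ℂ] Z}
    (hx : x ∈ clspan S) : x ∘L f ∈ P :=
  clspan_map ((compL ℂ X Y Z).flip f) hP h hx

/-- `[ρ_β(𝔅†) α] = [{ρ_β(η* η')} α]`, since `𝔅† = [γ* γ]`. -/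
theorem rho_comp_mem_clspan {α : BaseModule a H} {β : BaseModule b H} (γ : BaseModule b.op K)
    {y : 𝔎 →L[ℂ] 𝔎} (hy : y ∈ b.Bd) {ξ : 𝔎 →L[ℂ] H} (hξ : ξ ∈ α.space) :
    rho β y ∘L ξ ∈ clspan {x : 𝔎 →L[ℂ] H | ∃ η η' : γ.space, ∃ ξ ∈ α.space,
      rho β ((η : 𝔎 →L[ℂ] K)† ∘L (η' : 𝔎 →L[ℂ] K)) ∘L ξ = x} := by
  set P := clspan {x : 𝔎 →L[ℂ] H | ∃ η η' : γ.space, ∃ ξ ∈ α.space,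
      rho β ((η : 𝔎 →L[ℂ] K)† ∘L (η' : 𝔎 →L[ℂ] K)) ∘L ξ = x} with hP
  let Q : Submodule ℂ (𝔎 →L[ℂ] 𝔎) :=
    { carrier := {y | y ∈ b.Bd ∧ rho β y ∘L ξ ∈ P}
      add_mem' := fun {x y} hx hy => ⟨add_mem hx.1 hy.1, by
        rw [rho_add β hx.1 hy.1, ContinuousLinearMap.add_comp]; exact add_mem hx.2 hy.2⟩
      zero_mem' := ⟨zero_mem _, by
        have : rho β (0 : 𝔎 →L[ℂ] 𝔎) = 0 := (rhoL β).map_zero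
        rw [this, ContinuousLinearMap.zero_comp]; exact zero_mem _⟩
      smul_mem' := fun r x hx => ⟨SMulMemClass.smul_mem r hx.1, by
        rw [rho_smul β r hx.1, ContinuousLinearMap.smul_comp]; exact P.smul_mem _ hx.2⟩ }
  have hQ : IsClosed (Q : Set (𝔎 →L[ℂ] 𝔎)) := by
    have h1 : IsClosed {y : b.Bd | rhoL β y ∘L ξ ∈ P} :=
      (isClosed_clspan _).preimage
        (((compL ℂ 𝔎 H H).flip ξ ∘L rhoL β).continuous)
    have h2 := b.isClosed_Bd.isClosedEmbedding_subtypeVal.isClosedMap _ h1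
    convert h2 using 1
    ext y
    constructor
    · rintro ⟨h, h'⟩; exact ⟨⟨y, h⟩, h', rfl⟩
    · rintro ⟨⟨y, h⟩, h', rfl⟩; exact ⟨h, h'⟩
  have h3 : clspan {x : 𝔎 →L[ℂ] 𝔎 | ∃ ξ ∈ γ.space, ∃ ξ' ∈ γ.space, ξ† ∘L ξ' = x} ≤ Q := by
    refine clspan_le hQ ?_
    rintro _ ⟨η, hη, η', hη', rfl⟩
    exact ⟨γ.inner_mem ⟨η, hη⟩ ⟨η', hη'⟩, subset_clspan ⟨⟨η, hη⟩, ⟨η', hη'⟩, ξ, hξ, rfl⟩⟩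
  have h4 : y ∈ (clspan {x : 𝔎 →L[ℂ] 𝔎 | ∃ ξ ∈ γ.space, ∃ ξ' ∈ γ.space, ξ† ∘L ξ' = x} :
      Set (𝔎 →L[ℂ] 𝔎)) := by
    rw [γ.inner_space]; exact hy
  exact (h3 h4).2

/-- The module structure `[J α]` on `E` for a family `J` of operators from `H` to `E` with
`[J H] = E` and `[α* J* J α] = 𝔄`. -/
noncomputable def BaseModule.ofKets {ι : Type*} (J : ι → H →L[ℂ] X) (hJ : Total J)
    (α : BaseModule a H)
    (h1 : ∀ i j, ∀ ξ ∈ α.space, (J i)† ∘L J j ∘L ξ ∈ α.space)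
    (h2 : ∀ ξ ∈ α.space, ξ ∈ clspan {x | ∃ i j, ∃ ξ ∈ α.space, (J i)† ∘L J j ∘L ξ = x}) :
    BaseModule a X where
  space := clspan {x : 𝔎 →L[ℂ] X | ∃ i, ∃ ξ ∈ α.space, J i ∘L ξ = x}
  isClosed_space := isClosed_clspan _
  total_space := total_of_comp (α.total_space.comp hJ) fun p =>
    ⟨⟨J p.1 ∘L p.2, subset_clspan ⟨p.1, p.2, p.2.2, rfl⟩⟩, ContinuousLinearMap.id ℂ 𝔎, rfl⟩
  space_base := by
    refine le_antisymm (clspan_le (isClosed_clspan _) ?_) (clspan_le (isClosed_clspan _) ?_)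
    · rintro _ ⟨ξ, hξ, c, hc, rfl⟩
      refine clspan_comp_right c (isClosed_clspan _) ?_ hξ
      rintro _ ⟨i, ξ, hξ, rfl⟩
      exact subset_clspan ⟨i, ξ ∘L c, α.space_base.le (subset_clspan ⟨ξ, hξ, c, hc, rfl⟩), rfl⟩
    · rintro _ ⟨i, ξ, hξ, rfl⟩
      refine clspan_comp_left (J i) (isClosed_clspan _) ?_ (α.space_base.ge hξ)
      rintro _ ⟨ξ, hξ, c, hc, rfl⟩
      exact subset_clspan ⟨J i ∘L ξ, subset_clspan ⟨i, ξ, hξ, rfl⟩, c, hc, rfl⟩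
  inner_space := by
    have hBc : IsClosed (a.B.toSubmodule : Set (𝔎 →L[ℂ] 𝔎)) := a.isClosed_B
    refine Set.Subset.antisymm (clspan_le (P := a.B.toSubmodule) hBc ?_) ?_
    · have s1 : ∀ i, ∀ ξ ∈ α.space, ∀ y ∈ clspan {x : 𝔎 →L[ℂ] X | ∃ i, ∃ ξ ∈ α.space,
          J i ∘L ξ = x}, (J i ∘L ξ)† ∘L y ∈ a.B.toSubmodule := by
        intro i ξ hξ y hy
        refine clspan_comp_left ((J i ∘L ξ)†) hBc ?_ hy
        rintro _ ⟨j, ξ', hξ', rfl⟩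
        have := α.inner_mem ⟨ξ, hξ⟩ ⟨_, h1 i j ξ' hξ'⟩
        change (J i ∘L ξ)† ∘L (J j ∘L ξ') ∈ a.B
        rw [adjoint_comp]
        exact this
      rintro _ ⟨x, hx, y, hy, rfl⟩
      refine clspan_comp_left (x†) hBc ?_ hy
      rintro _ ⟨i, ξ, hξ, rfl⟩
      have h := star_mem (s := a.B) (s1 i ξ hξ x hx)
      change x† ∘L (J i ∘L ξ) ∈ a.B
      have e : star ((J i ∘L ξ)† ∘L x) = x† ∘L (J i ∘L ξ) := by
        rw [star_eq_adjoint, adjoint_comp, adjoint_adjoint]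
      rw [← e]
      exact h
    · rw [← α.inner_space]
      refine clspan_le (isClosed_clspan _) ?_
      rintro _ ⟨ξ, hξ, ξ', hξ', rfl⟩
      refine clspan_comp_left (ξ†) (isClosed_clspan _) ?_ (h2 ξ' hξ')
      rintro _ ⟨i, j, ξ', hξ', rfl⟩
      refine subset_clspan ⟨J i ∘L ξ, subset_clspan ⟨i, ξ, hξ, rfl⟩, J j ∘L ξ',
        subset_clspan ⟨j, ξ', hξ', rfl⟩, ?_⟩
      rw [adjoint_comp]
      rfl

theorem BaseModule.ofKets_mem {ι : Type*} (J : ι → H →L[ℂ] X) (hJ : Total J)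
    (α : BaseModule a H) (h1 h2) (i : ι) (ξ : α.space) :
    J i ∘L (ξ : 𝔎 →L[ℂ] H) ∈ (BaseModule.ofKets J hJ α h1 h2).space :=
  subset_clspan ⟨i, ξ, ξ.2, rfl⟩

theorem BaseModule.total_ofKets {ι : Type*} (J : ι → H →L[ℂ] X) (hJ : Total J)
    (α : BaseModule a H) :
    Total (fun p : ι × α.space => J p.1 ∘L (p.2 : 𝔎 →L[ℂ] H)) :=
  α.total_space.comp hJ

theorem rho_ofKets_comp {ι : Type*} (J : ι → H →L[ℂ] X) (hJ : Total J)
    (α : BaseModule a H) (h1 h2) {y : 𝔎 →L[ℂ] 𝔎} (hy : y ∈ a.Bd) (i : ι) :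
    rho (BaseModule.ofKets J hJ α h1 h2) y ∘L J i = J i ∘L rho α y := by
  refine α.total_space.ext fun ξ => ?_
  rw [ContinuousLinearMap.comp_assoc, ContinuousLinearMap.comp_assoc, rho_comp α hy,
    ← ContinuousLinearMap.comp_assoc]
  exact rho_comp (BaseModule.ofKets J hJ α h1 h2) hy ⟨_, BaseModule.ofKets_mem J hJ α h1 h2 i ξ⟩

/-- `α ◁ γ = [|γ⟩₂ α]`, a module structure on `H_β ⊗ _γK`. -/
noncomputable def ltri (α : BaseModule a H) (β : BaseModule b H) (γ : BaseModule b.op K)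
    (h : RhoStable β α) : BaseModule a (RT β γ) :=
  BaseModule.ofKets (ket₂ β γ) (total_ket₂ β γ) α
    (fun η η' ξ hξ => by
      rw [← ContinuousLinearMap.comp_assoc, ket₂_adjoint_comp]
      exact h.mem (γ.inner_mem η η') ⟨ξ, hξ⟩)
    (fun ξ hξ => by
      refine clspan_le (isClosed_clspan _) ?_ (h.ge hξ)
      rintro _ ⟨y, hy, ξ, hξ, rfl⟩
      refine clspan_le (isClosed_clspan _) ?_ (rho_comp_mem_clspan γ hy hξ)
      rintro _ ⟨η, η', ξ, hξ, rfl⟩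
      refine subset_clspan ⟨η, η', ξ, hξ, ?_⟩
      rw [← ContinuousLinearMap.comp_assoc, ket₂_adjoint_comp])

/-- `β ▷ δ = [|β⟩₁ δ]`, a module structure on `H_β ⊗ _γK`. -/
noncomputable def rtri (β : BaseModule b H) (γ : BaseModule b.op K) (δ : BaseModule c K)
    (h : RhoStable γ δ) : BaseModule c (RT β γ) :=
  BaseModule.ofKets (ket₁ β γ) (total_ket₁ β γ) δ
    (fun η η' ξ hξ => by
      rw [← ContinuousLinearMap.comp_assoc, ket₁_adjoint_comp]
      exact h.mem (β.inner_mem η η') ⟨ξ, hξ⟩)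
    (fun ξ hξ => by
      refine clspan_le (isClosed_clspan _) ?_ (h.ge hξ)
      rintro _ ⟨y, hy, ξ, hξ, rfl⟩
      refine clspan_le (isClosed_clspan _) ?_ (rho_comp_mem_clspan (b := b.op) β hy hξ)
      rintro _ ⟨η, η', ξ, hξ, rfl⟩
      refine subset_clspan ⟨η, η', ξ, hξ, ?_⟩
      rw [← ContinuousLinearMap.comp_assoc, ket₁_adjoint_comp])

theorem rho_ltri_comp (α : BaseModule a H) (β : BaseModule b H) (γ : BaseModule b.op K)
    (h : RhoStable β α) {y : 𝔎 →L[ℂ] 𝔎} (hy : y ∈ a.Bd) (η : γ.space) :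
    rho (ltri α β γ h) y ∘L ket₂ β γ η = ket₂ β γ η ∘L rho α y :=
  rho_ofKets_comp _ _ _ _ _ hy η

theorem rho_rtri_comp (β : BaseModule b H) (γ : BaseModule b.op K) (δ : BaseModule c K)
    (h : RhoStable γ δ) {y : 𝔎 →L[ℂ] 𝔎} (hy : y ∈ c.Bd) (ξ : β.space) :
    rho (rtri β γ δ h) y ∘L ket₁ β γ ξ = ket₁ β γ ξ ∘L rho δ y :=
  rho_ofKets_comp _ _ _ _ _ hy ξ

theorem ket₂_comp_mem_ltri (α : BaseModule a H) (β : BaseModule b H) (γ : BaseModule b.op K)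
    (h : RhoStable β α) (η : γ.space) (ξ : α.space) :
    ket₂ β γ η ∘L (ξ : 𝔎 →L[ℂ] H) ∈ (ltri α β γ h).space :=
  BaseModule.ofKets_mem _ _ _ _ _ η ξ

theorem ket₁_comp_mem_rtri (β : BaseModule b H) (γ : BaseModule b.op K) (δ : BaseModule c K)
    (h : RhoStable γ δ) (ξ : β.space) (η : δ.space) :
    ket₁ β γ ξ ∘L (η : 𝔎 →L[ℂ] K) ∈ (rtri β γ δ h).space :=
  BaseModule.ofKets_mem _ _ _ _ _ ξ η

/-! ### Canonical unitaries between relative tensor products -/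

/-- An operator `U` maps the module structure `α` onto `α'`: `U α = α'`. -/
def MapsModule (U : X ≃ₗᵢ[ℂ] Y) (α : BaseModule a X) (α' : BaseModule a Y) : Prop :=
  (fun ξ : 𝔎 →L[ℂ] X => (U : X →L[ℂ] Y) ∘L ξ) '' α.space = α'.space

theorem MapsModule.mem {U : X ≃ₗᵢ[ℂ] Y} {α : BaseModule a X} {α' : BaseModule a Y}
    (h : MapsModule U α α') (ξ : α.space) : (U : X →L[ℂ] Y) ∘L (ξ : 𝔎 →L[ℂ] X) ∈ α'.space := by
  have : (U : X →L[ℂ] Y) ∘L (ξ : 𝔎 →L[ℂ] X) ∈ (α'.space : Set (𝔎 →L[ℂ] Y)) := by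
    rw [← h]; exact ⟨ξ, ξ.2, rfl⟩
  exact this

theorem adjoint_comp_unitary (U : X ≃ₗᵢ[ℂ] Y) :
    (U : X →L[ℂ] Y)† ∘L (U : X →L[ℂ] Y) = ContinuousLinearMap.id ℂ X := by
  ext x
  refine ext_inner_left ℂ fun y => ?_
  change ⟪y, adjoint (U : X →L[ℂ] Y) (U x)⟫_ℂ = ⟪y, x⟫_ℂ
  rw [adjoint_inner_right]
  exact U.inner_map_map y x

theorem adjoint_comp_comp_unitary (U : X ≃ₗᵢ[ℂ] Y) (ξ η : 𝔎 →L[ℂ] X) :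
    (ξ† ∘L (U : X →L[ℂ] Y)†) ∘L ((U : X →L[ℂ] Y) ∘L η) = ξ† ∘L η := by
  rw [ContinuousLinearMap.comp_assoc, ← ContinuousLinearMap.comp_assoc (f := η),
    adjoint_comp_unitary, ContinuousLinearMap.id_comp]

theorem MapsModule.rho_comp {U : X ≃ₗᵢ[ℂ] Y} {α : BaseModule a X} {α' : BaseModule a Y}
    (h : MapsModule U α α') {y : 𝔎 →L[ℂ] 𝔎} (hy : y ∈ a.Bd) :
    (U : X →L[ℂ] Y) ∘L rho α y = rho α' y ∘L (U : X →L[ℂ] Y) := by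
  refine α.total_space.ext fun ξ => ?_
  rw [ContinuousLinearMap.comp_assoc, ContinuousLinearMap.comp_assoc, CPMU.rho_comp α hy]
  exact (CPMU.rho_comp α' hy ⟨_, h.mem ξ⟩).symm

theorem refl_mapsModule (α : BaseModule a X) :
    MapsModule (LinearIsometryEquiv.refl ℂ X) α α := by
  unfold MapsModule
  have : (fun ξ : 𝔎 →L[ℂ] X => ((LinearIsometryEquiv.refl ℂ X : X ≃ₗᵢ[ℂ] X) : X →L[ℂ] X) ∘L ξ)
    = id := rfl
  rw [this, Set.image_id]

theorem exists_rtMap {β : BaseModule b X} {β' : BaseModule b Y} {γ : BaseModule b.op H}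
    {γ' : BaseModule b.op K} {U : X ≃ₗᵢ[ℂ] Y} (hU : MapsModule U β β') {W : H ≃ₗᵢ[ℂ] K}
    (hW : MapsModule W γ γ') :
    ∃ T : RT β γ ≃ₗᵢ[ℂ] RT β' γ', ∀ p : β.space × γ.space, ∀ ζ : 𝔎,
      T (rtGen β γ p ζ) = rtGen β' γ' (⟨_, hU.mem p.1⟩, ⟨_, hW.mem p.2⟩) ζ := by
  refine (total_rtGen β γ).exists_unitary (((total_rtGen β' γ')).range_comp
    (fun p : β.space × γ.space => (⟨_, hU.mem p.1⟩, ⟨_, hW.mem p.2⟩)) ?_) ?_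
  · rintro ⟨⟨ξ, hξ⟩, ⟨η, hη⟩⟩
    obtain ⟨ξ₀, h0, rfl⟩ := (Set.ext_iff.1 hU ξ).2 hξ
    obtain ⟨η₀, h1, rfl⟩ := (Set.ext_iff.1 hW η).2 hη
    exact ⟨(⟨ξ₀, h0⟩, ⟨η₀, h1⟩), rfl⟩
  · intro p q
    simp only [rtGen_adjoint_comp, adjoint_comp]
    rw [adjoint_comp_comp_unitary, adjoint_comp_comp_unitary]

/-- `U ⊗ W : X_β ⊗ _γH → Y_β' ⊗ _γ'K`, `ξ ⊗ ζ ⊗ η ↦ U ξ ⊗ ζ ⊗ W η`, for unitaries with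
`U β = β'` and `W γ = γ'`. -/
noncomputable def rtMap {β : BaseModule b X} {β' : BaseModule b Y} {γ : BaseModule b.op H}
    {γ' : BaseModule b.op K} {U : X ≃ₗᵢ[ℂ] Y} (hU : MapsModule U β β') {W : H ≃ₗᵢ[ℂ] K}
    (hW : MapsModule W γ γ') : RT β γ ≃ₗᵢ[ℂ] RT β' γ' :=
  (exists_rtMap hU hW).choose

theorem exists_flip (β : BaseModule b X) (γ : BaseModule b.op Y) :
    ∃ T : RT β γ ≃ₗᵢ[ℂ] RT (b := b.op) γ β, ∀ p : β.space × γ.space, ∀ ζ : 𝔎,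
      T (rtGen β γ p ζ) = rtGen (b := b.op) γ β (p.2, p.1) ζ := by
  refine (total_rtGen β γ).exists_unitary ((total_rtGen (b := b.op) γ β).range_comp
    (fun p : β.space × γ.space => (p.2, p.1)) fun p => ⟨(p.2, p.1), rfl⟩) ?_
  intro p q
  rw [rtGen_adjoint_comp]
  refine Eq.trans ?_ (rtGen_adjoint_comp (b := b.op) γ β (p.2, p.1) (q.2, q.1)).symm
  exact (rtKernel_commute β γ p.1 q.1 p.2 q.2).eq

/-- The flip `Σ : X_β ⊗ _γY → Y_γ ⊗ _βX`, `ξ ⊗ ζ ⊗ η ↦ η ⊗ ζ ⊗ ξ`. -/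
noncomputable def rtFlip (β : BaseModule b X) (γ : BaseModule b.op Y) :
    RT β γ ≃ₗᵢ[ℂ] RT (b := b.op) γ β :=
  (exists_flip β γ).choose

theorem exists_assoc (β : BaseModule b X) (γ : BaseModule b.op Y) (ε : BaseModule d Y)
    (φ : BaseModule d.op Z) (h1 : RhoStable γ ε) (h2 : RhoStable ε γ) :
    ∃ T : RT (rtri β γ ε h1) φ ≃ₗᵢ[ℂ] RT β (ltri γ ε φ h2),
      ∀ (p : φ.space × β.space) (y : Y),
        T ((ket₂ (rtri β γ ε h1) φ p.1 ∘L ket₁ β γ p.2) y) =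
          (ket₁ β (ltri γ ε φ h2) p.2 ∘L ket₂ ε φ p.1) y := by
  refine ((total_ket₁ β γ).comp (total_ket₂ (rtri β γ ε h1) φ)).exists_unitary
    (((total_ket₂ ε φ).comp (total_ket₁ β (ltri γ ε φ h2))).range_comp Prod.swap
      Prod.swap_surjective) ?_
  intro p q
  have e1 : (ket₂ (rtri β γ ε h1) φ p.1 ∘L ket₁ β γ p.2)† ∘L
      (ket₂ (rtri β γ ε h1) φ q.1 ∘L ket₁ β γ q.2) =
      rho γ ((p.2 : 𝔎 →L[ℂ] X)† ∘L (q.2 : 𝔎 →L[ℂ] X)) ∘L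
        rho ε ((p.1 : 𝔎 →L[ℂ] Z)† ∘L (q.1 : 𝔎 →L[ℂ] Z)) := by
    rw [adjoint_comp, ContinuousLinearMap.comp_assoc, ← ContinuousLinearMap.comp_assoc _
      (ket₂ (rtri β γ ε h1) φ q.1), ket₂_adjoint_comp, rho_rtri_comp _ _ _ _ (φ.inner_mem _ _),
      ← ContinuousLinearMap.comp_assoc, ket₁_adjoint_comp]
  have e2 : (ket₁ β (ltri γ ε φ h2) p.2 ∘L ket₂ ε φ p.1)† ∘L
      (ket₁ β (ltri γ ε φ h2) q.2 ∘L ket₂ ε φ q.1) =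
      rho ε ((p.1 : 𝔎 →L[ℂ] Z)† ∘L (q.1 : 𝔎 →L[ℂ] Z)) ∘L
        rho γ ((p.2 : 𝔎 →L[ℂ] X)† ∘L (q.2 : 𝔎 →L[ℂ] X)) := by
    rw [adjoint_comp, ContinuousLinearMap.comp_assoc, ← ContinuousLinearMap.comp_assoc _
      (ket₁ β (ltri γ ε φ h2) q.2), ket₁_adjoint_comp, rho_ltri_comp _ _ _ _ (β.inner_mem _ _),
      ← ContinuousLinearMap.comp_assoc, ket₂_adjoint_comp]
  refine e1.trans (Eq.trans ?_ e2.symm)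
  exact h1.commute (β.inner_mem _ _) (φ.inner_mem _ _)

/-- The associativity isomorphism `(X_β ⊗ _γY)_{β▷ε} ⊗ _φZ → X_β ⊗ _{γ◁φ}(Y_ε ⊗ _φZ)`, which
identifies `|η⟩₂ |ξ⟩₁ y` with `|ξ⟩₁ |η⟩₂ y` for `ξ ∈ β`, `y ∈ Y`, `η ∈ φ`. -/
noncomputable def rtAssoc (β : BaseModule b X) (γ : BaseModule b.op Y) (ε : BaseModule d Y)
    (φ : BaseModule d.op Z) (h1 : RhoStable γ ε) (h2 : RhoStable ε γ) :
    RT (rtri β γ ε h1) φ ≃ₗᵢ[ℂ] RT β (ltri γ ε φ h2) :=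
  (exists_assoc β γ ε φ h1 h2).choose

theorem exists_sigma₂₃ (p : BaseModule b X) (q : BaseModule b.op Y) (r : BaseModule d X)
    (s : BaseModule d.op Z) (h1 : RhoStable p r) (h2 : RhoStable r p) :
    ∃ T : RT (ltri r p q h1) s ≃ₗᵢ[ℂ] RT (ltri p r s h2) q,
      ∀ (k : s.space × q.space) (x : X),
        T ((ket₂ (ltri r p q h1) s k.1 ∘L ket₂ p q k.2) x) =
          (ket₂ (ltri p r s h2) q k.2 ∘L ket₂ r s k.1) x := by
  refine ((total_ket₂ p q).comp (total_ket₂ (ltri r p q h1) s)).exists_unitary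
    (((total_ket₂ r s).comp (total_ket₂ (ltri p r s h2) q)).range_comp Prod.swap
      Prod.swap_surjective) ?_
  intro k l
  have e1 : (ket₂ (ltri r p q h1) s k.1 ∘L ket₂ p q k.2)† ∘L
      (ket₂ (ltri r p q h1) s l.1 ∘L ket₂ p q l.2) =
      rho p ((k.2 : 𝔎 →L[ℂ] Y)† ∘L (l.2 : 𝔎 →L[ℂ] Y)) ∘L
        rho r ((k.1 : 𝔎 →L[ℂ] Z)† ∘L (l.1 : 𝔎 →L[ℂ] Z)) := by
    rw [adjoint_comp, ContinuousLinearMap.comp_assoc, ← ContinuousLinearMap.comp_assoc _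
      (ket₂ (ltri r p q h1) s l.1), ket₂_adjoint_comp, rho_ltri_comp _ _ _ _ (s.inner_mem _ _),
      ← ContinuousLinearMap.comp_assoc, ket₂_adjoint_comp]
  have e2 : (ket₂ (ltri p r s h2) q k.2 ∘L ket₂ r s k.1)† ∘L
      (ket₂ (ltri p r s h2) q l.2 ∘L ket₂ r s l.1) =
      rho r ((k.1 : 𝔎 →L[ℂ] Z)† ∘L (l.1 : 𝔎 →L[ℂ] Z)) ∘L
        rho p ((k.2 : 𝔎 →L[ℂ] Y)† ∘L (l.2 : 𝔎 →L[ℂ] Y)) := by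
    rw [adjoint_comp, ContinuousLinearMap.comp_assoc, ← ContinuousLinearMap.comp_assoc _
      (ket₂ (ltri p r s h2) q l.2), ket₂_adjoint_comp, rho_ltri_comp _ _ _ _ (q.inner_mem _ _),
      ← ContinuousLinearMap.comp_assoc, ket₂_adjoint_comp]
  refine e1.trans (Eq.trans ?_ e2.symm)
  exact h1.commute (q.inner_mem _ _) (s.inner_mem _ _)

/-- The isomorphism `Σ₂₃ : (X_p ⊗ _qY)_{r◁q} ⊗ _sZ → (X_r ⊗ _sZ)_{p◁s} ⊗ _qY`, which identifies
`|η⟩₂ |ξ⟩₂ x` with `|ξ⟩₂ |η⟩₂ x` for `x ∈ X`, `ξ ∈ q`, `η ∈ s`. -/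
noncomputable def rtSigma₂₃ (p : BaseModule b X) (q : BaseModule b.op Y) (r : BaseModule d X)
    (s : BaseModule d.op Z) (h1 : RhoStable p r) (h2 : RhoStable r p) :
    RT (ltri r p q h1) s ≃ₗᵢ[ℂ] RT (ltri p r s h2) q :=
  (exists_sigma₂₃ p q r s h1 h2).choose

theorem mapsModule_ofKets {ι : Type*} (J : ι → H →L[ℂ] X) (hJ : Total J)
    (L : ι → H →L[ℂ] Y) (hL : Total L) (α : BaseModule a H) (h1 h2 h1' h2') (U : X ≃ₗᵢ[ℂ] Y)
    (hU : ∀ i, (U : X →L[ℂ] Y) ∘L J i = L i) :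
    MapsModule U (BaseModule.ofKets J hJ α h1 h2) (BaseModule.ofKets L hL α h1' h2') := by
  have hU' : ∀ i, (U.symm : Y →L[ℂ] X) ∘L L i = J i := fun i => by
    rw [← hU]
    ext x
    exact U.symm_apply_apply _
  refine Set.Subset.antisymm ?_ ?_
  · rintro _ ⟨x, hx, rfl⟩
    refine clspan_comp_left (U : X →L[ℂ] Y) (isClosed_clspan _) ?_ hx
    rintro _ ⟨i, ξ, hξ, rfl⟩
    exact subset_clspan ⟨i, ξ, hξ, by rw [← hU, ContinuousLinearMap.comp_assoc]⟩
  · intro y hy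
    refine ⟨(U.symm : Y →L[ℂ] X) ∘L y, ?_, ?_⟩
    · refine clspan_comp_left (U.symm : Y →L[ℂ] X) (isClosed_clspan _) ?_ hy
      rintro _ ⟨i, ξ, hξ, rfl⟩
      exact subset_clspan ⟨i, ξ, hξ, by rw [← hU', ContinuousLinearMap.comp_assoc]⟩
    · ext x
      exact U.apply_symm_apply _

theorem rtFlip_comp_ket₁ (β : BaseModule b X) (γ : BaseModule b.op Y) (ξ : β.space) :
    (rtFlip β γ : RT β γ →L[ℂ] RT (b := b.op) γ β) ∘L ket₁ β γ ξ =
      ket₂ (b := b.op) γ β ξ := by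
  refine γ.total_space.ext fun η => ?_
  rw [ContinuousLinearMap.comp_assoc, ket₁_comp, ket₂_comp (b := b.op)]
  ext ζ
  exact (exists_flip β γ).choose_spec (ξ, η) ζ

/-- `Σ (β ▷ δ) = δ ◁ β`. -/
theorem flip_mapsModule (β : BaseModule b X) (γ : BaseModule b.op Y) (δ : BaseModule c Y)
    (h : RhoStable γ δ) :
    MapsModule (rtFlip β γ) (rtri β γ δ h) (ltri (b := b.op) δ γ β h) :=
  mapsModule_ofKets _ _ _ _ _ _ _ _ _ _ (rtFlip_comp_ket₁ β γ)

end Kets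

section Series

variable {X E F G : Type*}
  [NormedAddCommGroup X] [InnerProductSpace ℂ X] [CompleteSpace X]
  [NormedAddCommGroup E] [InnerProductSpace ℂ E] [CompleteSpace E]
  [NormedAddCommGroup F] [InnerProductSpace ℂ F] [CompleteSpace F]
  [NormedAddCommGroup G] [InnerProductSpace ℂ G] [CompleteSpace G]

/-- The sum `∑ x_i* x_i` converges in norm. -/
def SqSummable {ι : Type*} (x : ι → X →L[ℂ] E) : Prop := Summable fun i => (x i)† ∘L x i

/-- The column operator `v ↦ (x_i v)_{i ∈ s}`. -/
noncomputable def colOp {ι : Type*} (s : Finset ι) (x : ι → X →L[ℂ] E) :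
    X →L[ℂ] PiLp 2 (fun _ : s => E) :=
  adjoint (rowOp fun i : s => (x i)†)

theorem colOp_apply {ι : Type*} (s : Finset ι) (x : ι → X →L[ℂ] E) (v : X) (i : s) :
    colOp s x v i = x i v := by
  rw [colOp, rowOp_adjoint_apply, adjoint_adjoint]

theorem colOp_adjoint_apply {ι : Type*} (s : Finset ι) (x : ι → X →L[ℂ] E)
    (v : PiLp 2 (fun _ : s => E)) : adjoint (colOp s x) v = ∑ i : s, adjoint (x i) (v i) := by
  rw [colOp, adjoint_adjoint, rowOp_apply]

theorem sum_eq_colOp {ι : Type*} (s : Finset ι) (x : ι → X →L[ℂ] E) (T : F →L[ℂ] E)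
    (y : ι → G →L[ℂ] F) :
    ∑ i ∈ s, (x i)† ∘L T ∘L y i = (colOp s x)† ∘L diagOp s T ∘L colOp s y := by
  ext v
  rw [ContinuousLinearMap.comp_apply, colOp_adjoint_apply, _root_.sum_apply,
    ← Finset.sum_coe_sort]
  refine Finset.sum_congr rfl fun i _ => ?_
  change adjoint (x i) (T (y i v)) = adjoint (x i) (diagOp s T (colOp s y v) i)
  rw [diagOp_apply, colOp_apply]

theorem norm_colOp_sq {ι : Type*} (s : Finset ι) (x : ι → X →L[ℂ] E) :
    ‖∑ i ∈ s, (x i)† ∘L x i‖ = ‖colOp s x‖ ^ 2 := by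
  have h : ∑ i ∈ s, (x i)† ∘L x i = (colOp s x)† ∘L colOp s x := by
    ext v
    rw [ContinuousLinearMap.comp_apply, colOp_adjoint_apply, _root_.sum_apply,
      ← Finset.sum_coe_sort]
    refine Finset.sum_congr rfl fun i _ => ?_
    rw [colOp_apply]
    rfl
  rw [h, norm_adjoint_comp_self, sq]

theorem norm_colOp_apply_sq {ι : Type*} (s : Finset ι) (x : ι → X →L[ℂ] E) (v : X) :
    ‖colOp s x v‖ ^ 2 = ∑ i ∈ s, ‖x i v‖ ^ 2 := by
  rw [PiLp.norm_sq_eq_of_L2, ← Finset.sum_coe_sort s]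
  exact Finset.sum_congr rfl fun i _ => by rw [colOp_apply]

theorem norm_sum_le_colOp {ι : Type*} (s : Finset ι) (x : ι → X →L[ℂ] E) (T : F →L[ℂ] E)
    (y : ι → G →L[ℂ] F) :
    ‖∑ i ∈ s, (x i)† ∘L T ∘L y i‖ ≤ ‖T‖ * (‖colOp s x‖ * ‖colOp s y‖) := by
  rw [sum_eq_colOp]
  refine (opNorm_comp_le _ _).trans ?_
  refine (mul_le_mul_of_nonneg_left (opNorm_comp_le _ _) (norm_nonneg _)).trans ?_
  rw [LinearIsometryEquiv.norm_map]
  have := norm_diagOp_le s T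
  calc _ ≤ ‖colOp s x‖ * (‖T‖ * ‖colOp s y‖) := by gcongr
    _ = _ := by ring

theorem SqSummable.norm_colOp_le {ι : Type*} {x : ι → X →L[ℂ] E} (hx : SqSummable x)
    (s : Finset ι) : ‖colOp s x‖ ≤ √‖∑' i, (x i)† ∘L x i‖ := by
  refine opNorm_le_bound _ (Real.sqrt_nonneg _) fun v => ?_
  rw [← sq_le_sq₀ (norm_nonneg _) (by positivity), mul_pow, Real.sq_sqrt (norm_nonneg _),
    norm_colOp_apply_sq]
  have h1 : HasSum (fun i => ‖x i v‖ ^ 2) (RCLike.re ⟪v, (∑' i, (x i)† ∘L x i) v⟫_ℂ) := by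
    have h := hx.hasSum.mapL (ContinuousLinearMap.apply ℂ X v)
    have h2 := h.mapL (innerSL ℂ v)
    have h3 := h2.mapL Complex.reCLM
    have e : (fun i => ‖x i v‖ ^ 2) =
        fun i => Complex.reCLM (innerSL ℂ v (ContinuousLinearMap.apply ℂ X v ((x i)† ∘L x i))) := by
      funext i
      change _ = (⟪v, adjoint (x i) (x i v)⟫_ℂ).re
      rw [adjoint_inner_right]
      exact (inner_self_eq_norm_sq (𝕜 := ℂ) _).symm
    rw [e]
    exact h3
  refine (sum_le_hasSum s (fun i _ => by positivity) h1).trans ?_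
  refine (re_inner_le_norm _ _).trans ?_
  calc _ ≤ ‖v‖ * (‖∑' i, (x i)† ∘L x i‖ * ‖v‖) := by gcongr; exact le_opNorm _ _
    _ = _ := by ring

theorem SqSummable.vanish {ι : Type*} {x : ι → X →L[ℂ] E} (hx : SqSummable x) {δ : ℝ}
    (hδ : 0 < δ) : ∃ s : Finset ι, ∀ t, Disjoint t s → ‖colOp t x‖ ≤ δ := by
  obtain ⟨s, hs⟩ := summable_iff_vanishing_norm.1 hx (δ ^ 2) (by positivity)
  refine ⟨s, fun t ht => ?_⟩
  have := (hs t ht).le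
  rw [norm_colOp_sq] at this
  exact le_of_sq_le_sq this hδ.le

theorem SqSummable.summable {ι : Type*} {x : ι → X →L[ℂ] E} (hx : SqSummable x)
    {y : ι → G →L[ℂ] F} (hy : SqSummable y) (T : F →L[ℂ] E) :
    Summable fun i => (x i)† ∘L T ∘L y i := by
  rw [summable_iff_vanishing_norm]
  intro ε hε
  set D := √‖∑' i, (y i)† ∘L y i‖
  have hD : 0 ≤ D := Real.sqrt_nonneg _
  have hpos : 0 < ‖T‖ * D + 1 := by positivity
  obtain ⟨s, hs⟩ := hx.vanish (div_pos hε hpos)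
  refine ⟨s, fun t ht => (norm_sum_le_colOp t x T y).trans_lt ?_⟩
  calc ‖T‖ * (‖colOp t x‖ * ‖colOp t y‖) ≤ ‖T‖ * (ε / (‖T‖ * D + 1) * D) := by
        gcongr
        · exact hs t ht
        · exact hy.norm_colOp_le t
    _ = ε * (‖T‖ * D / (‖T‖ * D + 1)) := by ring
    _ < ε := by
        refine mul_lt_of_lt_one_right hε ?_
        rw [div_lt_one hpos]
        linarith

theorem SqSummable.norm_tsum_le {ι : Type*} {x : ι → X →L[ℂ] E} (hx : SqSummable x)
    {y : ι → G →L[ℂ] F} (hy : SqSummable y) (T : F →L[ℂ] E) :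
    ‖∑' i, (x i)† ∘L T ∘L y i‖ ≤
      (√‖∑' i, (x i)† ∘L x i‖ * √‖∑' i, (y i)† ∘L y i‖) * ‖T‖ := by
  refine le_of_tendsto ((hx.summable hy T).hasSum.norm) (Filter.Eventually.of_forall fun s => ?_)
  refine (norm_sum_le_colOp s x T y).trans ?_
  rw [mul_comm]
  gcongr
  · exact hx.norm_colOp_le s
  · exact hy.norm_colOp_le s

theorem SqSummable.comp {ι κ : Type*} {x : ι → X →L[ℂ] E} (hx : SqSummable x)
    {y : κ → E →L[ℂ] F} (hy : SqSummable y) :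
    SqSummable fun p : ι × κ => y p.2 ∘L x p.1 := by
  classical
  have key : ∀ (s : Finset ι) (t : Finset κ),
      ‖colOp (s ×ˢ t) fun p : ι × κ => y p.2 ∘L x p.1‖ ≤ ‖colOp t y‖ * ‖colOp s x‖ := by
    intro s t
    refine opNorm_le_bound _ (by positivity) fun v => ?_
    rw [← sq_le_sq₀ (norm_nonneg _) (by positivity), norm_colOp_apply_sq, Finset.sum_product]
    calc ∑ i ∈ s, ∑ j ∈ t, ‖y j (x i v)‖ ^ 2 = ∑ i ∈ s, ‖colOp t y (x i v)‖ ^ 2 := by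
          simp_rw [norm_colOp_apply_sq]
      _ ≤ ∑ i ∈ s, ‖colOp t y‖ ^ 2 * ‖x i v‖ ^ 2 := by
          refine Finset.sum_le_sum fun i _ => ?_
          rw [← mul_pow]
          gcongr
          exact le_opNorm _ _
      _ = ‖colOp t y‖ ^ 2 * ‖colOp s x v‖ ^ 2 := by
          rw [← Finset.mul_sum, norm_colOp_apply_sq]
      _ ≤ ‖colOp t y‖ ^ 2 * (‖colOp s x‖ * ‖v‖) ^ 2 := by
          gcongr
          exact le_opNorm _ _
      _ = _ := by ring
  have mono : ∀ (t t' : Finset (ι × κ)), t ⊆ t' →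
      ‖colOp t fun p : ι × κ => y p.2 ∘L x p.1‖ ≤
        ‖colOp t' fun p : ι × κ => y p.2 ∘L x p.1‖ := by
    intro t t' h
    refine opNorm_le_bound _ (opNorm_nonneg _) fun v => ?_
    refine le_trans ?_ (le_opNorm _ _)
    rw [← sq_le_sq₀ (norm_nonneg _) (norm_nonneg _), norm_colOp_apply_sq, norm_colOp_apply_sq]
    exact Finset.sum_le_sum_of_subset_of_nonneg h fun _ _ _ => by positivity
  have tri : ∀ (t : Finset (ι × κ)) (q : ι × κ → Prop) [DecidablePred q],
      ‖colOp t fun p : ι × κ => y p.2 ∘L x p.1‖ ^ 2 ≤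
        ‖colOp (t.filter q) fun p : ι × κ => y p.2 ∘L x p.1‖ ^ 2 +
        ‖colOp (t.filter fun p => ¬ q p) fun p : ι × κ => y p.2 ∘L x p.1‖ ^ 2 := by
    intro t q _
    rw [← norm_colOp_sq, ← norm_colOp_sq, ← norm_colOp_sq,
      ← Finset.sum_filter_add_sum_filter_not t q]
    exact norm_add_le _ _
  set Dx := √‖∑' i, (x i)† ∘L x i‖
  set Dy := √‖∑' i, (y i)† ∘L y i‖
  have hDx : 0 ≤ Dx := Real.sqrt_nonneg _
  have hDy : 0 ≤ Dy := Real.sqrt_nonneg _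
  rw [SqSummable, summable_iff_vanishing_norm]
  intro ε hε
  set δ := √ε / (2 * (Dx + Dy + 1)) with hδ
  have hδ0 : 0 < δ := div_pos (Real.sqrt_pos.2 hε) (by positivity)
  obtain ⟨s1, h1⟩ := hx.vanish hδ0
  obtain ⟨s2, h2⟩ := hy.vanish hδ0
  refine ⟨s1 ×ˢ s2, fun t ht => ?_⟩
  rw [norm_colOp_sq]
  have b1 : ‖colOp (t.filter fun p => p.1 ∈ s1) fun p : ι × κ => y p.2 ∘L x p.1‖ ≤ δ * Dx := by
    refine (mono _ ((t.image Prod.fst) ×ˢ (t.image Prod.snd \ s2)) ?_).trans ((key _ _).trans ?_)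
    · intro p hp
      rw [Finset.mem_filter] at hp
      rw [Finset.mem_product, Finset.mem_sdiff]
      refine ⟨Finset.mem_image_of_mem _ hp.1, Finset.mem_image_of_mem _ hp.1, fun h => ?_⟩
      exact Finset.disjoint_left.1 ht hp.1 (Finset.mem_product.2 ⟨hp.2, h⟩)
    · gcongr
      · exact h2 _ Finset.sdiff_disjoint
      · exact hx.norm_colOp_le _
  have b2 : ‖colOp (t.filter fun p => ¬ p.1 ∈ s1) fun p : ι × κ => y p.2 ∘L x p.1‖
      ≤ Dy * δ := by
    refine (mono _ ((t.image Prod.fst \ s1) ×ˢ (t.image Prod.snd)) ?_).trans ((key _ _).trans ?_)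
    · intro p hp
      rw [Finset.mem_filter] at hp
      rw [Finset.mem_product, Finset.mem_sdiff]
      exact ⟨⟨Finset.mem_image_of_mem _ hp.1, hp.2⟩, Finset.mem_image_of_mem _ hp.1⟩
    · gcongr
      · exact hy.norm_colOp_le _
      · exact h1 _ Finset.sdiff_disjoint
  refine (tri t fun p => p.1 ∈ s1).trans_lt ?_
  have c1 : (δ * Dx) ^ 2 + (Dy * δ) ^ 2 ≤ (δ * (Dx + Dy + 1)) ^ 2 := by
    have : 0 ≤ δ ^ 2 * (2 * Dx * Dy + 2 * Dx + 2 * Dy + 1) := by positivity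
    nlinarith
  have c2 : δ * (Dx + Dy + 1) = √ε / 2 := by
    rw [hδ]; field_simp
  calc _ ≤ (δ * Dx) ^ 2 + (Dy * δ) ^ 2 := by gcongr
    _ ≤ (√ε / 2) ^ 2 := by rw [← c2]; exact c1
    _ < ε := by rw [div_pow, Real.sq_sqrt hε.le]; linarith

end Series
section Slices

variable {𝔎 H K X Y Z : Type*}
  [NormedAddCommGroup 𝔎] [InnerProductSpace ℂ 𝔎] [CompleteSpace 𝔎]
  [NormedAddCommGroup H] [InnerProductSpace ℂ H] [CompleteSpace H]
  [NormedAddCommGroup K] [InnerProductSpace ℂ K] [CompleteSpace K]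
  [NormedAddCommGroup X] [InnerProductSpace ℂ X] [CompleteSpace X]
  [NormedAddCommGroup Y] [InnerProductSpace ℂ Y] [CompleteSpace Y]
  [NormedAddCommGroup Z] [InnerProductSpace ℂ Z] [CompleteSpace Z]


variable {a b c d : CStarBase 𝔎}

/-- `α^∞`: the sequences in `α` for which `∑ η_n* η_n` converges in norm. -/
abbrev SqSeq (α : BaseModule a H) : Type _ :=
  {η : ℕ → α.space // SqSummable fun n => (η n : 𝔎 →L[ℂ] H)}

/-- The map `ω_{ξ,η} : T ↦ ∑ ξ_n* T η_n` on a space `A` of operators on `H`. -/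
noncomputable def omega (A : Submodule ℂ (H →L[ℂ] H)) {β : BaseModule a H} {α : BaseModule c H}
    (ξ : SqSeq β) (η : SqSeq α) : A →L[ℂ] (𝔎 →L[ℂ] 𝔎) :=
  LinearMap.mkContinuous
    { toFun := fun T => ∑' n, (ξ.1 n : 𝔎 →L[ℂ] H)† ∘L (T : H →L[ℂ] H) ∘L (η.1 n : 𝔎 →L[ℂ] H)
      map_add' := fun S T => by
        rw [← (ξ.2.summable η.2 _).tsum_add (ξ.2.summable η.2 _)]
        refine tsum_congr fun n => ?_
        rw [Submodule.coe_add, ContinuousLinearMap.add_comp, ContinuousLinearMap.comp_add]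
      map_smul' := fun r T => by
        rw [RingHom.id_apply, ← (ξ.2.summable η.2 _).tsum_const_smul]
        refine tsum_congr fun n => ?_
        rw [Submodule.coe_smul, ContinuousLinearMap.smul_comp, ContinuousLinearMap.comp_smul] }
    (√‖∑' n, (ξ.1 n : 𝔎 →L[ℂ] H)† ∘L (ξ.1 n : 𝔎 →L[ℂ] H)‖ *
      √‖∑' n, (η.1 n : 𝔎 →L[ℂ] H)† ∘L (η.1 n : 𝔎 →L[ℂ] H)‖)
    (fun T => ξ.2.norm_tsum_le η.2 _)

theorem omega_apply (A : Submodule ℂ (H →L[ℂ] H)) {β : BaseModule a H} {α : BaseModule c H}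
    (ξ : SqSeq β) (η : SqSeq α) (T : A) : omega A ξ η T =
      ∑' n, (ξ.1 n : 𝔎 →L[ℂ] H)† ∘L (T : H →L[ℂ] H) ∘L (η.1 n : 𝔎 →L[ℂ] H) := rfl

theorem hasSum_omega (A : Submodule ℂ (H →L[ℂ] H)) {β : BaseModule a H} {α : BaseModule c H}
    (ξ : SqSeq β) (η : SqSeq α) (T : A) :
    HasSum (fun n => (ξ.1 n : 𝔎 →L[ℂ] H)† ∘L (T : H →L[ℂ] H) ∘L (η.1 n : 𝔎 →L[ℂ] H))
      (omega A ξ η T) := (ξ.2.summable η.2 _).hasSum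

/-- The sequence `ξ_0, ξ'_0, ξ_1, ξ'_1, …`. -/
def interleave {S : Type*} (ξ ξ' : ℕ → S) (n : ℕ) : S :=
  if n % 2 = 0 then ξ (n / 2) else ξ' (n / 2)

theorem interleave_even {S : Type*} (ξ ξ' : ℕ → S) (k : ℕ) :
    interleave ξ ξ' (2 * k) = ξ k := by
  have h1 : 2 * k % 2 = 0 := by omega
  have h2 : 2 * k / 2 = k := by omega
  rw [interleave, if_pos h1, h2]

theorem interleave_odd {S : Type*} (ξ ξ' : ℕ → S) (k : ℕ) :
    interleave ξ ξ' (2 * k + 1) = ξ' k := by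
  have h1 : ¬ (2 * k + 1) % 2 = 0 := by omega
  have h2 : (2 * k + 1) / 2 = k := by omega
  rw [interleave, if_neg h1, h2]

/-- The interleaving of two sequences in `α^∞`. -/
def SqSeq.interleave {α : BaseModule a H} (ξ ξ' : SqSeq α) : SqSeq α :=
  ⟨CPMU.interleave ξ.1 ξ'.1, by
    refine (HasSum.even_add_odd (m := ∑' n, (ξ.1 n : 𝔎 →L[ℂ] H)† ∘L (ξ.1 n : 𝔎 →L[ℂ] H))
      (m' := ∑' n, (ξ'.1 n : 𝔎 →L[ℂ] H)† ∘L (ξ'.1 n : 𝔎 →L[ℂ] H)) ?_ ?_).summable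
    · simp only [interleave_even]; exact ξ.2.hasSum
    · simp only [interleave_odd]; exact ξ'.2.hasSum⟩

theorem omega_interleave (A : Submodule ℂ (H →L[ℂ] H)) {β : BaseModule a H}
    {α : BaseModule c H} (ξ ξ' : SqSeq β) (η η' : SqSeq α) :
    omega A (ξ.interleave ξ') (η.interleave η') = omega A ξ η + omega A ξ' η' := by
  ext1 T
  refine (hasSum_omega A _ _ T).unique (HasSum.even_add_odd ?_ ?_)
  · simp only [SqSeq.interleave, interleave_even]; exact hasSum_omega A ξ η T
  · simp only [SqSeq.interleave, interleave_odd]; exact hasSum_omega A ξ' η' T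

/-- The sequence `r η_0, r η_1, …`. -/
def SqSeq.smul {α : BaseModule a H} (r : ℂ) (η : SqSeq α) : SqSeq α :=
  ⟨fun n => r • η.1 n, by
    have h := (show Summable _ from η.2).const_smul ((starRingEnd ℂ) r * r)
    refine h.congr fun n => ?_
    change _ = (r • (η.1 n : 𝔎 →L[ℂ] H))† ∘L (r • (η.1 n : 𝔎 →L[ℂ] H))
    rw [map_smulₛₗ, ContinuousLinearMap.smul_comp, ContinuousLinearMap.comp_smul, smul_smul]⟩

theorem omega_smul (A : Submodule ℂ (H →L[ℂ] H)) {β : BaseModule a H}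
    {α : BaseModule c H} (r : ℂ) (ξ : SqSeq β) (η : SqSeq α) :
    omega A ξ (η.smul r) = r • omega A ξ η := by
  ext1 T
  refine (hasSum_omega A _ _ T).unique ?_
  refine ((hasSum_omega A ξ η T).const_smul r).congr_fun fun n => ?_
  change _ ∘L _ ∘L (r • (η.1 n : 𝔎 →L[ℂ] H)) = _
  rw [ContinuousLinearMap.comp_smul, ContinuousLinearMap.comp_smul]

/-- The zero sequence. -/
def SqSeq.zero (α : BaseModule a H) : SqSeq α :=
  ⟨fun _ => 0, by
    refine (summable_zero).congr fun n => ?_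
    change 0 = (0 : 𝔎 →L[ℂ] H)† ∘L (0 : 𝔎 →L[ℂ] H)
    rw [ContinuousLinearMap.comp_zero]⟩

/-- `Ω_{β,α}(A) = {ω_{ξ,η} | ξ ∈ β^∞, η ∈ α^∞}`, a space of bounded maps `A → L(𝔎)`. -/
noncomputable def Omega (β : BaseModule a H) (α : BaseModule c H)
    (A : Submodule ℂ (H →L[ℂ] H)) : Submodule ℂ (A →L[ℂ] (𝔎 →L[ℂ] 𝔎)) where
  carrier := {ω | ∃ (ξ : SqSeq β) (η : SqSeq α), ω = omega A ξ η}
  add_mem' := by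
    rintro _ _ ⟨ξ, η, rfl⟩ ⟨ξ', η', rfl⟩
    exact ⟨_, _, (omega_interleave A ξ ξ' η η').symm⟩
  zero_mem' := ⟨SqSeq.zero β, SqSeq.zero α, by
    ext1 T
    refine (HasSum.unique (hasSum_omega A _ _ T) ?_).symm
    refine (hasSum_zero).congr_fun fun n => ?_
    change (0 : 𝔎 →L[ℂ] H)† ∘L (T : H →L[ℂ] H) ∘L (0 : 𝔎 →L[ℂ] H) = 0
    rw [ContinuousLinearMap.comp_zero, ContinuousLinearMap.comp_zero]⟩
  smul_mem' := by
    rintro r _ ⟨ξ, η, rfl⟩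
    exact ⟨_, _, (omega_smul A r ξ η).symm⟩

/-- A sequence `ξ` of a chosen representation `ω = ω_{ξ,η}`. -/
noncomputable def Omega.left {β : BaseModule a H} {α : BaseModule c H}
    {A : Submodule ℂ (H →L[ℂ] H)} (ω : Omega β α A) : SqSeq β := ω.2.choose

/-- The sequence `η` of the chosen representation `ω = ω_{ξ,η}`. -/
noncomputable def Omega.right {β : BaseModule a H} {α : BaseModule c H}
    {A : Submodule ℂ (H →L[ℂ] H)} (ω : Omega β α A) : SqSeq α := ω.2.choose_spec.choose

theorem Omega.eq {β : BaseModule a H} {α : BaseModule c H} {A : Submodule ℂ (H →L[ℂ] H)}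
    (ω : Omega β α A) : ω.1 = omega A (Omega.left ω) (Omega.right ω) :=
  ω.2.choose_spec.choose_spec

/-- The element `ω_{ξ,η}` of `Ω_{β,α}(A)`. -/
noncomputable def Omega.mk {β : BaseModule a H} {α : BaseModule c H}
    (A : Submodule ℂ (H →L[ℂ] H)) (ξ : SqSeq β) (η : SqSeq α) : Omega β α A :=
  ⟨omega A ξ η, ξ, η, rfl⟩

/-! ### Slice maps -/

theorem summable_rho (β : BaseModule b H) {x : ℕ → 𝔎 →L[ℂ] 𝔎} (hx : ∀ n, x n ∈ b.Bd)
    (h : Summable x) : Summable fun n => rho β (x n) := by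
  rw [summable_iff_vanishing_norm] at h ⊢
  intro ε hε
  obtain ⟨s, hs⟩ := h ε hε
  refine ⟨s, fun t ht => lt_of_le_of_lt ?_ (hs t ht)⟩
  have e : ∑ i ∈ t, rho β (x i) = rho β (∑ i ∈ t, x i) := by
    have := map_sum (rhoL β) (fun i => (⟨x i, hx i⟩ : b.Bd)) t
    refine this.symm.trans ?_
    change rho β _ = _
    congr 1
    exact AddSubmonoidClass.coe_finsetSum _ _
  rw [e]
  exact norm_rho_le β (sum_mem fun i _ => hx i)

theorem SqSeq.ket₁ {β : BaseModule b H} (γ : BaseModule b.op K) (ξ : SqSeq β) :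
    SqSummable fun n => ket₁ β γ (ξ.1 n) := by
  refine (summable_rho γ (fun n => β.inner_mem (ξ.1 n) (ξ.1 n)) ξ.2).congr fun n => ?_
  exact (ket₁_adjoint_comp β γ (ξ.1 n) (ξ.1 n)).symm

theorem SqSeq.ket₂ (β : BaseModule b H) {γ : BaseModule b.op K} (η : SqSeq γ) :
    SqSummable fun n => ket₂ β γ (η.1 n) := by
  refine (summable_rho β (fun n => γ.inner_mem (η.1 n) (η.1 n)) η.2).congr fun n => ?_
  exact (ket₂_adjoint_comp β γ (η.1 n) (η.1 n)).symm

theorem ket_comm (β : BaseModule b H) (γ : BaseModule b.op K) (ξ : β.space) (η : γ.space) :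
    ket₂ β γ η ∘L (ξ : 𝔎 →L[ℂ] H) = ket₁ β γ ξ ∘L (η : 𝔎 →L[ℂ] K) := by
  rw [ket₁_comp, ket₂_comp]

theorem adjoint_ket_comm (β : BaseModule b H) (γ : BaseModule b.op K) (ξ : β.space)
    (η : γ.space) : (ξ : 𝔎 →L[ℂ] H)† ∘L (ket₂ β γ η)† =
      (η : 𝔎 →L[ℂ] K)† ∘L (ket₁ β γ ξ)† := by
  rw [← adjoint_comp, ← adjoint_comp, ket_comm]

/-- `∑ k_n* T l_n` is determined by `ω_{ξ,η}` if `p* k_n* T l_n q = ξ_n* S η_n`. -/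
theorem slice_test {A : Submodule ℂ (H →L[ℂ] H)} {β : BaseModule a H} {α : BaseModule c H}
    (ξ : SqSeq β) (η : SqSeq α) {k : ℕ → X →L[ℂ] Y} {l : ℕ → K →L[ℂ] Z} (T : Z →L[ℂ] Y)
    (hk : SqSummable k) (hl : SqSummable l) (p : 𝔎 →L[ℂ] X) (q : 𝔎 →L[ℂ] K) (S : A)
    (h : ∀ n, p† ∘L ((k n)† ∘L T ∘L l n) ∘L q =
      (ξ.1 n : 𝔎 →L[ℂ] H)† ∘L (S : H →L[ℂ] H) ∘L (η.1 n : 𝔎 →L[ℂ] H)) :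
    p† ∘L (∑' n, (k n)† ∘L T ∘L l n) ∘L q = omega A ξ η S := by
  have h1 := ((hk.summable hl T).hasSum.mapL ((compL ℂ 𝔎 K X).flip q)).mapL
    (compL ℂ 𝔎 X 𝔎 (p†))
  refine h1.unique ?_
  refine (hasSum_omega A ξ η S).congr_fun fun n => ?_
  exact h n

/-- The commutant of a set of operators. -/
def commutant (S : Set (H →L[ℂ] H)) : Submodule ℂ (H →L[ℂ] H) where
  carrier := {T | ∀ x ∈ S, T ∘L x = x ∘L T}
  add_mem' := fun {T T'} h h' x hx => by
    rw [ContinuousLinearMap.add_comp, ContinuousLinearMap.comp_add, h x hx, h' x hx]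
  zero_mem' := fun x _ => by rw [ContinuousLinearMap.zero_comp, ContinuousLinearMap.comp_zero]
  smul_mem' := fun r T h x hx => by
    rw [ContinuousLinearMap.smul_comp, ContinuousLinearMap.comp_smul, h x hx]

theorem isClosed_commutant (S : Set (H →L[ℂ] H)) :
    IsClosed (commutant S : Set (H →L[ℂ] H)) := by
  have : (commutant S : Set (H →L[ℂ] H)) = ⋂ x ∈ S, {T | T ∘L x = x ∘L T} := by
    ext T; simp [commutant]
  rw [this]
  refine isClosed_biInter fun x _ => isClosed_eq ?_ ?_
  · exact ((compL ℂ H H H).flip x).continuous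
  · exact (compL ℂ H H H x).continuous

theorem tsum_mem_commutant {S : Set (H →L[ℂ] H)} {x : ℕ → H →L[ℂ] H}
    (h : ∀ n, x n ∈ commutant S) : ∑' n, x n ∈ commutant S := by
  by_cases hs : Summable x
  · exact (isClosed_commutant S).mem_of_tendsto hs.hasSum
      (Filter.Eventually.of_forall fun t => sum_mem fun i _ => h i)
  · rw [tsum_eq_zero_of_not_summable hs]; exact zero_mem _

/-- `ρ_β(𝔄†)' ⊆ L(H)`. -/
noncomputable def rhoCommutant (β : BaseModule a H) : Submodule ℂ (H →L[ℂ] H) :=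
  commutant {T | ∃ y ∈ a.Bd, rho β y = T}

/-! ### Tensor products of operators -/

/-- The operator `z ⊗ Id` on `H_β ⊗ _γK`, for `z ∈ ρ_β(𝔅†)'`: it maps `|η⟩₂ v` to `|η⟩₂ z v`. -/
noncomputable def otimesLeft (β : BaseModule b H) (γ : BaseModule b.op K) (z : H →L[ℂ] H) :
    RT β γ →L[ℂ] RT β γ :=
  amplify (ket₂ β γ) z

/-- The operator `Id ⊗ y` on `H_β ⊗ _γK`, for `y ∈ ρ_γ(𝔅)'`: it maps `|ξ⟩₁ v` to `|ξ⟩₁ y v`. -/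
noncomputable def otimesRight (β : BaseModule b H) (γ : BaseModule b.op K) (y : K →L[ℂ] K) :
    RT β γ →L[ℂ] RT β γ :=
  amplify (ket₁ β γ) y

theorem otimesLeft_comp (β : BaseModule b H) (γ : BaseModule b.op K) {z : H →L[ℂ] H}
    (hz : z ∈ rhoCommutant β) (η : γ.space) :
    otimesLeft β γ z ∘L ket₂ β γ η = ket₂ β γ η ∘L z :=
  (total_ket₂ β γ).amplify_comp z (fun η η' => by
    rw [ket₂_adjoint_comp]
    exact (hz _ ⟨_, γ.inner_mem η η', rfl⟩).symm) η

theorem otimesRight_comp (β : BaseModule b H) (γ : BaseModule b.op K) {y : K →L[ℂ] K}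
    (hy : y ∈ rhoCommutant γ) (ξ : β.space) :
    otimesRight β γ y ∘L ket₁ β γ ξ = ket₁ β γ ξ ∘L y :=
  (total_ket₁ β γ).amplify_comp y (fun ξ ξ' => by
    rw [ket₁_adjoint_comp]
    exact (hy _ ⟨_, β.inner_mem ξ ξ', rfl⟩).symm) ξ

theorem RhoStable.rho_mem {α : BaseModule a H} {β : BaseModule b H} (h : RhoStable α β)
    {y : 𝔎 →L[ℂ] 𝔎} (hy : y ∈ a.Bd) : rho α y ∈ rhoCommutant β := by
  rintro _ ⟨x, hx, rfl⟩
  exact h.commute hy hx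

theorem otimesLeft_rho (μ : BaseModule a H) (β : BaseModule b H) (γ : BaseModule b.op K)
    (h : RhoStable β μ) (h' : RhoStable μ β) {y : 𝔎 →L[ℂ] 𝔎} (hy : y ∈ a.Bd) :
    otimesLeft β γ (rho μ y) = rho (ltri μ β γ h) y :=
  (total_ket₂ β γ).ext fun η => by
    rw [otimesLeft_comp β γ (h'.rho_mem hy), rho_ltri_comp _ _ _ _ hy]

theorem otimesRight_rho (β : BaseModule b H) (γ : BaseModule b.op K) (ν : BaseModule c K)
    (h : RhoStable γ ν) (h' : RhoStable ν γ) {y : 𝔎 →L[ℂ] 𝔎} (hy : y ∈ c.Bd) :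
    otimesRight β γ (rho ν y) = rho (rtri β γ ν h) y :=
  (total_ket₁ β γ).ext fun η => by
    rw [otimesRight_comp β γ (h'.rho_mem hy), rho_rtri_comp _ _ _ _ hy]

theorem rho_rtri_comp_ket₂ (β : BaseModule b H) (γ : BaseModule b.op K) (ν : BaseModule c K)
    (h : RhoStable γ ν) (h' : RhoStable ν γ) {y : 𝔎 →L[ℂ] 𝔎} (hy : y ∈ c.Bd) (η : γ.space) :
    rho (rtri β γ ν h) y ∘L ket₂ β γ η = ket₂ β γ ⟨_, h'.mem hy η⟩ :=
  β.total_space.ext fun ξ => by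
    rw [ContinuousLinearMap.comp_assoc, ket_comm, ← ContinuousLinearMap.comp_assoc,
      rho_rtri_comp _ _ _ _ hy, ket_comm, ContinuousLinearMap.comp_assoc]

theorem rho_ltri_comp_ket₁ (μ : BaseModule a H) (β : BaseModule b H) (γ : BaseModule b.op K)
    (h : RhoStable β μ) (h' : RhoStable μ β) {y : 𝔎 →L[ℂ] 𝔎} (hy : y ∈ a.Bd) (ξ : β.space) :
    rho (ltri μ β γ h) y ∘L ket₁ β γ ξ = ket₁ β γ ⟨_, h'.mem hy ξ⟩ :=
  γ.total_space.ext fun η => by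
    rw [ContinuousLinearMap.comp_assoc, ← ket_comm, ← ContinuousLinearMap.comp_assoc,
      rho_ltri_comp _ _ _ _ hy, ← ket_comm, ContinuousLinearMap.comp_assoc]

theorem otimesLeft_commute (β : BaseModule b H) (γ : BaseModule b.op K) (ν : BaseModule c K)
    (h : RhoStable γ ν) (h' : RhoStable ν γ) {y : 𝔎 →L[ℂ] 𝔎} (hy : y ∈ c.Bd) {z : H →L[ℂ] H}
    (hz : z ∈ rhoCommutant β) :
    otimesLeft β γ z ∘L rho (rtri β γ ν h) y = rho (rtri β γ ν h) y ∘L otimesLeft β γ z :=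
  (total_ket₂ β γ).ext fun η => by
    rw [ContinuousLinearMap.comp_assoc, ContinuousLinearMap.comp_assoc,
      otimesLeft_comp β γ hz, rho_rtri_comp_ket₂ β γ ν h h' hy, otimesLeft_comp β γ hz,
      ← ContinuousLinearMap.comp_assoc, rho_rtri_comp_ket₂ β γ ν h h' hy]

theorem otimesRight_commute (μ : BaseModule a H) (β : BaseModule b H) (γ : BaseModule b.op K)
    (h : RhoStable β μ) (h' : RhoStable μ β) {y : 𝔎 →L[ℂ] 𝔎} (hy : y ∈ a.Bd) {z : K →L[ℂ] K}
    (hz : z ∈ rhoCommutant γ) :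
    otimesRight β γ z ∘L rho (ltri μ β γ h) y = rho (ltri μ β γ h) y ∘L otimesRight β γ z :=
  (total_ket₁ β γ).ext fun ξ => by
    rw [ContinuousLinearMap.comp_assoc, ContinuousLinearMap.comp_assoc,
      otimesRight_comp β γ hz, rho_ltri_comp_ket₁ μ β γ h h' hy, otimesRight_comp β γ hz,
      ← ContinuousLinearMap.comp_assoc, rho_ltri_comp_ket₁ μ β γ h h' hy]

/-- `(ρ_μ(𝔄†) ⊗ ρ_ν(ℭ†))'`, a space of operators on `H_β ⊗ _γK`. -/
noncomputable def tensorCommutant (μ : BaseModule a H) (β : BaseModule b H)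
    (γ : BaseModule b.op K) (ν : BaseModule c K) : Submodule ℂ (RT β γ →L[ℂ] RT β γ) :=
  commutant {T | ∃ y ∈ a.Bd, ∃ y' ∈ c.Bd,
    otimesLeft β γ (rho μ y) ∘L otimesRight β γ (rho ν y') = T}

theorem total_rho (β : BaseModule b H) : Total fun y : b.Bd => rho β y := by
  have h0 : Total (fun y : b.Bd => (y : 𝔎 →L[ℂ] 𝔎)) := by
    have h := b.nondegenerate_Bd
    unfold Total
    rw [← h]
    congr 1
    ext ζ
    simp
  exact total_of_comp (h0.comp β.total_space) fun p =>
    ⟨p.2, p.1, (rho_comp β p.2.2 p.1).symm⟩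

/-- Operators that commute with all products `D E` commute with all `D` and all `E`, if the
operators `D` and `E` form commuting nondegenerate families closed under products. -/
theorem commute_of_commute_comp {ι κ : Type*} {D : ι → X →L[ℂ] X} {E : κ → X →L[ℂ] X}
    (hD : Total D) (hDm : ∀ i j, ∃ k, D i ∘L D j = D k) (hDa : ∀ i, ∃ k, (D i)† = D k)
    (hc : ∀ i j, D i ∘L E j = E j ∘L D i) {x : X →L[ℂ] X}
    (hx : ∀ i j, x ∘L (D i ∘L E j) = (D i ∘L E j) ∘L x) (j : κ) : x ∘L E j = E j ∘L x := by
  refine hD.ext₂ hD fun i k => ?_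
  obtain ⟨k', hk⟩ := hDa k
  obtain ⟨l, hl⟩ := hDm k' i
  rw [hk]
  calc D k' ∘L (x ∘L E j) ∘L D i = D k' ∘L (x ∘L (D i ∘L E j)) := by
        rw [hc]; rfl
    _ = ((D k' ∘L D i) ∘L E j) ∘L x := by rw [hx]; rfl
    _ = x ∘L ((D k' ∘L D i) ∘L E j) := by rw [hl, hx]
    _ = (x ∘L (D k' ∘L E j)) ∘L D i := by
        rw [ContinuousLinearMap.comp_assoc, hc i]; rfl
    _ = (D k' ∘L E j) ∘L x ∘L D i := by rw [hx]; rfl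
    _ = _ := by rfl

theorem rho_comp_rho (β : BaseModule b H) {x y : 𝔎 →L[ℂ] 𝔎} (hx : x ∈ b.Bd) (hy : y ∈ b.Bd) :
    rho β x ∘L rho β y = rho β (x ∘L y) :=
  rho_unique β (mul_mem hx hy) fun ξ => by
    rw [ContinuousLinearMap.comp_assoc, rho_comp β hy, ← ContinuousLinearMap.comp_assoc,
      rho_comp β hx, ContinuousLinearMap.comp_assoc]
    rfl

theorem rho_ltri_commute_rtri (μ : BaseModule a H) (β : BaseModule b H) (γ : BaseModule b.op K)
    (ν : BaseModule c K) (h1 : RhoStable β μ) (h2 : RhoStable γ ν) (h3 : RhoStable ν γ)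
    {y y' : 𝔎 →L[ℂ] 𝔎} (hy : y ∈ a.Bd) (hy' : y' ∈ c.Bd) :
    rho (ltri μ β γ h1) y ∘L rho (rtri β γ ν h2) y' =
      rho (rtri β γ ν h2) y' ∘L rho (ltri μ β γ h1) y :=
  (total_ket₂ β γ).ext fun η => by
    rw [ContinuousLinearMap.comp_assoc, ContinuousLinearMap.comp_assoc,
      rho_ltri_comp _ _ _ _ hy, rho_rtri_comp_ket₂ β γ ν h2 h3 hy', rho_ltri_comp _ _ _ _ hy,
      ← ContinuousLinearMap.comp_assoc, rho_rtri_comp_ket₂ β γ ν h2 h3 hy']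

section TensorCommutant

variable {μ : BaseModule a H} {β : BaseModule b H} {γ : BaseModule b.op K}
  {ν : BaseModule c K}

theorem mem_tensorCommutant (h1 : RhoStable β μ) (h1' : RhoStable μ β) (h2 : RhoStable γ ν)
    (h2' : RhoStable ν γ) {x : RT β γ →L[ℂ] RT β γ} : x ∈ tensorCommutant μ β γ ν ↔
      (∀ y ∈ a.Bd, x ∘L rho (ltri μ β γ h1) y = rho (ltri μ β γ h1) y ∘L x) ∧
      ∀ y ∈ c.Bd, x ∘L rho (rtri β γ ν h2) y = rho (rtri β γ ν h2) y ∘L x := by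
  constructor
  · intro hx
    have hx' : ∀ (y : a.Bd) (y' : c.Bd),
        x ∘L (rho (ltri μ β γ h1) y ∘L rho (rtri β γ ν h2) y') =
          (rho (ltri μ β γ h1) y ∘L rho (rtri β γ ν h2) y') ∘L x := fun y y' => by
      have := hx _ ⟨y, y.2, y', y'.2, rfl⟩
      rwa [otimesLeft_rho μ β γ h1 h1' y.2, otimesRight_rho β γ ν h2 h2' y'.2] at this
    have hc : ∀ (y : a.Bd) (y' : c.Bd),
        rho (ltri μ β γ h1) y ∘L rho (rtri β γ ν h2) y' =
          rho (rtri β γ ν h2) y' ∘L rho (ltri μ β γ h1) y := fun y y' =>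
      rho_ltri_commute_rtri μ β γ ν h1 h2 h2' y.2 y'.2
    constructor
    · intro y hy
      refine commute_of_commute_comp (D := fun y' : c.Bd => rho (rtri β γ ν h2) y')
        (E := fun y : a.Bd => rho (ltri μ β γ h1) y) (total_rho _)
        (fun i j => ⟨i * j, rho_comp_rho _ i.2 j.2⟩)
        (fun i => ⟨star i, rho_adjoint _ i.2⟩) (fun i j => (hc j i).symm) (fun i j => ?_) ⟨y, hy⟩
      rw [← hc]
      exact hx' j i
    · intro y hy
      exact commute_of_commute_comp (D := fun y : a.Bd => rho (ltri μ β γ h1) y)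
        (E := fun y' : c.Bd => rho (rtri β γ ν h2) y') (total_rho _)
        (fun i j => ⟨i * j, rho_comp_rho _ i.2 j.2⟩)
        (fun i => ⟨star i, rho_adjoint _ i.2⟩) hc hx' ⟨y, hy⟩
  · rintro ⟨hx, hx'⟩ _ ⟨y, hy, y', hy', rfl⟩
    rw [otimesLeft_rho μ β γ h1 h1' hy, otimesRight_rho β γ ν h2 h2' hy',
      ← ContinuousLinearMap.comp_assoc, hx y hy, ContinuousLinearMap.comp_assoc, hx' y' hy']
    rfl

/-- `⟨s|₂ x |t⟩₂ ∈ ρ_μ(𝔄†)'` if `x` commutes with `ρ_μ(𝔄†) ⊗ Id`. -/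
theorem bra_ket_mem (α : BaseModule a X) (θ : BaseModule a Y) (ε : BaseModule a Z)
    (k : X →L[ℂ] Y) (l : X →L[ℂ] Z) (x : Z →L[ℂ] Y)
    (hk : ∀ y ∈ a.Bd, rho θ y ∘L k = k ∘L rho α y)
    (hl : ∀ y ∈ a.Bd, rho ε y ∘L l = l ∘L rho α y)
    (hx : ∀ y ∈ a.Bd, x ∘L rho ε y = rho θ y ∘L x) : k† ∘L x ∘L l ∈ rhoCommutant α := by
  rintro _ ⟨y, hy, rfl⟩
  have h1 : k† ∘L rho θ y = rho α y ∘L k† := by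
    have := congrArg adjoint (hk _ (star_mem hy))
    rw [adjoint_comp, adjoint_comp, rho_adjoint _ (star_mem hy), rho_adjoint _ (star_mem hy),
      star_eq_adjoint, adjoint_adjoint] at this
    exact this
  calc (k† ∘L x ∘L l) ∘L rho α y = k† ∘L x ∘L (l ∘L rho α y) := rfl
    _ = k† ∘L (x ∘L rho ε y) ∘L l := by rw [← hl y hy]; rfl
    _ = (k† ∘L rho θ y) ∘L x ∘L l := by rw [hx y hy]; rfl
    _ = _ := by rw [h1]; rfl

end TensorCommutant

end Slices
section Products

variable {𝔎 H K X Y Z : Type*}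
  [NormedAddCommGroup 𝔎] [InnerProductSpace ℂ 𝔎] [CompleteSpace 𝔎]
  [NormedAddCommGroup H] [InnerProductSpace ℂ H] [CompleteSpace H]
  [NormedAddCommGroup K] [InnerProductSpace ℂ K] [CompleteSpace K]
  [NormedAddCommGroup X] [InnerProductSpace ℂ X] [CompleteSpace X]
  [NormedAddCommGroup Y] [InnerProductSpace ℂ Y] [CompleteSpace Y]
  [NormedAddCommGroup Z] [InnerProductSpace ℂ Z] [CompleteSpace Z]


variable {a b c d : CStarBase 𝔎}

theorem total_id (E : Type*) [NormedAddCommGroup E] [InnerProductSpace ℂ E] [CompleteSpace E] :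
    Total fun _ : Unit => ContinuousLinearMap.id ℂ E := by
  unfold Total
  rw [eq_top_iff]
  exact fun e _ => subset_clspan ⟨(), e, rfl⟩

theorem SqSummable.comp_nat {E F : Type*}
    [NormedAddCommGroup E] [InnerProductSpace ℂ E] [CompleteSpace E]
    [NormedAddCommGroup F] [InnerProductSpace ℂ F] [CompleteSpace F]
    {x : ℕ → X →L[ℂ] E} (hx : SqSummable x) {y : ℕ → E →L[ℂ] F} (hy : SqSummable y) :
    SqSummable fun k : ℕ => y k.unpair.2 ∘L x k.unpair.1 :=
  (Nat.pairEquiv.symm.summable_iff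
    (f := fun p : ℕ × ℕ => (y p.2 ∘L x p.1)† ∘L (y p.2 ∘L x p.1))).2 (hx.comp hy)

theorem SqSummable.comp_nat' {E F : Type*}
    [NormedAddCommGroup E] [InnerProductSpace ℂ E] [CompleteSpace E]
    [NormedAddCommGroup F] [InnerProductSpace ℂ F] [CompleteSpace F]
    {x : ℕ → X →L[ℂ] E} (hx : SqSummable x) {y : ℕ → E →L[ℂ] F} (hy : SqSummable y) :
    SqSummable fun k : ℕ => y k.unpair.1 ∘L x k.unpair.2 :=
  (((Equiv.prodComm ℕ ℕ).trans Nat.pairEquiv).symm.summable_iff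
    (f := fun p : ℕ × ℕ => (y p.2 ∘L x p.1)† ∘L (y p.2 ∘L x p.1))).2 (hx.comp hy)

/-- The family `|η_n⟩₂ ξ_m` in `μ ◁ γ`, indexed by `ℕ ≅ ℕ × ℕ`. -/
noncomputable def ltriSeq {μ : BaseModule a H} {γ : BaseModule b.op K} (β : BaseModule b H)
    (h : RhoStable β μ) (ξ : SqSeq μ) (η : SqSeq γ) : SqSeq (ltri μ β γ h) :=
  ⟨fun k => ⟨ket₂ β γ (η.1 k.unpair.2) ∘L (ξ.1 k.unpair.1 : 𝔎 →L[ℂ] H),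
    ket₂_comp_mem_ltri μ β γ h _ _⟩,
    SqSummable.comp_nat (x := fun m => (ξ.1 m : 𝔎 →L[ℂ] H)) (y := fun n => ket₂ β γ (η.1 n)) ξ.2
      (SqSeq.ket₂ β η)⟩

/-- The family `|ξ_m⟩₁ η_n` in `β ▷ ν`, indexed by `ℕ ≅ ℕ × ℕ`. -/
noncomputable def rtriSeq {β : BaseModule b H} {ν : BaseModule c K} (γ : BaseModule b.op K)
    (h : RhoStable γ ν) (ξ : SqSeq β) (η : SqSeq ν) : SqSeq (rtri β γ ν h) :=
  ⟨fun k => ⟨ket₁ β γ (ξ.1 k.unpair.1) ∘L (η.1 k.unpair.2 : 𝔎 →L[ℂ] K),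
    ket₁_comp_mem_rtri β γ ν h _ _⟩,
    SqSummable.comp_nat' (x := fun n => (η.1 n : 𝔎 →L[ℂ] K)) (y := fun m => ket₁ β γ (ξ.1 m)) η.2
      (SqSeq.ket₁ γ ξ)⟩

/-- The product `ω_{ξ,ξ'} ⊠ ω_{η,η'} = ω_{θ,θ'}` on `M ⊆ L(H_β ⊗ _γK)`, where `θ` is the family
`|η_n⟩₂ ξ_m` in `μ ◁ γ` and `θ'` is the family `|ξ'_m⟩₁ η'_n` in `β ▷ ν`, for
`ξ ∈ μ^∞`, `ξ' ∈ β^∞`, `η ∈ γ^∞`, `η' ∈ ν^∞`. -/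
noncomputable def boxtimes {μ : BaseModule a H} {β : BaseModule b H} {γ : BaseModule b.op K}
    {ν : BaseModule c K} (h : RhoStable β μ) (h' : RhoStable γ ν)
    (M : Submodule ℂ (RT β γ →L[ℂ] RT β γ))
    {A : Submodule ℂ (H →L[ℂ] H)} {A' : Submodule ℂ (K →L[ℂ] K)}
    (ω : Omega μ β A) (ω' : Omega γ ν A') : Omega (ltri μ β γ h) (rtri β γ ν h') M :=
  Omega.mk M (ltriSeq β h (Omega.left ω) (Omega.left ω')) (rtriSeq γ h' (Omega.right ω)
    (Omega.right ω'))

section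

variable {μ : BaseModule a H} {β : BaseModule b H} {γ : BaseModule b.op K}
  {ν : BaseModule c K} (h : RhoStable β μ) (h' : RhoStable γ ν)
  {M : Submodule ℂ (RT β γ →L[ℂ] RT β γ)}
  {A : Submodule ℂ (H →L[ℂ] H)} {A' : Submodule ℂ (K →L[ℂ] K)}

theorem hasSum_box (ξ : SqSeq μ) (ξ' : SqSeq β) (η : SqSeq γ) (η' : SqSeq ν) (x : M) :
    HasSum (fun p : ℕ × ℕ => (ket₂ β γ (η.1 p.2) ∘L (ξ.1 p.1 : 𝔎 →L[ℂ] H))† ∘L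
      (x : RT β γ →L[ℂ] RT β γ) ∘L ket₁ β γ (ξ'.1 p.1) ∘L (η'.1 p.2 : 𝔎 →L[ℂ] K))
      (omega M (ltriSeq β h ξ η) (rtriSeq γ h' ξ' η') x) :=
  (Nat.pairEquiv.symm.hasSum_iff).1 (hasSum_omega M (ltriSeq β h ξ η) (rtriSeq γ h' ξ' η') x)

theorem box_congr_left (hA : ∀ x ∈ M, ∀ s t : γ.space, (ket₂ β γ s)† ∘L x ∘L ket₂ β γ t ∈ A)
    {ξ₁ ξ₂ : SqSeq μ} {ξ₁' ξ₂' : SqSeq β} (e : omega A ξ₁ ξ₁' = omega A ξ₂ ξ₂')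
    (η : SqSeq γ) (η' : SqSeq ν) : omega M (ltriSeq β h ξ₁ η) (rtriSeq γ h' ξ₁' η') =
      omega M (ltriSeq β h ξ₂ η) (rtriSeq γ h' ξ₂' η') := by
  ext1 x
  have inner : ∀ (ξ : SqSeq μ) (ξ' : SqSeq β) (n : ℕ),
      ∑' m, ((ket₂ β γ (η.1 n) ∘L (ξ.1 m : 𝔎 →L[ℂ] H))† ∘L
        (x : RT β γ →L[ℂ] RT β γ) ∘L ket₁ β γ (ξ'.1 m) ∘L (η'.1 n : 𝔎 →L[ℂ] K)) =
      (∑' m, (ξ.1 m : 𝔎 →L[ℂ] H)† ∘L ((ket₂ β γ (η.1 n))† ∘L (x : RT β γ →L[ℂ] RT β γ)) ∘L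
        ket₁ β γ (ξ'.1 m)) ∘L (η'.1 n : 𝔎 →L[ℂ] K) := by
    intro ξ ξ' n
    have h1 := ((ξ.2.summable (SqSeq.ket₁ γ ξ')
      ((ket₂ β γ (η.1 n))† ∘L (x : RT β γ →L[ℂ] RT β γ))).hasSum.mapL
        ((compL ℂ 𝔎 K 𝔎).flip (η'.1 n : 𝔎 →L[ℂ] K)))
    refine Eq.trans (tsum_congr fun m => ?_) h1.tsum_eq
    rw [adjoint_comp]
    rfl
  have op : ∀ n, (∑' m, (ξ₁.1 m : 𝔎 →L[ℂ] H)† ∘L ((ket₂ β γ (η.1 n))† ∘L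
      (x : RT β γ →L[ℂ] RT β γ)) ∘L ket₁ β γ (ξ₁'.1 m)) =
      ∑' m, (ξ₂.1 m : 𝔎 →L[ℂ] H)† ∘L ((ket₂ β γ (η.1 n))† ∘L (x : RT β γ →L[ℂ] RT β γ)) ∘L
        ket₁ β γ (ξ₂'.1 m) := by
    intro n
    refine γ.total_space.ext fun t => ?_
    have test : ∀ (ξ : SqSeq μ) (ξ' : SqSeq β),
        (∑' m, (ξ.1 m : 𝔎 →L[ℂ] H)† ∘L ((ket₂ β γ (η.1 n))† ∘L (x : RT β γ →L[ℂ] RT β γ)) ∘L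
          ket₁ β γ (ξ'.1 m)) ∘L (t : 𝔎 →L[ℂ] K) =
        omega A ξ ξ' ⟨_, hA x x.2 (η.1 n) t⟩ := by
      intro ξ ξ'
      have h1 := ((ξ.2.summable (SqSeq.ket₁ γ ξ')
        ((ket₂ β γ (η.1 n))† ∘L (x : RT β γ →L[ℂ] RT β γ))).hasSum.mapL
          ((compL ℂ 𝔎 K 𝔎).flip (t : 𝔎 →L[ℂ] K)))
      refine h1.unique ((hasSum_omega A ξ ξ' _).congr_fun fun m => ?_)
      change (ξ.1 m : 𝔎 →L[ℂ] H)† ∘L ((ket₂ β γ (η.1 n))† ∘L (x : RT β γ →L[ℂ] RT β γ)) ∘L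
        (ket₁ β γ (ξ'.1 m) ∘L (t : 𝔎 →L[ℂ] K)) = _
      rw [← ket_comm]
      rfl
    rw [test, test, e]
  have s1 := (Equiv.prodComm ℕ ℕ).hasSum_iff.2 (hasSum_box h h' ξ₁ ξ₁' η η' x)
  have s2 := (Equiv.prodComm ℕ ℕ).hasSum_iff.2 (hasSum_box h h' ξ₂ ξ₂' η η' x)
  rw [← s1.tsum_eq, ← s2.tsum_eq, s1.summable.tsum_prod, s2.summable.tsum_prod]
  refine tsum_congr fun n => ?_
  exact (inner ξ₁ ξ₁' n).trans ((congrArg (· ∘L (η'.1 n : 𝔎 →L[ℂ] K)) (op n)).trans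
    (inner ξ₂ ξ₂' n).symm)

theorem box_congr_right (hA : ∀ x ∈ M, ∀ s t : β.space, (ket₁ β γ s)† ∘L x ∘L ket₁ β γ t ∈ A')
    (ξ : SqSeq μ) (ξ' : SqSeq β) {η₁ η₂ : SqSeq γ} {η₁' η₂' : SqSeq ν}
    (e : omega A' η₁ η₁' = omega A' η₂ η₂') :
    omega M (ltriSeq β h ξ η₁) (rtriSeq γ h' ξ' η₁') =
      omega M (ltriSeq β h ξ η₂) (rtriSeq γ h' ξ' η₂') := by
  ext1 x
  have inner : ∀ (η : SqSeq γ) (η' : SqSeq ν) (m : ℕ),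
      ∑' n, ((ket₂ β γ (η.1 n) ∘L (ξ.1 m : 𝔎 →L[ℂ] H))† ∘L
        (x : RT β γ →L[ℂ] RT β γ) ∘L ket₁ β γ (ξ'.1 m) ∘L (η'.1 n : 𝔎 →L[ℂ] K)) =
      (ξ.1 m : 𝔎 →L[ℂ] H)† ∘L ∑' n, (ket₂ β γ (η.1 n))† ∘L ((x : RT β γ →L[ℂ] RT β γ) ∘L
        ket₁ β γ (ξ'.1 m)) ∘L (η'.1 n : 𝔎 →L[ℂ] K) := by
    intro η η' m
    have h1 := (((SqSeq.ket₂ β η).summable η'.2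
      ((x : RT β γ →L[ℂ] RT β γ) ∘L ket₁ β γ (ξ'.1 m))).hasSum.mapL
        (compL ℂ 𝔎 H 𝔎 ((ξ.1 m : 𝔎 →L[ℂ] H)†)))
    refine Eq.trans (tsum_congr fun n => ?_) h1.tsum_eq
    rw [adjoint_comp]
    rfl
  have op : ∀ m, (∑' n, (ket₂ β γ (η₁.1 n))† ∘L ((x : RT β γ →L[ℂ] RT β γ) ∘L
        ket₁ β γ (ξ'.1 m)) ∘L (η₁'.1 n : 𝔎 →L[ℂ] K)) =
      ∑' n, (ket₂ β γ (η₂.1 n))† ∘L ((x : RT β γ →L[ℂ] RT β γ) ∘L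
        ket₁ β γ (ξ'.1 m)) ∘L (η₂'.1 n : 𝔎 →L[ℂ] K) := by
    intro m
    have test : ∀ (t : β.space) (η : SqSeq γ) (η' : SqSeq ν),
        (t : 𝔎 →L[ℂ] H)† ∘L (∑' n, (ket₂ β γ (η.1 n))† ∘L ((x : RT β γ →L[ℂ] RT β γ) ∘L
          ket₁ β γ (ξ'.1 m)) ∘L (η'.1 n : 𝔎 →L[ℂ] K)) =
        omega A' η η' ⟨_, hA x x.2 t (ξ'.1 m)⟩ := by
      intro t η η'
      have h1 := (((SqSeq.ket₂ β η).summable η'.2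
        ((x : RT β γ →L[ℂ] RT β γ) ∘L ket₁ β γ (ξ'.1 m))).hasSum.mapL
          (compL ℂ 𝔎 H 𝔎 ((t : 𝔎 →L[ℂ] H)†)))
      refine h1.unique ((hasSum_omega A' η η' _).congr_fun fun n => ?_)
      change ((t : 𝔎 →L[ℂ] H)† ∘L (ket₂ β γ (η.1 n))†) ∘L ((x : RT β γ →L[ℂ] RT β γ) ∘L
          ket₁ β γ (ξ'.1 m)) ∘L (η'.1 n : 𝔎 →L[ℂ] K) = _
      rw [adjoint_ket_comm]
      rfl
    refine (total_id 𝔎).ext₂ β.total_space fun _ t => ?_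
    rw [ContinuousLinearMap.comp_id, ContinuousLinearMap.comp_id, test, test, e]
  have s1 := hasSum_box h h' ξ ξ' η₁ η₁' x
  have s2 := hasSum_box h h' ξ ξ' η₂ η₂' x
  rw [← s1.tsum_eq, ← s2.tsum_eq, s1.summable.tsum_prod, s2.summable.tsum_prod]
  refine tsum_congr fun m => ?_
  exact (inner η₁ η₁' m).trans ((congrArg ((ξ.1 m : 𝔎 →L[ℂ] H)† ∘L ·) (op m)).trans
    (inner η₂ η₂' m).symm)

/-- The value of `ω ⊠ ω'` does not depend on the chosen representations. -/
theorem boxtimes_mk (hA : ∀ x ∈ M, ∀ s t : γ.space, (ket₂ β γ s)† ∘L x ∘L ket₂ β γ t ∈ A)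
    (hA' : ∀ x ∈ M, ∀ s t : β.space, (ket₁ β γ s)† ∘L x ∘L ket₁ β γ t ∈ A')
    (ξ : SqSeq μ) (ξ' : SqSeq β) (η : SqSeq γ) (η' : SqSeq ν) :
    boxtimes h h' M (Omega.mk A ξ ξ') (Omega.mk A' η η') =
      Omega.mk M (ltriSeq β h ξ η) (rtriSeq γ h' ξ' η') := by
  apply Subtype.ext
  have e1 := (Omega.eq (Omega.mk A ξ ξ')).symm
  have e2 := (Omega.eq (Omega.mk A' η η')).symm
  exact (box_congr_left h h' hA e1 _ _).trans (box_congr_right h h' hA' ξ ξ' e2)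

end

end Products

section PseudoMultiplicativeUnitary

variable {𝔎 H : Type*}
  [NormedAddCommGroup 𝔎] [InnerProductSpace ℂ 𝔎] [CompleteSpace 𝔎]
  [NormedAddCommGroup H] [InnerProductSpace ℂ H] [CompleteSpace H]

/-- A `C*`-`(𝔟†, 𝔟, 𝔟†)`-module `(H, β̂, α, β)`. -/
structure TriModule (b : CStarBase 𝔎) (H : Type*) [NormedAddCommGroup H]
    [InnerProductSpace ℂ H] [CompleteSpace H] where
  βh : BaseModule b.op H
  α : BaseModule b H
  β : BaseModule b.op H
  βh_α : RhoStable βh α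
  βh_β : RhoStable βh β
  α_βh : RhoStable α βh
  α_β : RhoStable α β
  β_βh : RhoStable β βh
  β_α : RhoStable β α

/-- A `C*`-pseudo-multiplicative unitary `V : H_β̂ ⊗ _αH → H_α ⊗ _βH`. -/
structure PMU (b : CStarBase 𝔎) (H : Type*) [NormedAddCommGroup H]
    [InnerProductSpace ℂ H] [CompleteSpace H] extends TriModule b H where
  V : RT (b := b.op) βh α ≃ₗᵢ[ℂ] RT α β
  /-- `V (α ◁ α) = α ▷ α` -/
  map_αα : MapsModule V (ltri (b := b.op) α βh α βh_α) (rtri α β α β_α)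
  /-- `V (β̂ ▷ β) = β̂ ◁ β` -/
  map_βhβ : MapsModule V (rtri (b := b.op) βh α β α_β) (ltri βh α β α_βh)
  /-- `V (β̂ ▷ β̂) = α ▷ β̂` -/
  map_βhβh : MapsModule V (rtri (b := b.op) βh α βh α_βh) (rtri α β βh β_βh)
  /-- `V (β ◁ α) = β ◁ β` -/
  map_βα : MapsModule V (ltri (b := b.op) β βh α βh_β) (ltri β α β α_β)
  /-- The pentagon equation `V₂₃ V₁₂ = V₁₂ Σ₂₃ V₁₂ (Id ⊗ Σ) V₂₃`, read from
  `(H_β̂ ⊗ _αH)_{β̂▷β̂} ⊗ _αH` to `H_α ⊗ _{β◁β}(H_α ⊗ _βH)`. -/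
  pentagon : ∀ x : RT (b := b.op) (rtri (b := b.op) βh α βh α_βh) α,
    rtMap (refl_mapsModule α) map_βα
      (rtAssoc α β βh α β_βh βh_β
        (rtMap (b := b.op) map_βhβh (refl_mapsModule α) x)) =
    rtAssoc α β α β β_α α_β
      (rtMap map_αα (refl_mapsModule β)
        (rtSigma₂₃ α β βh α α_βh βh_α
          (rtMap (b := b.op) map_βhβ (refl_mapsModule α)
            ((rtAssoc (b := b.op) βh α β α α_β β_α).symm
              (rtMap (b := b.op) (refl_mapsModule βh) (flip_mapsModule α β α β_α)
                (rtMap (b := b.op) (refl_mapsModule βh) map_αα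
                  (rtAssoc (b := b.op) βh α βh α α_βh βh_α x)))))))

namespace PMU

variable {b : CStarBase 𝔎} (W : PMU b H)

/-- `Ω̃_{β,α} = Ω_{β,α}(ρ_β̂(𝔅)')`. -/
noncomputable abbrev omegaβα : Submodule ℂ (rhoCommutant W.βh →L[ℂ] (𝔎 →L[ℂ] 𝔎)) :=
  Omega W.β W.α (rhoCommutant W.βh)

/-- `Ω̃_{α,β̂} = Ω_{α,β̂}(ρ_β(𝔅)')`. -/
noncomputable abbrev omegaαβh : Submodule ℂ (rhoCommutant W.β →L[ℂ] (𝔎 →L[ℂ] 𝔎)) :=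
  Omega W.α W.βh (rhoCommutant W.β)

/-- `∑ ⟨ξ_n|₂ V |η_n⟩₂` for `ξ ∈ β^∞` and `η ∈ α^∞`. -/
noncomputable def slice₂ (ξ : SqSeq W.β) (η : SqSeq W.α) : H →L[ℂ] H :=
  ∑' n, (ket₂ W.α W.β (ξ.1 n))† ∘L (W.V : RT (b := b.op) W.βh W.α →L[ℂ] RT W.α W.β) ∘L
    ket₂ (b := b.op) W.βh W.α (η.1 n)

/-- `∑ ⟨η_n|₁ V |ζ_n⟩₁` for `η ∈ α^∞` and `ζ ∈ β̂^∞`. -/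
noncomputable def slice₁ (η : SqSeq W.α) (ζ : SqSeq W.βh) : H →L[ℂ] H :=
  ∑' n, (ket₁ W.α W.β (η.1 n))† ∘L (W.V : RT (b := b.op) W.βh W.α →L[ℂ] RT W.α W.β) ∘L
    ket₁ (b := b.op) W.βh W.α (ζ.1 n)

theorem bra₂_mem (ξ : W.β.space) (η : W.α.space) :
    (ket₂ W.α W.β ξ)† ∘L (W.V : RT (b := b.op) W.βh W.α →L[ℂ] RT W.α W.β) ∘L
      ket₂ (b := b.op) W.βh W.α η ∈ rhoCommutant W.β :=
  bra_ket_mem W.β (ltri W.β W.α W.β W.α_β) (ltri (b := b.op) W.β W.βh W.α W.βh_β) _ _ _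
    (fun _ hy => rho_ltri_comp _ _ _ _ hy _) (fun _ hy => rho_ltri_comp _ _ _ _ hy _)
    (fun _ hy => W.map_βα.rho_comp hy)

theorem bra₁_mem (η : W.α.space) (ζ : W.βh.space) :
    (ket₁ W.α W.β η)† ∘L (W.V : RT (b := b.op) W.βh W.α →L[ℂ] RT W.α W.β) ∘L
      ket₁ (b := b.op) W.βh W.α ζ ∈ rhoCommutant W.βh :=
  bra_ket_mem W.βh (rtri W.α W.β W.βh W.β_βh) (rtri (b := b.op) W.βh W.α W.βh W.α_βh) _ _ _
    (fun _ hy => rho_rtri_comp _ _ _ _ hy _) (fun _ hy => rho_rtri_comp _ _ _ _ hy _)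
    (fun _ hy => W.map_βhβh.rho_comp hy)

theorem slice₂_mem (ξ : SqSeq W.β) (η : SqSeq W.α) : W.slice₂ ξ η ∈ rhoCommutant W.β :=
  tsum_mem_commutant fun n => W.bra₂_mem (ξ.1 n) (η.1 n)

theorem slice₁_mem (η : SqSeq W.α) (ζ : SqSeq W.βh) : W.slice₁ η ζ ∈ rhoCommutant W.βh :=
  tsum_mem_commutant fun n => W.bra₁_mem (η.1 n) (ζ.1 n)

/-- `p* (∑ ⟨ξ_n|₂ V |η_n⟩₂) q = ω_{ξ,η}(⟨p|₁ V |q⟩₁)` for `p ∈ α` and `q ∈ β̂`. -/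
theorem slice₂_test (ξ : SqSeq W.β) (η : SqSeq W.α) (p : W.α.space) (q : W.βh.space) :
    (p : 𝔎 →L[ℂ] H)† ∘L W.slice₂ ξ η ∘L (q : 𝔎 →L[ℂ] H) =
      omega (rhoCommutant W.βh) ξ η ⟨_, W.bra₁_mem p q⟩ := by
  refine slice_test ξ η _ (SqSeq.ket₂ W.α ξ) (SqSeq.ket₂ (b := b.op) W.βh η) _ _ _ fun n => ?_
  have h1 := adjoint_ket_comm W.α W.β p (ξ.1 n)
  have h2 := ket_comm (b := b.op) W.βh W.α q (η.1 n)
  change ((p : 𝔎 →L[ℂ] H)† ∘L (ket₂ W.α W.β (ξ.1 n))†) ∘L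
    (W.V : RT (b := b.op) W.βh W.α →L[ℂ] RT W.α W.β) ∘L
      (ket₂ (b := b.op) W.βh W.α (η.1 n) ∘L (q : 𝔎 →L[ℂ] H)) = _
  rw [h1, h2]
  rfl

/-- `p* (∑ ⟨η_n|₁ V |ζ_n⟩₁) q = ω_{η,ζ}(⟨p|₂ V |q⟩₂)` for `p ∈ β` and `q ∈ α`. -/
theorem slice₁_test (η : SqSeq W.α) (ζ : SqSeq W.βh) (p : W.β.space) (q : W.α.space) :
    (p : 𝔎 →L[ℂ] H)† ∘L W.slice₁ η ζ ∘L (q : 𝔎 →L[ℂ] H) =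
      omega (rhoCommutant W.β) η ζ ⟨_, W.bra₂_mem p q⟩ := by
  refine slice_test η ζ _ (SqSeq.ket₁ W.β η) (SqSeq.ket₁ (b := b.op) W.α ζ) _ _ _ fun n => ?_
  have h1 := adjoint_ket_comm W.α W.β (η.1 n) p
  have h2 := ket_comm (b := b.op) W.βh W.α (ζ.1 n) q
  change ((p : 𝔎 →L[ℂ] H)† ∘L (ket₁ W.α W.β (η.1 n))†) ∘L
    (W.V : RT (b := b.op) W.βh W.α →L[ℂ] RT W.α W.β) ∘L
      (ket₁ (b := b.op) W.βh W.α (ζ.1 n) ∘L (q : 𝔎 →L[ℂ] H)) = _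
  rw [← h1, ← h2]
  rfl

theorem hatPi_test (ω : W.omegaβα) (p : W.α.space) (q : W.βh.space) :
    (p : 𝔎 →L[ℂ] H)† ∘L W.slice₂ (Omega.left ω) (Omega.right ω) ∘L (q : 𝔎 →L[ℂ] H) =
      ω.1 ⟨_, W.bra₁_mem p q⟩ := by
  rw [slice₂_test, ← Omega.eq]

theorem pi_test (υ : W.omegaαβh) (p : W.β.space) (q : W.α.space) :
    (p : 𝔎 →L[ℂ] H)† ∘L W.slice₁ (Omega.left υ) (Omega.right υ) ∘L (q : 𝔎 →L[ℂ] H) =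
      υ.1 ⟨_, W.bra₂_mem p q⟩ := by
  rw [slice₁_test, ← Omega.eq]

/-- `π̂_V : Ω̃_{β,α} → L(H)`, `π̂_V(ω_{ξ,η}) = ∑ ⟨ξ_n|₂ V |η_n⟩₂`. -/
noncomputable def hatPi : W.omegaβα →ₗ[ℂ] (H →L[ℂ] H) where
  toFun ω := W.slice₂ (Omega.left ω) (Omega.right ω)
  map_add' ω ω' := by
    refine W.βh.total_space.ext₂ W.α.total_space fun q p => ?_
    rw [hatPi_test, ContinuousLinearMap.add_comp, ContinuousLinearMap.comp_add, hatPi_test,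
      hatPi_test]
    rfl
  map_smul' r ω := by
    refine W.βh.total_space.ext₂ W.α.total_space fun q p => ?_
    rw [hatPi_test, RingHom.id_apply, ContinuousLinearMap.smul_comp,
      ContinuousLinearMap.comp_smul, hatPi_test]
    rfl

/-- `π_V : Ω̃_{α,β̂} → L(H)`, `π_V(ω_{η,ζ}) = ∑ ⟨η_n|₁ V |ζ_n⟩₁`. -/
noncomputable def pi : W.omegaαβh →ₗ[ℂ] (H →L[ℂ] H) where
  toFun υ := W.slice₁ (Omega.left υ) (Omega.right υ)
  map_add' υ υ' := by
    refine W.α.total_space.ext₂ W.β.total_space fun q p => ?_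
    rw [pi_test, ContinuousLinearMap.add_comp, ContinuousLinearMap.comp_add, pi_test, pi_test]
    rfl
  map_smul' r υ := by
    refine W.α.total_space.ext₂ W.β.total_space fun q p => ?_
    rw [pi_test, RingHom.id_apply, ContinuousLinearMap.smul_comp,
      ContinuousLinearMap.comp_smul, pi_test]
    rfl

theorem hatPi_mk (ξ : SqSeq W.β) (η : SqSeq W.α) :
    W.hatPi (Omega.mk (rhoCommutant W.βh) ξ η) = W.slice₂ ξ η := by
  refine W.βh.total_space.ext₂ W.α.total_space fun q p => ?_
  rw [slice₂_test]
  exact W.hatPi_test _ p q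

theorem pi_mk (η : SqSeq W.α) (ζ : SqSeq W.βh) :
    W.pi (Omega.mk (rhoCommutant W.β) η ζ) = W.slice₁ η ζ := by
  refine W.α.total_space.ext₂ W.β.total_space fun q p => ?_
  rw [slice₁_test]
  exact W.pi_test _ p q

theorem hasSum_hatPi (ξ : SqSeq W.β) (η : SqSeq W.α) :
    HasSum (fun n => (ket₂ W.α W.β (ξ.1 n))† ∘L
      (W.V : RT (b := b.op) W.βh W.α →L[ℂ] RT W.α W.β) ∘L ket₂ (b := b.op) W.βh W.α (η.1 n))
      (W.hatPi (Omega.mk (rhoCommutant W.βh) ξ η)) := by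
  rw [hatPi_mk]
  exact ((SqSeq.ket₂ W.α ξ).summable (SqSeq.ket₂ (b := b.op) W.βh η) _).hasSum

theorem hasSum_pi (η : SqSeq W.α) (ζ : SqSeq W.βh) :
    HasSum (fun n => (ket₁ W.α W.β (η.1 n))† ∘L
      (W.V : RT (b := b.op) W.βh W.α →L[ℂ] RT W.α W.β) ∘L ket₁ (b := b.op) W.βh W.α (ζ.1 n))
      (W.pi (Omega.mk (rhoCommutant W.β) η ζ)) := by
  rw [pi_mk]
  exact ((SqSeq.ket₁ W.β η).summable (SqSeq.ket₁ (b := b.op) W.α ζ) _).hasSum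

theorem hatPi_mem (ω : W.omegaβα) : W.hatPi ω ∈ rhoCommutant W.β := W.slice₂_mem _ _

theorem pi_mem (υ : W.omegaαβh) : W.pi υ ∈ rhoCommutant W.βh := W.slice₁_mem _ _

/-- The Fourier algebra `Â⁰_V = π̂_V(Ω̃_{β,α})`. -/
noncomputable def hatA0 : Submodule ℂ (H →L[ℂ] H) := LinearMap.range W.hatPi

/-- The dual Fourier algebra `A⁰_V = π_V(Ω̃_{α,β̂})`. -/
noncomputable def A0 : Submodule ℂ (H →L[ℂ] H) := LinearMap.range W.pi

theorem hatA0_le : W.hatA0 ≤ rhoCommutant W.β := by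
  rintro _ ⟨ω, rfl⟩
  exact W.hatPi_mem ω

theorem A0_le : W.A0 ≤ rhoCommutant W.βh := by
  rintro _ ⟨υ, rfl⟩
  exact W.pi_mem υ

/-- `(ρ_β̂(𝔅) ⊗ ρ_β̂(𝔅))' ⊆ L(H_α ⊗ _βH)`. -/
noncomputable abbrev rangeCommutant : Submodule ℂ (RT W.α W.β →L[ℂ] RT W.α W.β) :=
  tensorCommutant W.βh W.α W.β W.βh

/-- `(ρ_β(𝔅) ⊗ ρ_β(𝔅))' ⊆ L(H_β̂ ⊗ _αH)`. -/
noncomputable abbrev sourceCommutant :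
    Submodule ℂ (RT (b := b.op) W.βh W.α →L[ℂ] RT (b := b.op) W.βh W.α) :=
  tensorCommutant (b := b.op) W.β W.βh W.α W.β

/-- `Δ_V(z) = V (z ⊗ Id) V*` for `z ∈ ρ_β̂(𝔅)'`. -/
noncomputable def delta (z : rhoCommutant W.βh) : RT W.α W.β →L[ℂ] RT W.α W.β :=
  (W.V : RT (b := b.op) W.βh W.α →L[ℂ] RT W.α W.β) ∘L
    otimesLeft (b := b.op) W.βh W.α z.1 ∘L
      (W.V.symm : RT W.α W.β →L[ℂ] RT (b := b.op) W.βh W.α)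

/-- `Δ̂_V(y) = V* (Id ⊗ y) V` for `y ∈ ρ_β(𝔅)'`. -/
noncomputable def hatDelta (y : rhoCommutant W.β) :
    RT (b := b.op) W.βh W.α →L[ℂ] RT (b := b.op) W.βh W.α :=
  (W.V.symm : RT W.α W.β →L[ℂ] RT (b := b.op) W.βh W.α) ∘L
    otimesRight W.α W.β y.1 ∘L
      (W.V : RT (b := b.op) W.βh W.α →L[ℂ] RT W.α W.β)

theorem conj_commute {X Y : Type*}
    [NormedAddCommGroup X] [InnerProductSpace ℂ X] [CompleteSpace X]
    [NormedAddCommGroup Y] [InnerProductSpace ℂ Y] [CompleteSpace Y]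
    (U : X ≃ₗᵢ[ℂ] Y) {z w : X →L[ℂ] X} {w' : Y →L[ℂ] Y} (h : z ∘L w = w ∘L z)
    (hU : (U : X →L[ℂ] Y) ∘L w = w' ∘L (U : X →L[ℂ] Y)) :
    ((U : X →L[ℂ] Y) ∘L z ∘L (U.symm : Y →L[ℂ] X)) ∘L w' =
      w' ∘L ((U : X →L[ℂ] Y) ∘L z ∘L (U.symm : Y →L[ℂ] X)) := by
  have hU' : ∀ x, U (w x) = w' (U x) := fun x => DFunLike.congr_fun hU x
  have h' : ∀ x, z (w x) = w (z x) := fun x => DFunLike.congr_fun h x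
  ext y
  obtain ⟨x, rfl⟩ := U.surjective y
  change U (z (U.symm (w' (U x)))) = w' (U (z (U.symm (U x))))
  rw [← hU', U.symm_apply_apply, U.symm_apply_apply, ← hU', h']

theorem conj_commute' {X Y : Type*}
    [NormedAddCommGroup X] [InnerProductSpace ℂ X] [CompleteSpace X]
    [NormedAddCommGroup Y] [InnerProductSpace ℂ Y] [CompleteSpace Y]
    (U : X ≃ₗᵢ[ℂ] Y) {z w' : Y →L[ℂ] Y} {w : X →L[ℂ] X} (h : z ∘L w' = w' ∘L z)
    (hU : (U : X →L[ℂ] Y) ∘L w = w' ∘L (U : X →L[ℂ] Y)) :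
    ((U.symm : Y →L[ℂ] X) ∘L z ∘L (U : X →L[ℂ] Y)) ∘L w =
      w ∘L ((U.symm : Y →L[ℂ] X) ∘L z ∘L (U : X →L[ℂ] Y)) := by
  have hU' : ∀ x, U (w x) = w' (U x) := fun x => DFunLike.congr_fun hU x
  have h' : ∀ x, z (w' x) = w' (z x) := fun x => DFunLike.congr_fun h x
  ext x
  apply U.injective
  change U (U.symm (z (U (w x)))) = U (w (U.symm (z (U x))))
  rw [hU', hU', U.apply_symm_apply, U.apply_symm_apply, h']

theorem delta_mem (z : rhoCommutant W.βh) : W.delta z ∈ W.rangeCommutant := by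
  refine (mem_tensorCommutant W.α_βh W.βh_α W.β_βh W.βh_β).2 ⟨fun y hy => ?_, fun y hy => ?_⟩
  · exact conj_commute W.V
      (otimesLeft_commute (b := b.op) W.βh W.α W.β W.α_β W.β_α hy z.2) (W.map_βhβ.rho_comp hy)
  · exact conj_commute W.V
      (otimesLeft_commute (b := b.op) W.βh W.α W.βh W.α_βh W.βh_α hy z.2)
      (W.map_βhβh.rho_comp hy)

theorem hatDelta_mem (y : rhoCommutant W.β) : W.hatDelta y ∈ W.sourceCommutant := by
  refine (mem_tensorCommutant (b := b.op) W.βh_β W.β_βh W.α_β W.β_α).2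
    ⟨fun x hx => ?_, fun x hx => ?_⟩
  · exact conj_commute' W.V
      (otimesRight_commute W.β W.α W.β W.α_β W.β_α hx y.2) (W.map_βα.rho_comp hx)
  · exact conj_commute' W.V
      (otimesRight_commute W.βh W.α W.β W.α_βh W.βh_α hx y.2) (W.map_βhβ.rho_comp hx)

/-- `ω ⊠ ω'` on `(ρ_β̂(𝔅) ⊗ ρ_β̂(𝔅))'` for `ω, ω' ∈ Ω̃_{β,α}`. -/
noncomputable def boxβα (ω ω' : W.omegaβα) :
    Omega (ltri W.β W.α W.β W.α_β) (rtri W.α W.β W.α W.β_α) W.rangeCommutant :=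
  boxtimes W.α_β W.β_α W.rangeCommutant ω ω'

/-- `υ ⊠ υ'` on `(ρ_β(𝔅) ⊗ ρ_β(𝔅))'` for `υ, υ' ∈ Ω̃_{α,β̂}`. -/
noncomputable def boxαβh (υ υ' : W.omegaαβh) :
    Omega (ltri (b := b.op) W.α W.βh W.α W.βh_α) (rtri (b := b.op) W.βh W.α W.βh W.α_βh)
      W.sourceCommutant :=
  boxtimes (b := b.op) W.βh_α W.α_βh W.sourceCommutant υ υ'

theorem boxβα_mk (ξ : SqSeq W.β) (η : SqSeq W.α) (ξ' : SqSeq W.β) (η' : SqSeq W.α) :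
    W.boxβα (Omega.mk _ ξ η) (Omega.mk _ ξ' η') =
      Omega.mk _ (ltriSeq W.α W.α_β ξ ξ') (rtriSeq W.β W.β_α η η') := by
  refine boxtimes_mk W.α_β W.β_α (fun x hx s t => ?_) (fun x hx s t => ?_) ξ η ξ' η'
  · exact bra_ket_mem W.βh (ltri W.βh W.α W.β W.α_βh) (ltri W.βh W.α W.β W.α_βh) _ _ _
      (fun _ hy => rho_ltri_comp _ _ _ _ hy _) (fun _ hy => rho_ltri_comp _ _ _ _ hy _)
      ((mem_tensorCommutant W.α_βh W.βh_α W.β_βh W.βh_β).1 hx).1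
  · exact bra_ket_mem W.βh (rtri W.α W.β W.βh W.β_βh) (rtri W.α W.β W.βh W.β_βh) _ _ _
      (fun _ hy => rho_rtri_comp _ _ _ _ hy _) (fun _ hy => rho_rtri_comp _ _ _ _ hy _)
      ((mem_tensorCommutant W.α_βh W.βh_α W.β_βh W.βh_β).1 hx).2

theorem boxαβh_mk (η : SqSeq W.α) (ζ : SqSeq W.βh) (η' : SqSeq W.α) (ζ' : SqSeq W.βh) :
    W.boxαβh (Omega.mk _ η ζ) (Omega.mk _ η' ζ') =
      Omega.mk _ (ltriSeq (b := b.op) W.βh W.βh_α η η')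
        (rtriSeq (b := b.op) W.α W.α_βh ζ ζ') := by
  refine boxtimes_mk (b := b.op) W.βh_α W.α_βh (fun x hx s t => ?_) (fun x hx s t => ?_)
    η ζ η' ζ'
  · exact bra_ket_mem W.β (ltri (b := b.op) W.β W.βh W.α W.βh_β)
      (ltri (b := b.op) W.β W.βh W.α W.βh_β) _ _ _
      (fun _ hy => rho_ltri_comp _ _ _ _ hy _) (fun _ hy => rho_ltri_comp _ _ _ _ hy _)
      ((mem_tensorCommutant (b := b.op) W.βh_β W.β_βh W.α_β W.β_α).1 hx).1
  · exact bra_ket_mem W.β (rtri (b := b.op) W.βh W.α W.β W.α_β)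
      (rtri (b := b.op) W.βh W.α W.β W.α_β) _ _ _
      (fun _ hy => rho_rtri_comp _ _ _ _ hy _) (fun _ hy => rho_rtri_comp _ _ _ _ hy _)
      ((mem_tensorCommutant (b := b.op) W.βh_β W.β_βh W.α_β W.β_α).1 hx).2

end PMU

end PseudoMultiplicativeUnitary

end CPMU

/-!
# The pairing between the Fourier algebra and the dual Fourier algebra

The slices `⟨p|₁ V |q⟩₁` (`PMU.sliceFst`) and `⟨p|₂ V |q⟩₂` (`PMU.sliceSnd`) satisfy
`ξ* ⟨η|₁ V |ζ⟩₁ η' = η* ⟨ξ|₂ V |η'⟩₂ ζ`. As `ω ∈ Ω̃_{β,α}` is norm continuous, it can be applied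
term by term to `π_V(υ) = ∑ ⟨η_n|₁ V |ζ_n⟩₁`, and the outcome is `υ(π̂_V(ω))`
(`PMU.omega_pi_eq`). So `(π̂_V(ω) | π_V(υ)) = ω(π_V(υ))` depends only on `π̂_V(ω)` and `π_V(υ)`.
The pairing is nondegenerate because the slices of `V` belong to `A⁰_V` and `Â⁰_V`, and pairing
with them gives the matrix coefficients `p* â q` and `p* a q`, which determine `â` and `a`.

For the products, two facts are combined.

* In the forms `V₂₃ V₁₂ V₂₃* = V₁₂ V₁₃` and `V₁₂* V₂₃ V₁₂ = V₁₃ V₂₃`, the pentagon equation says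
  that `Δ_V(⟨p|₁ V |q⟩₁)` and `Δ̂_V(⟨p|₂ V |q⟩₂)` have products of slices as matrix coefficients
  (`PMU.delta_sliceFst`, `PMU.hatDelta_sliceSnd`). Hence, if `σ ∈ Ω̃_{β,α}` equals
  `(ω ⊠ ω') ∘ Δ_V`, then `π̂_V(σ) = π̂_V(ω) π̂_V(ω')` (`PMU.hatPi_eq_comp`).

* Such a `σ` exists (`PMU.exists_boxβα_delta`). By the intertwining relations of `V`,
  `(ω ⊠ ω') ∘ Δ_V` is of the form `z ↦ ∑ x_k* (z ⊗ Id) y_k` with square summable `x_k` in `β ◁ α`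
  and `y_k` in `α ◁ α`, and every such map lies in `Ω̃_{β,α}` (`exists_omega_otimesLeft`). To see
  the latter, note that the frame operator `U = ∑ |f_i⟩₂⟨f_i|₂` of a finite family in `α` satisfies
  `(z ⊗ Id) U = ∑ |f_i⟩₂ z ⟨f_i|₂`, so that
  `∑_k x_k* (z ⊗ Id) U y_k = ∑_{k,i} (⟨f_i|₂ x_k)* z (⟨f_i|₂ y_k)` is in `Ω̃_{β,α}`. Frame
  operators form a contractive approximate unit on `α` (`BaseModule.exists_approx_unit`), so the
  sequence `y` can be written as `∑_j U_j w_j` with `w_0 = y`, `w_{j+1} = w_j - U_j w_j` and `w_j`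
  decaying geometrically. The weights `2^{-j}` on the side of `x` and `2^j` on the side of `w_j`
  make both resulting families square summable.

The statements on `Δ̂_V` follow in the same way, after a flip of the two legs of `H_α ⊗ _βH`.
-/

namespace CPMU

/-! ### Legs of maps between relative tensor products -/

section Intertwining

variable {𝔎 H K X Y Z : Type*}
  [NormedAddCommGroup 𝔎] [InnerProductSpace ℂ 𝔎] [CompleteSpace 𝔎]
  [NormedAddCommGroup H] [InnerProductSpace ℂ H] [CompleteSpace H]
  [NormedAddCommGroup K] [InnerProductSpace ℂ K] [CompleteSpace K]
  [NormedAddCommGroup X] [InnerProductSpace ℂ X] [CompleteSpace X]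
  [NormedAddCommGroup Y] [InnerProductSpace ℂ Y] [CompleteSpace Y]
  [NormedAddCommGroup Z] [InnerProductSpace ℂ Z] [CompleteSpace Z]

variable {a b c d : CStarBase 𝔎}

theorem rtMap_comp_ket₁ {β : BaseModule b X} {β' : BaseModule b Y} {γ : BaseModule b.op H}
    {γ' : BaseModule b.op K} {U : X ≃ₗᵢ[ℂ] Y} (hU : MapsModule U β β') {W : H ≃ₗᵢ[ℂ] K}
    (hW : MapsModule W γ γ') (ξ : β.space) :
    (rtMap hU hW : RT β γ →L[ℂ] RT β' γ') ∘L ket₁ β γ ξ =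
      ket₁ β' γ' ⟨_, hU.mem ξ⟩ ∘L (W : H →L[ℂ] K) := by
  refine γ.total_space.ext fun η => ?_
  have h := ket₁_comp β' γ' ⟨_, hU.mem ξ⟩ ⟨_, hW.mem η⟩
  rw [ContinuousLinearMap.comp_assoc, ket₁_comp, ContinuousLinearMap.comp_assoc, h]
  ext ζ
  exact (exists_rtMap hU hW).choose_spec (ξ, η) ζ

theorem rtMap_comp_ket₂ {β : BaseModule b X} {β' : BaseModule b Y} {γ : BaseModule b.op H}
    {γ' : BaseModule b.op K} {U : X ≃ₗᵢ[ℂ] Y} (hU : MapsModule U β β') {W : H ≃ₗᵢ[ℂ] K}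
    (hW : MapsModule W γ γ') (η : γ.space) :
    (rtMap hU hW : RT β γ →L[ℂ] RT β' γ') ∘L ket₂ β γ η =
      ket₂ β' γ' ⟨_, hW.mem η⟩ ∘L (U : X →L[ℂ] Y) := by
  refine β.total_space.ext fun ξ => ?_
  have h := ket₂_comp β' γ' ⟨_, hU.mem ξ⟩ ⟨_, hW.mem η⟩
  rw [ContinuousLinearMap.comp_assoc, ket₂_comp, ContinuousLinearMap.comp_assoc, h]
  ext ζ
  exact (exists_rtMap hU hW).choose_spec (ξ, η) ζ

theorem rtMap_ket₁ {β : BaseModule b X} {γ : BaseModule b.op H}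
    {γ' : BaseModule b.op K} {W : H ≃ₗᵢ[ℂ] K} (hW : MapsModule W γ γ') (ξ : β.space) (v : H) :
    rtMap (refl_mapsModule β) hW (ket₁ β γ ξ v) = ket₁ β γ' ξ (W v) :=
  DFunLike.congr_fun (rtMap_comp_ket₁ (refl_mapsModule β) hW ξ) v

theorem rtMap_ket₂ {β : BaseModule b X} {β' : BaseModule b Y} {γ : BaseModule b.op H}
    {U : X ≃ₗᵢ[ℂ] Y} (hU : MapsModule U β β') (η : γ.space) (v : X) :
    rtMap hU (refl_mapsModule γ) (ket₂ β γ η v) = ket₂ β' γ η (U v) :=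
  DFunLike.congr_fun (rtMap_comp_ket₂ hU (refl_mapsModule γ) η) v

theorem bra₁_rtMap {β : BaseModule b X} {γ : BaseModule b.op H}
    {γ' : BaseModule b.op K} {W : H ≃ₗᵢ[ℂ] K} (hW : MapsModule W γ γ') (ξ : β.space)
    (x : RT β γ) : adjoint (ket₁ β γ' ξ) (rtMap (refl_mapsModule β) hW x) =
      W (adjoint (ket₁ β γ ξ) x) := by
  refine DFunLike.congr_fun (f := (ket₁ β γ' ξ)† ∘L
    (rtMap (refl_mapsModule β) hW : RT β γ →L[ℂ] RT β γ'))
    (g := (W : H →L[ℂ] K) ∘L (ket₁ β γ ξ)†) ((total_ket₁ β γ).ext fun ξ' => ?_) x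
  have h1 : (rtMap (refl_mapsModule β) hW : RT β γ →L[ℂ] RT β γ') ∘L ket₁ β γ ξ' =
    ket₁ β γ' ξ' ∘L (W : H →L[ℂ] K) := rtMap_comp_ket₁ (refl_mapsModule β) hW ξ'
  rw [ContinuousLinearMap.comp_assoc, h1, ← ContinuousLinearMap.comp_assoc, ket₁_adjoint_comp,
    ContinuousLinearMap.comp_assoc, ket₁_adjoint_comp, hW.rho_comp (β.inner_mem ξ ξ')]

theorem bra₂_rtMap {β : BaseModule b X} {β' : BaseModule b Y} {γ : BaseModule b.op H}
    {U : X ≃ₗᵢ[ℂ] Y} (hU : MapsModule U β β') (η : γ.space) (x : RT β γ) :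
    adjoint (ket₂ β' γ η) (rtMap hU (refl_mapsModule γ) x) = U (adjoint (ket₂ β γ η) x) := by
  refine DFunLike.congr_fun (f := (ket₂ β' γ η)† ∘L
    (rtMap hU (refl_mapsModule γ) : RT β γ →L[ℂ] RT β' γ))
    (g := (U : X →L[ℂ] Y) ∘L (ket₂ β γ η)†) ((total_ket₂ β γ).ext fun η' => ?_) x
  have h1 : (rtMap hU (refl_mapsModule γ) : RT β γ →L[ℂ] RT β' γ) ∘L ket₂ β γ η' =
    ket₂ β' γ η' ∘L (U : X →L[ℂ] Y) := rtMap_comp_ket₂ hU (refl_mapsModule γ) η'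
  rw [ContinuousLinearMap.comp_assoc, h1, ← ContinuousLinearMap.comp_assoc, ket₂_adjoint_comp,
    ContinuousLinearMap.comp_assoc, ket₂_adjoint_comp, hU.rho_comp (γ.inner_mem η η')]

theorem rtFlip_ket₁ (β : BaseModule b X) (γ : BaseModule b.op Y) (ξ : β.space) (v : Y) :
    rtFlip β γ (ket₁ β γ ξ v) = ket₂ (b := b.op) γ β ξ v :=
  DFunLike.congr_fun (rtFlip_comp_ket₁ β γ ξ) v

theorem bra₂_rtFlip (β : BaseModule b X) (γ : BaseModule b.op Y) (ξ : β.space) (x : RT β γ) :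
    adjoint (ket₂ (b := b.op) γ β ξ) (rtFlip β γ x) = adjoint (ket₁ β γ ξ) x := by
  refine ext_inner_left ℂ fun v => ?_
  rw [adjoint_inner_right, adjoint_inner_right, ← rtFlip_ket₁, LinearIsometryEquiv.inner_map_map]

section Assoc

variable (β : BaseModule b X) (γ : BaseModule b.op Y) (ε : BaseModule d Y)
    (φ : BaseModule d.op Z) (h1 : RhoStable γ ε) (h2 : RhoStable ε γ)

theorem rtAssoc_ket₂_ket₁ (η : φ.space) (ξ : β.space) (y : Y) :
    rtAssoc β γ ε φ h1 h2 (ket₂ (rtri β γ ε h1) φ η (ket₁ β γ ξ y)) =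
      ket₁ β (ltri γ ε φ h2) ξ (ket₂ ε φ η y) :=
  (exists_assoc β γ ε φ h1 h2).choose_spec (η, ξ) y

theorem bra₁_rtAssoc_ket₂ (η : φ.space) (ξ : β.space) (x : RT β γ) :
    adjoint (ket₁ β (ltri γ ε φ h2) ξ)
      (rtAssoc β γ ε φ h1 h2 (ket₂ (rtri β γ ε h1) φ η x)) =
      ket₂ ε φ η (adjoint (ket₁ β γ ξ) x) := by
  refine DFunLike.congr_fun (f := (ket₁ β (ltri γ ε φ h2) ξ)† ∘L
    (rtAssoc β γ ε φ h1 h2 : RT (rtri β γ ε h1) φ →L[ℂ] RT β (ltri γ ε φ h2)) ∘L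
      ket₂ (rtri β γ ε h1) φ η)
    (g := ket₂ ε φ η ∘L (ket₁ β γ ξ)†) ((total_ket₁ β γ).ext fun ξ' => ?_) x
  have e : (rtAssoc β γ ε φ h1 h2 : RT (rtri β γ ε h1) φ →L[ℂ] RT β (ltri γ ε φ h2)) ∘L
      ket₂ (rtri β γ ε h1) φ η ∘L ket₁ β γ ξ' =
      ket₁ β (ltri γ ε φ h2) ξ' ∘L ket₂ ε φ η := by
    ext y
    exact rtAssoc_ket₂_ket₁ β γ ε φ h1 h2 η ξ' y
  calc _ = (ket₁ β (ltri γ ε φ h2) ξ)† ∘L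
        ((rtAssoc β γ ε φ h1 h2 : RT (rtri β γ ε h1) φ →L[ℂ] RT β (ltri γ ε φ h2)) ∘L
          ket₂ (rtri β γ ε h1) φ η ∘L ket₁ β γ ξ') := rfl
    _ = ((ket₁ β (ltri γ ε φ h2) ξ)† ∘L ket₁ β (ltri γ ε φ h2) ξ') ∘L ket₂ ε φ η := by
        rw [e]; rfl
    _ = ket₂ ε φ η ∘L ((ket₁ β γ ξ)† ∘L ket₁ β γ ξ') := by
        rw [ket₁_adjoint_comp, rho_ltri_comp _ _ _ _ (β.inner_mem _ _), ket₁_adjoint_comp]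
    _ = _ := rfl

theorem bra₂_rtAssoc_symm_ket₁ (η : φ.space) (ξ : β.space) (y : RT ε φ) :
    adjoint (ket₂ (rtri β γ ε h1) φ η)
      ((rtAssoc β γ ε φ h1 h2).symm (ket₁ β (ltri γ ε φ h2) ξ y)) =
      ket₁ β γ ξ (adjoint (ket₂ ε φ η) y) := by
  refine ext_inner_left ℂ fun v => ?_
  rw [adjoint_inner_right, ← LinearIsometryEquiv.inner_map_map (rtAssoc β γ ε φ h1 h2),
    LinearIsometryEquiv.apply_symm_apply, ← adjoint_inner_left, bra₁_rtAssoc_ket₂,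
    ← adjoint_inner_right, adjoint_inner_left]

theorem bra₂_bra₁_rtAssoc (η : φ.space) (ξ : β.space) (x : RT (rtri β γ ε h1) φ) :
    adjoint (ket₂ ε φ η) (adjoint (ket₁ β (ltri γ ε φ h2) ξ) (rtAssoc β γ ε φ h1 h2 x)) =
      adjoint (ket₁ β γ ξ) (adjoint (ket₂ (rtri β γ ε h1) φ η) x) := by
  refine ext_inner_left ℂ fun v => ?_
  rw [adjoint_inner_right, adjoint_inner_right, ← rtAssoc_ket₂_ket₁ β γ ε φ h1 h2,
    LinearIsometryEquiv.inner_map_map, adjoint_inner_right, adjoint_inner_right]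

end Assoc

section Sigma

variable (p : BaseModule b X) (q : BaseModule b.op Y) (r : BaseModule d X)
    (s : BaseModule d.op Z) (h1 : RhoStable p r) (h2 : RhoStable r p)

theorem rtSigma₂₃_ket₂_ket₂ (η : s.space) (ξ : q.space) (x : X) :
    rtSigma₂₃ p q r s h1 h2 (ket₂ (ltri r p q h1) s η (ket₂ p q ξ x)) =
      ket₂ (ltri p r s h2) q ξ (ket₂ r s η x) :=
  (exists_sigma₂₃ p q r s h1 h2).choose_spec (η, ξ) x

theorem bra₂_rtSigma₂₃_ket₂ (η : s.space) (ξ : q.space) (x : RT p q) :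
    adjoint (ket₂ (ltri p r s h2) q ξ)
      (rtSigma₂₃ p q r s h1 h2 (ket₂ (ltri r p q h1) s η x)) =
      ket₂ r s η (adjoint (ket₂ p q ξ) x) := by
  refine DFunLike.congr_fun (f := (ket₂ (ltri p r s h2) q ξ)† ∘L
    (rtSigma₂₃ p q r s h1 h2 : RT (ltri r p q h1) s →L[ℂ] RT (ltri p r s h2) q) ∘L
      ket₂ (ltri r p q h1) s η)
    (g := ket₂ r s η ∘L (ket₂ p q ξ)†) ((total_ket₂ p q).ext fun ξ' => ?_) x
  have e : (rtSigma₂₃ p q r s h1 h2 : RT (ltri r p q h1) s →L[ℂ] RT (ltri p r s h2) q) ∘L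
      ket₂ (ltri r p q h1) s η ∘L ket₂ p q ξ' =
      ket₂ (ltri p r s h2) q ξ' ∘L ket₂ r s η := by
    ext y
    exact rtSigma₂₃_ket₂_ket₂ p q r s h1 h2 η ξ' y
  calc _ = (ket₂ (ltri p r s h2) q ξ)† ∘L
        ((rtSigma₂₃ p q r s h1 h2 : RT (ltri r p q h1) s →L[ℂ] RT (ltri p r s h2) q) ∘L
          ket₂ (ltri r p q h1) s η ∘L ket₂ p q ξ') := rfl
    _ = ((ket₂ (ltri p r s h2) q ξ)† ∘L ket₂ (ltri p r s h2) q ξ') ∘L ket₂ r s η := by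
        rw [e]; rfl
    _ = ket₂ r s η ∘L ((ket₂ p q ξ)† ∘L ket₂ p q ξ') := by
        rw [ket₂_adjoint_comp, rho_ltri_comp _ _ _ _ (q.inner_mem _ _), ket₂_adjoint_comp]
    _ = _ := rfl

theorem bra₂_bra₂_rtSigma₂₃ (η : s.space) (ξ : q.space) (x : RT (ltri r p q h1) s) :
    adjoint (ket₂ r s η) (adjoint (ket₂ (ltri p r s h2) q ξ) (rtSigma₂₃ p q r s h1 h2 x)) =
      adjoint (ket₂ p q ξ) (adjoint (ket₂ (ltri r p q h1) s η) x) := by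
  refine ext_inner_left ℂ fun v => ?_
  rw [adjoint_inner_right, adjoint_inner_right, ← rtSigma₂₃_ket₂_ket₂ p q r s h1 h2,
    LinearIsometryEquiv.inner_map_map, adjoint_inner_right, adjoint_inner_right]

end Sigma

end Intertwining

/-! ### Slices of `V` and the pentagon equation -/

section Pentagon

variable {𝔎 H : Type*}
  [NormedAddCommGroup 𝔎] [InnerProductSpace ℂ 𝔎] [CompleteSpace 𝔎]
  [NormedAddCommGroup H] [InnerProductSpace ℂ H] [CompleteSpace H]

namespace PMU

variable {b : CStarBase 𝔎} (W : PMU b H)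

/-- The slice `⟨p|₁ V |q⟩₁ ∈ ρ_β̂(𝔅)'` of `V` in the first leg. -/
noncomputable def sliceFst (p : W.α.space) (q : W.βh.space) : rhoCommutant W.βh :=
  ⟨_, W.bra₁_mem p q⟩

/-- The slice `⟨p|₂ V |q⟩₂ ∈ ρ_β(𝔅)'` of `V` in the second leg. -/
noncomputable def sliceSnd (p : W.β.space) (q : W.α.space) : rhoCommutant W.β :=
  ⟨_, W.bra₂_mem p q⟩

/-- Slicing `V₁₂` in the first leg gives `⟨p|₁ V |q⟩₁ ⊗ Id`. -/
theorem bra₁_V₁₂_ket₁ (p : W.α.space) (q : W.βh.space) (y : RT (b := b.op) W.βh W.α) :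
    adjoint (ket₁ W.α (ltri W.β W.βh W.α W.βh_β) p)
      (rtAssoc W.α W.β W.βh W.α W.β_βh W.βh_β
        (rtMap (b := b.op) W.map_βhβh (refl_mapsModule W.α)
          ((rtAssoc (b := b.op) W.βh W.α W.βh W.α W.α_βh W.βh_α).symm
            (ket₁ (b := b.op) W.βh (ltri (b := b.op) W.α W.βh W.α W.βh_α) q y)))) =
      otimesLeft (b := b.op) W.βh W.α (W.sliceFst p q).1 y := by
  revert y
  refine (total_ket₂ (b := b.op) W.βh W.α).induction ?_ ?_ ?_ ?_ fun c v => ?_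
  · exact isClosed_eq (by fun_prop) (by fun_prop)
  · simp only [map_zero]
  · intro x y hx hy
    simp only [map_add, hx, hy]
  · intro c x hx
    simp only [map_smul, hx]
  have h1 := rtAssoc_ket₂_ket₁ (b := b.op) W.βh W.α W.βh W.α W.α_βh W.βh_α c q v
  have h2 : otimesLeft (b := b.op) W.βh W.α (W.sliceFst p q).1
      (ket₂ (b := b.op) W.βh W.α c v) = ket₂ (b := b.op) W.βh W.α c ((W.sliceFst p q).1 v) :=
    DFunLike.congr_fun (otimesLeft_comp (b := b.op) W.βh W.α (W.sliceFst p q).2 c) v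
  rw [h2, ← h1, LinearIsometryEquiv.symm_apply_apply, rtMap_ket₂ (b := b.op) W.map_βhβh]
  exact bra₁_rtAssoc_ket₂ W.α W.β W.βh W.α W.β_βh W.βh_β c p _

/-- Slicing `V₂₃` in the third leg gives `Id ⊗ ⟨p|₂ V |q⟩₂`. -/
theorem bra₂_V₂₃_ket₂ (p : W.β.space) (q : W.α.space) (y : RT W.α W.β) :
    adjoint (ket₂ (rtri W.α W.β W.α W.β_α) W.β p)
      ((rtAssoc W.α W.β W.α W.β W.β_α W.α_β).symm
        (rtMap (refl_mapsModule W.α) W.map_βα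
          (rtAssoc W.α W.β W.βh W.α W.β_βh W.βh_β
            (ket₂ (b := b.op) (rtri W.α W.β W.βh W.β_βh) W.α q y)))) =
      otimesRight W.α W.β (W.sliceSnd p q).1 y := by
  revert y
  refine (total_ket₁ W.α W.β).induction ?_ ?_ ?_ ?_ fun c v => ?_
  · exact isClosed_eq (by fun_prop) (by fun_prop)
  · simp only [map_zero]
  · intro x y hx hy
    simp only [map_add, hx, hy]
  · intro c x hx
    simp only [map_smul, hx]
  have h1 := rtAssoc_ket₂_ket₁ W.α W.β W.βh W.α W.β_βh W.βh_β q c v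
  have h2 : otimesRight W.α W.β (W.sliceSnd p q).1 (ket₁ W.α W.β c v) =
      ket₁ W.α W.β c ((W.sliceSnd p q).1 v) :=
    DFunLike.congr_fun (otimesRight_comp W.α W.β (W.sliceSnd p q).2 c) v
  rw [h2, h1, rtMap_ket₁ W.map_βα]
  exact bra₂_rtAssoc_symm_ket₁ W.α W.β W.α W.β W.β_α W.α_β p c _

theorem ket_comm_apply {X Y : Type*}
    [NormedAddCommGroup X] [InnerProductSpace ℂ X] [CompleteSpace X]
    [NormedAddCommGroup Y] [InnerProductSpace ℂ Y] [CompleteSpace Y]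
    (β : BaseModule b X) (γ : BaseModule b.op Y) (ξ : β.space) (η : γ.space) (ζ : 𝔎) :
    ket₂ β γ η ((ξ : 𝔎 →L[ℂ] X) ζ) = ket₁ β γ ξ ((η : 𝔎 →L[ℂ] Y) ζ) :=
  DFunLike.congr_fun (ket_comm β γ ξ η) ζ

theorem adjoint_ket_comm_apply {X Y : Type*}
    [NormedAddCommGroup X] [InnerProductSpace ℂ X] [CompleteSpace X]
    [NormedAddCommGroup Y] [InnerProductSpace ℂ Y] [CompleteSpace Y]
    (β : BaseModule b X) (γ : BaseModule b.op Y) (ξ : β.space) (η : γ.space) (x : RT β γ) :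
    adjoint (ξ : 𝔎 →L[ℂ] X) (adjoint (ket₂ β γ η) x) =
      adjoint (η : 𝔎 →L[ℂ] Y) (adjoint (ket₁ β γ ξ) x) :=
  DFunLike.congr_fun (adjoint_ket_comm β γ ξ η) x

/-- The matrix coefficients of `Δ_V(⟨p|₁ V |q⟩₁)`, from the pentagon equation in the form
`V₂₃ V₁₂ V₂₃* = V₁₂ V₁₃`. -/
theorem delta_sliceFst (p : W.α.space) (q : W.βh.space) (ξ ξ' : W.β.space) (η η' : W.α.space) :
    (ket₂ W.α W.β ξ' ∘L (ξ : 𝔎 →L[ℂ] H))† ∘L W.delta (W.sliceFst p q) ∘L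
      ket₁ W.α W.β η ∘L (η' : 𝔎 →L[ℂ] H) =
    (p : 𝔎 →L[ℂ] H)† ∘L ((W.sliceSnd ξ η).1 ∘L (W.sliceSnd ξ' η').1) ∘L (q : 𝔎 →L[ℂ] H) := by
  rw [adjoint_comp]
  ext ζ
  change adjoint (ξ : 𝔎 →L[ℂ] H) (adjoint (ket₂ W.α W.β ξ') (W.V
    (otimesLeft (b := b.op) W.βh W.α (W.sliceFst p q).1
      (W.V.symm (ket₁ W.α W.β η ((η' : 𝔎 →L[ℂ] H) ζ)))))) =
    adjoint (p : 𝔎 →L[ℂ] H) ((W.sliceSnd ξ η).1 ((W.sliceSnd ξ' η').1 ((q : 𝔎 →L[ℂ] H) ζ)))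
  -- The pentagon equation at `V₂₃* |q⟩₁ |η⟩₁ η' ζ`, sliced by `⟨p|₁` in the first leg, then by
  -- `⟨ξ'|₂` and `ξ*`; the first slice turns `V₁₂` on the left into `⟨p|₁ V |q⟩₁ ⊗ Id`.
  have pent := congrArg (fun x => adjoint (ξ : 𝔎 →L[ℂ] H) (adjoint (ket₂ W.α W.β ξ')
    (adjoint (ket₁ W.α (ltri W.β W.α W.β W.α_β) p) x)))
    (W.pentagon ((rtAssoc (b := b.op) W.βh W.α W.βh W.α W.α_βh W.βh_α).symm
      (ket₁ (b := b.op) W.βh (ltri (b := b.op) W.α W.βh W.α W.βh_α) q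
        (W.V.symm (ket₁ W.α W.β η ((η' : 𝔎 →L[ℂ] H) ζ))))))
  rw [bra₁_rtMap W.map_βα, bra₁_V₁₂_ket₁] at pent
  refine pent.trans ?_
  rw [LinearIsometryEquiv.apply_symm_apply, rtMap_ket₁ (b := b.op) W.map_αα,
    LinearIsometryEquiv.apply_symm_apply,
    rtMap_ket₁ (b := b.op) (flip_mapsModule W.α W.β W.α W.β_α), rtFlip_ket₁]
  have h1 := rtAssoc_ket₂_ket₁ (b := b.op) W.βh W.α W.β W.α W.α_β W.β_α η q
    ((η' : 𝔎 →L[ℂ] H) ζ)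
  have h2 := ket_comm_apply (b := b.op) W.βh W.α q η' ζ
  have h3 := bra₂_bra₁_rtAssoc W.α W.β W.α W.β W.β_α W.α_β ξ' p
  rw [h3, ← h1, LinearIsometryEquiv.symm_apply_apply, rtMap_ket₂ (b := b.op) W.map_βhβ,
    bra₂_rtMap W.map_αα]
  have h4 := bra₂_rtSigma₂₃_ket₂ W.α W.β W.βh W.α W.α_βh W.βh_α η ξ'
    (W.V (ket₁ (b := b.op) W.βh W.α q ((η' : 𝔎 →L[ℂ] H) ζ)))
  refine (congrArg (fun v => adjoint (ξ : 𝔎 →L[ℂ] H)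
    (adjoint (ket₁ W.α W.β p) (W.V v))) h4).trans ?_
  have h5 := adjoint_ket_comm_apply W.α W.β p ξ
  rw [← h5, ← h2]
  rfl

/-- The matrix coefficients of `Δ̂_V(⟨p|₂ V |q⟩₂)`, from the pentagon equation in the form
`V₁₂* V₂₃ V₁₂ = V₁₃ V₂₃`. -/
theorem hatDelta_sliceSnd (p : W.β.space) (q : W.α.space) (η η' : W.α.space)
    (ζ ζ' : W.βh.space) :
    (ket₂ (b := b.op) W.βh W.α η' ∘L (η : 𝔎 →L[ℂ] H))† ∘L W.hatDelta (W.sliceSnd p q) ∘L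
      ket₁ (b := b.op) W.βh W.α ζ ∘L (ζ' : 𝔎 →L[ℂ] H) =
    (p : 𝔎 →L[ℂ] H)† ∘L ((W.sliceFst η ζ).1 ∘L (W.sliceFst η' ζ').1) ∘L (q : 𝔎 →L[ℂ] H) := by
  rw [adjoint_comp]
  ext v
  change adjoint (η : 𝔎 →L[ℂ] H) (adjoint (ket₂ (b := b.op) W.βh W.α η') (W.V.symm
    (otimesRight W.α W.β (W.sliceSnd p q).1
      (W.V (ket₁ (b := b.op) W.βh W.α ζ ((ζ' : 𝔎 →L[ℂ] H) v)))))) =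
    adjoint (p : 𝔎 →L[ℂ] H) ((W.sliceFst η ζ).1 ((W.sliceFst η' ζ').1 ((q : 𝔎 →L[ℂ] H) v)))
  -- The pentagon equation at `|q⟩₂ |ζ⟩₁ ζ' v`, sliced by `⟨p|₂` in the third leg, then by
  -- `⟨η'|₂` and `η*` after `V*`; the first slice turns `V₂₃` into `Id ⊗ ⟨p|₂ V |q⟩₂`.
  have pent := congrArg (fun x => adjoint (η : 𝔎 →L[ℂ] H)
    (adjoint (ket₂ (b := b.op) W.βh W.α η') (W.V.symm
      (adjoint (ket₂ (rtri W.α W.β W.α W.β_α) W.β p)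
        ((rtAssoc W.α W.β W.α W.β W.β_α W.α_β).symm x)))))
    (W.pentagon (ket₂ (b := b.op) (rtri (b := b.op) W.βh W.α W.βh W.α_βh) W.α q
      (ket₁ (b := b.op) W.βh W.α ζ ((ζ' : 𝔎 →L[ℂ] H) v))))
  rw [rtMap_ket₂ (b := b.op) W.map_βhβh, bra₂_V₂₃_ket₂] at pent
  refine pent.trans ?_
  have h1 := rtAssoc_ket₂_ket₁ (b := b.op) W.βh W.α W.βh W.α W.α_βh W.βh_α q ζ
    ((ζ' : 𝔎 →L[ℂ] H) v)
  have h2 := ket_comm_apply (b := b.op) W.βh W.α ζ' q v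
  rw [LinearIsometryEquiv.symm_apply_apply, bra₂_rtMap W.map_αα,
    LinearIsometryEquiv.symm_apply_apply, h1, rtMap_ket₁ (b := b.op) W.map_αα,
    rtMap_ket₁ (b := b.op) (flip_mapsModule W.α W.β W.α W.β_α)]
  have h4 := bra₂_bra₂_rtSigma₂₃ W.α W.β W.βh W.α W.α_βh W.βh_α η' p
  rw [h4]
  have h5 := bra₂_rtMap (b := b.op) W.map_βhβ η'
  rw [h5]
  have h6 := bra₂_rtAssoc_symm_ket₁ (b := b.op) W.βh W.α W.β W.α W.α_β W.β_α η' ζ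
  rw [h6, bra₂_rtFlip, adjoint_ket_comm_apply W.α W.β, h2]
  rfl

end PMU

end Pentagon

/-! ### Square summable families and frames -/

section SquareSummable

variable {X E F G : Type*}
  [NormedAddCommGroup X] [InnerProductSpace ℂ X] [CompleteSpace X]
  [NormedAddCommGroup E] [InnerProductSpace ℂ E] [CompleteSpace E]
  [NormedAddCommGroup F] [InnerProductSpace ℂ F] [CompleteSpace F]
  [NormedAddCommGroup G] [InnerProductSpace ℂ G] [CompleteSpace G]

theorem SqSummable.norm_sum_le {ι : Type*} {x : ι → X →L[ℂ] E} (hx : SqSummable x)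
    (s : Finset ι) : ‖∑ i ∈ s, (x i)† ∘L x i‖ ≤ ‖∑' i, (x i)† ∘L x i‖ := by
  rw [norm_colOp_sq, ← Real.sq_sqrt (norm_nonneg (∑' i, (x i)† ∘L x i))]
  have := hx.norm_colOp_le s
  gcongr

theorem SqSummable.of_finite {ι : Type*} [Finite ι] (x : ι → X →L[ℂ] E) : SqSummable x :=
  Summable.of_finite

theorem SqSummable.comp_left {ι : Type*} {x : ι → X →L[ℂ] E} (hx : SqSummable x)
    (T : E →L[ℂ] F) : SqSummable fun i => T ∘L x i := by
  refine (hx.summable hx (T† ∘L T)).congr fun i => ?_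
  rw [adjoint_comp]
  rfl

theorem SqSummable.smul {ι : Type*} {x : ι → X →L[ℂ] E} (hx : SqSummable x) (r : ℂ) :
    SqSummable fun i => r • x i := by
  have := hx.comp_left (r • ContinuousLinearMap.id ℂ E)
  simpa only [ContinuousLinearMap.smul_comp, ContinuousLinearMap.id_comp] using this

theorem tsum_adjoint_smul_comp_smul {ι : Type*} (x : ι → X →L[ℂ] E) (r : ℂ) :
    ‖∑' i, (r • x i)† ∘L (r • x i)‖ = ‖r‖ ^ 2 * ‖∑' i, (x i)† ∘L x i‖ := by
  have : ∀ i, (r • x i)† ∘L (r • x i) = (starRingEnd ℂ r * r) • ((x i)† ∘L x i) := fun i => by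
    rw [map_smulₛₗ, ContinuousLinearMap.smul_comp, ContinuousLinearMap.comp_smul, smul_smul]
  rw [tsum_congr this, tsum_const_smul'', norm_smul, norm_mul, RCLike.norm_conj, sq]

/-- A family of operators is square summable if it splits into square summable blocks whose
square sums have summable norms. -/
theorem SqSummable.sigma {κ : ℕ → Type*} {x : (Σ j, κ j) → X →L[ℂ] E}
    (hx : ∀ j, SqSummable fun i : κ j => x ⟨j, i⟩) {c : ℕ → ℝ} (hc : Summable c)
    (h : ∀ j, ‖∑' i : κ j, (x ⟨j, i⟩)† ∘L x ⟨j, i⟩‖ ≤ c j) : SqSummable x := by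
  classical
  rw [SqSummable, summable_iff_vanishing_norm]
  intro ε hε
  obtain ⟨J, hJ⟩ := summable_iff_vanishing_norm.1 hc (ε / 2) (half_pos hε)
  have hδ : 0 < ε / (2 * (J.card + 1)) := by positivity
  choose s hs using fun j => summable_iff_vanishing_norm.1 (hx j) _ hδ
  refine ⟨J.sigma s, fun t ht => ?_⟩
  let r : ∀ j, Finset (κ j) := fun j =>
    t.preimage (Sigma.mk j) (sigma_mk_injective.injOn)
  have e1 : ∀ j, ∑ p ∈ t with p.1 = j, (x p)† ∘L x p = ∑ i ∈ r j, (x ⟨j, i⟩)† ∘L x ⟨j, i⟩ := by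
    intro j
    have e : r j = (t.filter fun p => p.1 = j).preimage (Sigma.mk j)
        (sigma_mk_injective.injOn) := by
      ext i; simp [r]
    rw [e]
    refine (Finset.sum_preimage (Sigma.mk j) _ _ (fun p => (x p)† ∘L x p) ?_).symm
    rintro ⟨j', i⟩ hp hn
    obtain rfl : j' = j := (Finset.mem_filter.1 hp).2
    exact absurd ⟨i, rfl⟩ hn
  have e2 : ∑ p ∈ t, (x p)† ∘L x p =
      ∑ j ∈ t.image Sigma.fst, ∑ i ∈ r j, (x ⟨j, i⟩)† ∘L x ⟨j, i⟩ := by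
    rw [← Finset.sum_fiberwise_of_maps_to (s := t) (t := t.image Sigma.fst) (g := Sigma.fst)
      (fun p hp => Finset.mem_image_of_mem _ hp)]
    exact Finset.sum_congr rfl fun j _ => e1 j
  have b1 : ∀ j ∈ J, ‖∑ i ∈ r j, (x ⟨j, i⟩)† ∘L x ⟨j, i⟩‖ ≤ ε / (2 * (J.card + 1)) := by
    intro j hj
    refine (hs j (r j) (Finset.disjoint_left.2 fun i hi hi' => ?_)).le
    exact Finset.disjoint_left.1 ht (Finset.mem_preimage.1 hi) (Finset.mem_sigma.2 ⟨hj, hi'⟩)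
  have b2 : ∀ j, ‖∑ i ∈ r j, (x ⟨j, i⟩)† ∘L x ⟨j, i⟩‖ ≤ c j := fun j =>
    ((hx j).norm_sum_le _).trans (h j)
  rw [e2, ← Finset.sum_filter_add_sum_filter_not (t.image Sigma.fst) (· ∈ J)]
  have c1 : ‖∑ j ∈ t.image Sigma.fst with j ∈ J, ∑ i ∈ r j, (x ⟨j, i⟩)† ∘L x ⟨j, i⟩‖
      < ε / 2 := by
    refine (norm_sum_le_of_le _ fun j hj => b1 j (Finset.mem_filter.1 hj).2).trans_lt ?_
    have hcard : ((t.image Sigma.fst).filter (· ∈ J)).card ≤ J.card :=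
      Finset.card_le_card fun j hj => (Finset.mem_filter.1 hj).2
    have hcard' : (((t.image Sigma.fst).filter (· ∈ J)).card : ℝ) ≤ J.card := by
      exact_mod_cast hcard
    rw [Finset.sum_const, nsmul_eq_mul]
    calc _ ≤ (J.card : ℝ) * (ε / (2 * (J.card + 1))) := by gcongr
      _ = ε / 2 * (J.card / (J.card + 1)) := by field_simp
      _ < ε / 2 := by
        refine mul_lt_of_lt_one_right (half_pos hε) ?_
        rw [div_lt_one (by positivity)]
        linarith
  have c2 : ‖∑ j ∈ t.image Sigma.fst with ¬ j ∈ J, ∑ i ∈ r j, (x ⟨j, i⟩)† ∘L x ⟨j, i⟩‖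
      < ε / 2 := by
    refine (norm_sum_le_of_le _ fun j _ => b2 j).trans_lt ?_
    refine (le_abs_self _).trans_lt (hJ _ (Finset.disjoint_left.2 fun j hj => ?_))
    exact (Finset.mem_filter.1 hj).2
  calc _ ≤ _ := norm_add_le _ _
    _ < ε / 2 + ε / 2 := add_lt_add c1 c2
    _ = ε := add_halves ε

/-- `∑_{k,i} (A_i x_k)* T (A_i y_k) = ∑_k x_k* (∑_i A_i* T A_i) y_k` for a finite family `A`. -/
theorem tsum_finite_family {ι κ : Type*} [Fintype κ] {x : ι → X →L[ℂ] E} (hx : SqSummable x)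
    {y : ι → G →L[ℂ] E} (hy : SqSummable y) (A : κ → E →L[ℂ] F) (T : F →L[ℂ] F) :
    ∑' p : ι × κ, (A p.2 ∘L x p.1)† ∘L T ∘L (A p.2 ∘L y p.1) =
      ∑' k, (x k)† ∘L (∑ i, (A i)† ∘L T ∘L A i) ∘L y k := by
  have hA : SqSummable A := SqSummable.of_finite A
  have hs := (hx.comp hA).summable (hy.comp hA) T
  rw [hs.tsum_prod]
  refine tsum_congr fun k => ?_
  rw [tsum_fintype, ContinuousLinearMap.finsetSum_comp, ContinuousLinearMap.comp_finsetSum]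
  refine Finset.sum_congr rfl fun i _ => ?_
  rw [adjoint_comp]
  rfl

theorem norm_tsum_finite_family_le {ι κ : Type*} [Fintype κ] {x : ι → X →L[ℂ] E}
    (hx : SqSummable x) (A : κ → E →L[ℂ] F) (hA : ‖∑ i, (A i)† ∘L A i‖ ≤ 1) :
    ‖∑' p : ι × κ, (A p.2 ∘L x p.1)† ∘L (A p.2 ∘L x p.1)‖ ≤ ‖∑' k, (x k)† ∘L x k‖ := by
  have h := tsum_finite_family hx hx A (ContinuousLinearMap.id ℂ F)
  simp only [ContinuousLinearMap.id_comp] at h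
  rw [h]
  refine (hx.norm_tsum_le hx _).trans ?_
  rw [Real.mul_self_sqrt (norm_nonneg _)]
  exact mul_le_of_le_one_right (norm_nonneg _) hA

end SquareSummable

section Approximation

variable {𝔎 H K : Type*}
  [NormedAddCommGroup 𝔎] [InnerProductSpace ℂ 𝔎] [CompleteSpace 𝔎]
  [NormedAddCommGroup H] [InnerProductSpace ℂ H] [CompleteSpace H]
  [NormedAddCommGroup K] [InnerProductSpace ℂ K] [CompleteSpace K]

variable {a b c : CStarBase 𝔎}

theorem SqSeq.exists_extend {ι : Type*} {f : ι → ℕ} (hf : Function.Injective f)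
    {θ : BaseModule a H} (ζ : ι → θ.space) (hζ : SqSummable fun i => (ζ i : 𝔎 →L[ℂ] H)) :
    ∃ ζ' : SqSeq θ, (∀ i, ζ'.1 (f i) = ζ i) ∧ ∀ n ∉ Set.range f, ζ'.1 n = 0 := by
  have h1 : ∀ i, Function.extend f ζ 0 (f i) = ζ i := hf.extend_apply ζ 0
  have h0 : ∀ n ∉ Set.range f, Function.extend f ζ 0 n = 0 := fun n hn =>
    Function.extend_apply' _ _ _ hn
  refine ⟨⟨Function.extend f ζ 0, ?_⟩, h1, h0⟩
  refine (hf.summable_iff fun n hn => ?_).1 (hζ.congr fun i => ?_)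
  · change ((Function.extend f ζ 0 : ℕ → θ.space) n : 𝔎 →L[ℂ] H)† ∘L
      ((Function.extend f ζ 0 : ℕ → θ.space) n : 𝔎 →L[ℂ] H) = 0
    rw [h0 n hn, Submodule.coe_zero, ContinuousLinearMap.comp_zero]
  · change _ = ((Function.extend f ζ 0 : ℕ → θ.space) (f i) : 𝔎 →L[ℂ] H)† ∘L
      ((Function.extend f ζ 0 : ℕ → θ.space) (f i) : 𝔎 →L[ℂ] H)
    rw [h1]

/-- A countable family of pairs `(ξ_i, η_i)` defines an element of `Ω_{β,α}(A)`. -/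
theorem Omega.exists_of_countable {ι : Type*} [Countable ι] {β : BaseModule a H}
    {α : BaseModule c H} (A : Submodule ℂ (H →L[ℂ] H)) (ξ : ι → β.space) (η : ι → α.space)
    (hξ : SqSummable fun i => (ξ i : 𝔎 →L[ℂ] H)) (hη : SqSummable fun i => (η i : 𝔎 →L[ℂ] H)) :
    ∃ ω : Omega β α A, ∀ T : A, HasSum (fun i => (ξ i : 𝔎 →L[ℂ] H)† ∘L (T : H →L[ℂ] H) ∘L
      (η i : 𝔎 →L[ℂ] H)) (ω.1 T) := by
  obtain ⟨f, hf⟩ := exists_injective_nat ι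
  obtain ⟨ξ', h1, -⟩ := SqSeq.exists_extend hf ξ hξ
  obtain ⟨η', h2, h2'⟩ := SqSeq.exists_extend hf η hη
  refine ⟨Omega.mk A ξ' η', fun T => ?_⟩
  have h := (hf.hasSum_iff fun n hn => ?_).2 (hasSum_omega A ξ' η' T)
  · refine h.congr_fun fun i => ?_
    rw [Function.comp_apply, h1, h2]
  · rw [h2' n hn, Submodule.coe_zero, ContinuousLinearMap.comp_zero,
      ContinuousLinearMap.comp_zero]

theorem BaseModule.comp_mem (α : BaseModule b H) {ξ c : _} (hξ : ξ ∈ α.space) (hc : c ∈ b.B) :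
    ξ ∘L c ∈ α.space :=
  α.space_base.le (subset_clspan ⟨ξ, hξ, c, hc, rfl⟩)

theorem BaseModule.comp_adjoint_comp_mem (α : BaseModule b H) (ξ ξ' ξ'' : α.space) :
    (ξ : 𝔎 →L[ℂ] H) ∘L (ξ' : 𝔎 →L[ℂ] H)† ∘L (ξ'' : 𝔎 →L[ℂ] H) ∈ α.space :=
  α.comp_mem ξ.2 (α.inner_mem ξ' ξ'')

/-- The frame operator `∑ x_i x_i*` of a finite family. -/
noncomputable def frameOp {ι : Type*} [Fintype ι] (x : ι → 𝔎 →L[ℂ] H) : H →L[ℂ] H :=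
  ∑ i, x i ∘L (x i)†

theorem comp_adjoint_nonneg (x : 𝔎 →L[ℂ] H) : 0 ≤ x ∘L x† := by
  rw [nonneg_iff_isPositive]
  have := isPositive_adjoint_comp_self (x†)
  rwa [adjoint_adjoint] at this

theorem frameOp_nonneg {ι : Type*} [Fintype ι] (x : ι → 𝔎 →L[ℂ] H) : 0 ≤ frameOp x :=
  Finset.sum_nonneg fun i _ => comp_adjoint_nonneg (x i)

/-- The operators that leave `α` invariant together with their adjoints. -/
def BaseModule.stabilizer (α : BaseModule b H) : StarSubalgebra ℝ (H →L[ℂ] H) where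
  carrier := {T | (∀ ξ ∈ α.space, T ∘L ξ ∈ α.space) ∧ ∀ ξ ∈ α.space, T† ∘L ξ ∈ α.space}
  mul_mem' := by
    rintro S T ⟨hS, hS'⟩ ⟨hT, hT'⟩
    have e : S * T = S ∘L T := rfl
    rw [e]
    refine ⟨fun ξ hξ => ?_, fun ξ hξ => ?_⟩
    · rw [ContinuousLinearMap.comp_assoc]
      exact hS _ (hT ξ hξ)
    · rw [adjoint_comp, ContinuousLinearMap.comp_assoc]
      exact hT' _ (hS' ξ hξ)
  add_mem' := by
    rintro S T ⟨hS, hS'⟩ ⟨hT, hT'⟩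
    refine ⟨fun ξ hξ => ?_, fun ξ hξ => ?_⟩
    · rw [ContinuousLinearMap.add_comp]
      exact add_mem (hS ξ hξ) (hT ξ hξ)
    · rw [map_add, ContinuousLinearMap.add_comp]
      exact add_mem (hS' ξ hξ) (hT' ξ hξ)
  algebraMap_mem' := fun r => by
    have e : algebraMap ℝ (H →L[ℂ] H) r = r • (1 : H →L[ℂ] H) := Algebra.algebraMap_eq_smul_one r
    have e' : (r • (1 : H →L[ℂ] H))† = r • (1 : H →L[ℂ] H) :=
      (star_smul r (1 : H →L[ℂ] H)).trans (by rw [star_one]; rfl)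
    have h : ∀ ξ ∈ α.space, (r • (1 : H →L[ℂ] H)) ∘L ξ ∈ α.space := fun ξ hξ =>
      α.space.smul_mem (r : ℂ) hξ
    rw [e]
    refine ⟨h, ?_⟩
    rw [e']
    exact h
  star_mem' := by
    rintro T ⟨hT, hT'⟩
    refine ⟨hT', fun ξ hξ => ?_⟩
    rw [star_eq_adjoint, adjoint_adjoint]
    exact hT ξ hξ

theorem mem_stabilizer {α : BaseModule b H} {T : H →L[ℂ] H} : T ∈ α.stabilizer ↔
    (∀ ξ ∈ α.space, T ∘L ξ ∈ α.space) ∧ ∀ ξ ∈ α.space, T† ∘L ξ ∈ α.space := Iff.rfl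

/-- Together with `frameOp_mem_stabilizer`, this puts every continuous function of a frame operator
of `α` into the stabilizer, so that it maps `α` to itself. -/
theorem BaseModule.isClosed_stabilizer (α : BaseModule b H) :
    IsClosed (α.stabilizer : Set (H →L[ℂ] H)) := by
  have : (α.stabilizer : Set (H →L[ℂ] H)) =
      (⋂ ξ ∈ α.space, {T : H →L[ℂ] H | T ∘L ξ ∈ α.space}) ∩
        ⋂ ξ ∈ α.space, {T : H →L[ℂ] H | T† ∘L ξ ∈ α.space} := by
    ext T
    simp [BaseModule.stabilizer]
  rw [this]
  have hc : ∀ ξ : 𝔎 →L[ℂ] H, IsClosed {T : H →L[ℂ] H | T ∘L ξ ∈ α.space} := fun ξ =>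
    α.isClosed_space.preimage ((compL ℂ 𝔎 H H).flip ξ).continuous
  refine IsClosed.inter (isClosed_biInter fun ξ _ => hc ξ) (isClosed_biInter fun ξ _ => ?_)
  exact (hc ξ).preimage (adjoint (𝕜 := ℂ) (E := H) (F := H)).continuous

theorem frameOp_comp_mem {ι : Type*} [Fintype ι] (α : BaseModule b H)
    (x : ι → α.space) {ξ : 𝔎 →L[ℂ] H} (hξ : ξ ∈ α.space) :
    frameOp (fun i => (x i : 𝔎 →L[ℂ] H)) ∘L ξ ∈ α.space := by
  rw [frameOp, ContinuousLinearMap.finsetSum_comp]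
  refine sum_mem fun i _ => ?_
  rw [ContinuousLinearMap.comp_assoc]
  exact α.comp_adjoint_comp_mem (x i) (x i) ⟨ξ, hξ⟩

theorem frameOp_adjoint {ι : Type*} [Fintype ι] (x : ι → 𝔎 →L[ℂ] H) :
    (frameOp x)† = frameOp x :=
  (IsSelfAdjoint.of_nonneg (frameOp_nonneg x)).adjoint_eq

theorem frameOp_mem_stabilizer {ι : Type*} [Fintype ι] (α : BaseModule b H)
    (x : ι → α.space) : frameOp (fun i => (x i : 𝔎 →L[ℂ] H)) ∈ α.stabilizer := by
  rw [mem_stabilizer, frameOp_adjoint]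
  exact ⟨fun ξ hξ => frameOp_comp_mem α x hξ, fun ξ hξ => frameOp_comp_mem α x hξ⟩

/-- In a `C*`-algebra, `k = (h + ε)^{-1/2}` satisfies `0 ≤ k h k ≤ 1`, and `1 - k h k` nearly
annihilates `h`. -/
theorem exists_resolvent_sqrt {A : Type*} [CStarAlgebra A] [PartialOrder A] [StarOrderedRing A]
    {h : A} (h0 : 0 ≤ h) {ε : ℝ} (hε : 0 < ε) :
    ∃ k ∈ StarAlgebra.elemental ℝ h, IsSelfAdjoint k ∧ ‖k * h * k‖ ≤ 1 ∧ ‖1 - k * h * k‖ ≤ 1 ∧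
      IsSelfAdjoint (1 - k * h * k) ∧ ‖(1 - k * h * k) * h * (1 - k * h * k)‖ ≤ ε := by
  have hsa : IsSelfAdjoint h := IsSelfAdjoint.of_nonneg h0
  have spec : ∀ t ∈ spectrum ℝ h, 0 ≤ t := fun t ht => spectrum_nonneg_of_nonneg h0 ht
  have hpos : ∀ t ∈ spectrum ℝ h, 0 < t + ε := fun t ht => by linarith [spec t ht]
  have hle : ∀ t ∈ spectrum ℝ h, t / (t + ε) ≤ 1 := fun t ht => by
    rw [div_le_one (hpos t ht)]; linarith
  have hle' : ∀ t ∈ spectrum ℝ h, ε / (t + ε) ≤ 1 := fun t ht => by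
    rw [div_le_one (hpos t ht)]; linarith [spec t ht]
  have hf : ContinuousOn (fun t : ℝ => (√(t + ε))⁻¹) (spectrum ℝ h) :=
    ContinuousOn.inv₀ (by fun_prop) fun t ht => (Real.sqrt_pos.2 (hpos t ht)).ne'
  have hg : ContinuousOn (fun t : ℝ => t / (t + ε)) (spectrum ℝ h) :=
    continuousOn_id.div (by fun_prop) fun t ht => (hpos t ht).ne'
  have hg' : ContinuousOn (fun t : ℝ => ε / (t + ε)) (spectrum ℝ h) :=
    continuousOn_const.div (by fun_prop) fun t ht => (hpos t ht).ne'
  have mid : ∀ f : ℝ → ℝ, ContinuousOn f (spectrum ℝ h) →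
      cfc f h * h * cfc f h = cfc (fun t => f t * t * f t) h := fun f hf => by
    rw [cfc_mul (fun t => f t * t) f h (hf.mul continuousOn_id) hf,
      cfc_mul f (fun t => t) h hf continuousOn_id, cfc_id' ℝ h]
  have hu : cfc (fun t : ℝ => (√(t + ε))⁻¹) h * h * cfc (fun t : ℝ => (√(t + ε))⁻¹) h =
      cfc (fun t => t / (t + ε)) h := by
    rw [mid _ hf]
    refine cfc_congr fun t ht => ?_
    rw [mul_assoc, mul_comm, mul_assoc, ← mul_inv, Real.mul_self_sqrt (hpos t ht).le,
      div_eq_mul_inv]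
  have hv : 1 - cfc (fun t : ℝ => t / (t + ε)) h = cfc (fun t => ε / (t + ε)) h := by
    rw [← cfc_one ℝ h, ← cfc_sub (1 : ℝ → ℝ) _ h continuousOn_const hg]
    refine cfc_congr fun t ht => ?_
    have := (hpos t ht).ne'
    change 1 - t / (t + ε) = ε / (t + ε)
    field_simp
    ring
  refine ⟨cfc (fun t : ℝ => (√(t + ε))⁻¹) h, cfc_mem_elemental _ h, cfc_predicate _ h, ?_⟩
  rw [hu, hv, mid _ hg']
  refine ⟨norm_cfc_le zero_le_one fun t ht => ?_, norm_cfc_le zero_le_one fun t ht => ?_,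
    cfc_predicate _ h, norm_cfc_le hε.le fun t ht => ?_⟩
  · rw [Real.norm_of_nonneg (div_nonneg (spec t ht) (hpos t ht).le)]
    exact hle t ht
  · rw [Real.norm_of_nonneg (div_nonneg hε.le (hpos t ht).le)]
    exact hle' t ht
  · have h1 := spec t ht
    have h2 := hpos t ht
    have h3 := hle t ht
    have h4 := hle' t ht
    rw [Real.norm_of_nonneg (by positivity)]
    calc ε / (t + ε) * t * (ε / (t + ε)) = ε * (t / (t + ε)) * (ε / (t + ε)) := by ring
      _ ≤ ε * 1 * 1 := by gcongr
      _ = ε := by ring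

theorem frameOp_comp_left {ι : Type*} [Fintype ι] (x : ι → 𝔎 →L[ℂ] H) (T : H →L[ℂ] H) :
    frameOp (fun i => T ∘L x i) = T ∘L frameOp x ∘L T† := by
  rw [frameOp, frameOp, ContinuousLinearMap.finsetSum_comp, ContinuousLinearMap.comp_finsetSum]
  refine Finset.sum_congr rfl fun i _ => ?_
  rw [adjoint_comp]
  rfl

theorem norm_sq_le_norm_frameOp {ι : Type*} [Fintype ι] (x : ι → 𝔎 →L[ℂ] H) (i : ι) :
    ‖x i‖ ^ 2 ≤ ‖frameOp x‖ := by
  have e : ‖x i‖ ^ 2 = ‖x i ∘L (x i)†‖ := by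
    have := norm_adjoint_comp_self ((x i)†)
    rw [adjoint_adjoint, LinearIsometryEquiv.norm_map] at this
    rw [sq, ← this]
  rw [e]
  refine CStarAlgebra.norm_le_norm_of_nonneg_of_le (comp_adjoint_nonneg _) ?_
  exact Finset.single_le_sum (f := fun i => x i ∘L (x i)†) (fun j _ => comp_adjoint_nonneg _)
    (Finset.mem_univ i)

/-- With `h = ∑ x_i x_i*`, the family `(h + ε)^{-1/2} x_i` lies in `α` and has the frame operator
`h (h + ε)^{-1}`, which is nearly the identity on each `x_i`. -/
theorem BaseModule.exists_frame {ι : Type*} [Fintype ι] (α : BaseModule b H) (x : ι → α.space)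
    {ε : ℝ} (hε : 0 < ε) : ∃ y : ι → α.space,
      ‖frameOp fun i => (y i : 𝔎 →L[ℂ] H)‖ ≤ 1 ∧
      ‖1 - frameOp fun i => (y i : 𝔎 →L[ℂ] H)‖ ≤ 1 ∧
      ∀ i, ‖(1 - frameOp fun i => (y i : 𝔎 →L[ℂ] H)) ∘L (x i : 𝔎 →L[ℂ] H)‖ ^ 2 ≤ ε := by
  obtain ⟨k, hk, hka, h1, h2, h3, h4⟩ := exists_resolvent_sqrt
    (frameOp_nonneg fun i => (x i : 𝔎 →L[ℂ] H)) hε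
  have hk' := mem_stabilizer.1 (StarAlgebra.elemental.le_of_mem α.isClosed_stabilizer
    (frameOp_mem_stabilizer α x) hk)
  have e : frameOp (fun i => k ∘L (x i : 𝔎 →L[ℂ] H)) =
      k * frameOp (fun i => (x i : 𝔎 →L[ℂ] H)) * k := by
    rw [frameOp_comp_left, hka.adjoint_eq]
    rfl
  refine ⟨fun i => ⟨k ∘L x i, hk'.1 _ (x i).2⟩, ?_⟩
  change ‖frameOp (fun i => k ∘L (x i : 𝔎 →L[ℂ] H))‖ ≤ 1 ∧
    ‖1 - frameOp (fun i => k ∘L (x i : 𝔎 →L[ℂ] H))‖ ≤ 1 ∧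
      ∀ i, ‖(1 - frameOp (fun i => k ∘L (x i : 𝔎 →L[ℂ] H))) ∘L (x i : 𝔎 →L[ℂ] H)‖ ^ 2 ≤ ε
  rw [e]
  refine ⟨h1, h2, fun i => ?_⟩
  refine (norm_sq_le_norm_frameOp (fun i => (1 - k * frameOp (fun i => (x i : 𝔎 →L[ℂ] H)) * k) ∘L
    (x i : 𝔎 →L[ℂ] H)) i).trans ?_
  rw [frameOp_comp_left, h3.adjoint_eq]
  exact h4

end Approximation

/-! ### Frame operators on the relative tensor product -/

section Factorization

variable {𝔎 H K X Y Z : Type*}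
  [NormedAddCommGroup 𝔎] [InnerProductSpace ℂ 𝔎] [CompleteSpace 𝔎]
  [NormedAddCommGroup H] [InnerProductSpace ℂ H] [CompleteSpace H]
  [NormedAddCommGroup K] [InnerProductSpace ℂ K] [CompleteSpace K]
  [NormedAddCommGroup X] [InnerProductSpace ℂ X] [CompleteSpace X]
  [NormedAddCommGroup Y] [InnerProductSpace ℂ Y] [CompleteSpace Y]

variable {a b c : CStarBase 𝔎}

theorem frameOp_mem_rhoCommutant {ι : Type*} [Fintype ι] (α : BaseModule b H)
    (x : ι → α.space) : frameOp (fun i => (x i : 𝔎 →L[ℂ] H)) ∈ rhoCommutant α := by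
  refine sum_mem fun i _ => ?_
  rintro _ ⟨y, hy, rfl⟩
  have h := congrArg adjoint (rho_comp α (star_mem hy) (x i))
  rw [adjoint_comp, adjoint_comp, rho_adjoint α (star_mem hy), star_eq_adjoint,
    adjoint_adjoint] at h
  rw [ContinuousLinearMap.comp_assoc, h, ← ContinuousLinearMap.comp_assoc, ← rho_comp α hy,
    ContinuousLinearMap.comp_assoc]

theorem norm_ket₂_le (β : BaseModule b H) (γ : BaseModule b.op K) (η : γ.space) :
    ‖ket₂ β γ η‖ ≤ ‖(η : 𝔎 →L[ℂ] K)‖ := by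
  rw [← sq_le_sq₀ (norm_nonneg _) (norm_nonneg _), sq, sq, ← norm_adjoint_comp_self,
    ← norm_adjoint_comp_self, ket₂_adjoint_comp]
  exact norm_rho_le β (γ.inner_mem η η)

/-- The identity `∑ |y_i⟩₂⟨y_i|₂ = Id ⊗ ∑ y_i y_i*`. -/
theorem frameOp_ket₂_comp_ket₁ {ι : Type*} [Fintype ι] (β : BaseModule b H)
    (γ : BaseModule b.op K) (y : ι → γ.space) (ξ : β.space) :
    frameOp (fun i => ket₂ β γ (y i)) ∘L ket₁ β γ ξ =
      ket₁ β γ ξ ∘L frameOp (fun i => (y i : 𝔎 →L[ℂ] K)) := by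
  refine γ.total_space.ext fun η => ?_
  rw [ContinuousLinearMap.comp_assoc, ← ket_comm, frameOp, frameOp,
    ContinuousLinearMap.finsetSum_comp, ContinuousLinearMap.comp_finsetSum,
    ContinuousLinearMap.finsetSum_comp]
  refine Finset.sum_congr rfl fun i _ => ?_
  calc (ket₂ β γ (y i) ∘L (ket₂ β γ (y i))†) ∘L ket₂ β γ η ∘L (ξ : 𝔎 →L[ℂ] H)
      = ket₂ β γ (y i) ∘L ((ket₂ β γ (y i))† ∘L ket₂ β γ η) ∘L (ξ : 𝔎 →L[ℂ] H) := rfl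
    _ = (ket₂ β γ (y i) ∘L (ξ : 𝔎 →L[ℂ] H)) ∘L
        ((y i : 𝔎 →L[ℂ] K)† ∘L (η : 𝔎 →L[ℂ] K)) := by
        rw [ket₂_adjoint_comp, rho_comp β (γ.inner_mem _ _), ContinuousLinearMap.comp_assoc]
    _ = _ := by rw [ket_comm]; rfl

/-- The operator `T` is `Id ⊗ t`, and amplification does not increase the norm. -/
theorem norm_le_of_comp_ket₁ (β : BaseModule b H) (γ : BaseModule b.op K)
    {T : RT β γ →L[ℂ] RT β γ} {t : K →L[ℂ] K} (ht : t ∈ rhoCommutant γ)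
    (hT : ∀ ξ, T ∘L ket₁ β γ ξ = ket₁ β γ ξ ∘L t) : ‖T‖ ≤ ‖t‖ := by
  have hc : ∀ ξ ξ', Commute ((ket₁ β γ ξ)† ∘L ket₁ β γ ξ') t := fun ξ ξ' => by
    rw [ket₁_adjoint_comp]
    exact (ht _ ⟨_, β.inner_mem ξ ξ', rfl⟩).symm
  have e : T = amplify (ket₁ β γ) t := (total_ket₁ β γ).ext fun ξ => by
    rw [hT, (total_ket₁ β γ).amplify_comp t hc]
  rw [e]
  exact (total_ket₁ β γ).norm_amplify_le t hc

theorem one_mem_rhoCommutant (α : BaseModule b H) : (1 : H →L[ℂ] H) ∈ rhoCommutant α :=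
  fun _ _ => rfl

theorem norm_frameOp_ket₂_le {ι : Type*} [Fintype ι] (β : BaseModule b H)
    (γ : BaseModule b.op K) (y : ι → γ.space) :
    ‖frameOp (fun i => ket₂ β γ (y i))‖ ≤ ‖frameOp (fun i => (y i : 𝔎 →L[ℂ] K))‖ :=
  norm_le_of_comp_ket₁ β γ (frameOp_mem_rhoCommutant γ y) (frameOp_ket₂_comp_ket₁ β γ y)

theorem one_sub_frameOp_ket₂_comp_ket₁ {ι : Type*} [Fintype ι] (β : BaseModule b H)
    (γ : BaseModule b.op K) (y : ι → γ.space) (ξ : β.space) :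
    (1 - frameOp (fun i => ket₂ β γ (y i))) ∘L ket₁ β γ ξ =
      ket₁ β γ ξ ∘L (1 - frameOp (fun i => (y i : 𝔎 →L[ℂ] K))) := by
  rw [ContinuousLinearMap.sub_comp, ContinuousLinearMap.comp_sub, frameOp_ket₂_comp_ket₁]
  rfl

theorem norm_one_sub_frameOp_ket₂_le {ι : Type*} [Fintype ι] (β : BaseModule b H)
    (γ : BaseModule b.op K) (y : ι → γ.space) :
    ‖1 - frameOp (fun i => ket₂ β γ (y i))‖ ≤ ‖1 - frameOp (fun i => (y i : 𝔎 →L[ℂ] K))‖ :=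
  norm_le_of_comp_ket₁ β γ
    (sub_mem (one_mem_rhoCommutant γ) (frameOp_mem_rhoCommutant γ y))
    (one_sub_frameOp_ket₂_comp_ket₁ β γ y)

theorem norm_one_sub_frameOp_comp_ket₂_le {ι : Type*} [Fintype ι] (β : BaseModule b H)
    (γ : BaseModule b.op K) (y : ι → γ.space) (η : γ.space) :
    ‖(1 - frameOp (fun i => ket₂ β γ (y i))) ∘L ket₂ β γ η‖ ≤
      ‖(1 - frameOp (fun i => (y i : 𝔎 →L[ℂ] K))) ∘L (η : 𝔎 →L[ℂ] K)‖ := by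
  let η' : γ.space := ⟨(1 - frameOp (fun i => (y i : 𝔎 →L[ℂ] K))) ∘L (η : 𝔎 →L[ℂ] K), by
    rw [ContinuousLinearMap.sub_comp]
    exact sub_mem η.2 (frameOp_comp_mem γ y η.2)⟩
  have e : (1 - frameOp (fun i => ket₂ β γ (y i))) ∘L ket₂ β γ η = ket₂ β γ η' := by
    refine β.total_space.ext fun ξ => ?_
    rw [ContinuousLinearMap.comp_assoc, ket_comm, ← ContinuousLinearMap.comp_assoc,
      one_sub_frameOp_ket₂_comp_ket₁, ket_comm]
    rfl
  rw [e]
  exact norm_ket₂_le β γ η'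

open Filter Topology in
/-- The frame operators of finite families in `α` form an approximate unit for `α`. -/
theorem BaseModule.exists_approx_unit (α : BaseModule b H) :
    ∃ (n : Finset α.space × ℕ → ℕ) (y : ∀ p, Fin (n p) → α.space),
      (∀ p, ‖frameOp fun i => (y p i : 𝔎 →L[ℂ] H)‖ ≤ 1) ∧
      (∀ p, ‖1 - frameOp fun i => (y p i : 𝔎 →L[ℂ] H)‖ ≤ 1) ∧
      ∀ ξ : α.space, Tendsto (fun p => ‖(1 - frameOp fun i => (y p i : 𝔎 →L[ℂ] H)) ∘L
        (ξ : 𝔎 →L[ℂ] H)‖) atTop (𝓝 0) := by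
  have hpos : ∀ m : ℕ, (0 : ℝ) < (1 / ((m : ℝ) + 1)) := fun m => Nat.one_div_pos_of_nat
  choose y h1 h2 h3 using fun p : Finset α.space × ℕ =>
    α.exists_frame (fun i : Fin p.1.card => (p.1.equivFin.symm i : α.space)) (hpos p.2)
  refine ⟨fun p => p.1.card, y, h1, h2, fun ξ => ?_⟩
  have hsq : Tendsto (fun p => ‖(1 - frameOp fun i => (y p i : 𝔎 →L[ℂ] H)) ∘L
      (ξ : 𝔎 →L[ℂ] H)‖ ^ 2) atTop (𝓝 0) := by
    have hlim : Tendsto (fun p : Finset α.space × ℕ => 1 / ((p.2 : ℝ) + 1)) atTop (𝓝 0) := by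
      rw [← prod_atTop_atTop_eq]
      exact tendsto_one_div_add_atTop_nhds_zero_nat.comp tendsto_snd
    refine tendsto_of_tendsto_of_tendsto_of_le_of_le' tendsto_const_nhds hlim
      (Eventually.of_forall fun p => sq_nonneg _) ?_
    refine (eventually_ge_atTop (({ξ} : Finset α.space), 0)).mono fun p hp => ?_
    have hm : ξ ∈ p.1 := Finset.singleton_subset_iff.1 hp.1
    have := h3 p (p.1.equivFin ⟨ξ, hm⟩)
    rwa [Equiv.symm_apply_apply] at this
  have := hsq.sqrt
  simpa only [Real.sqrt_sq (norm_nonneg _), Real.sqrt_zero] using this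

open Filter Topology in
theorem tendsto_norm_comp_of_mem_clspan {ι : Type*} {l : Filter ι} {T : ι → X →L[ℂ] Y}
    (hT : ∀ i, ‖T i‖ ≤ 1) {S : Set (𝔎 →L[ℂ] X)}
    (hS : ∀ x ∈ S, Tendsto (fun i => ‖T i ∘L x‖) l (𝓝 0)) {x : 𝔎 →L[ℂ] X} (hx : x ∈ clspan S) :
    Tendsto (fun i => ‖T i ∘L x‖) l (𝓝 0) := by
  let P : Submodule ℂ (𝔎 →L[ℂ] X) :=
    { carrier := {x | Tendsto (fun i => T i ∘L x) l (𝓝 0)}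
      add_mem' := fun {x y} hx hy => by
        have := Tendsto.add hx hy
        rw [add_zero] at this
        exact this.congr fun i => (ContinuousLinearMap.comp_add _ _ _).symm
      zero_mem' := tendsto_const_nhds.congr fun i => (ContinuousLinearMap.comp_zero _).symm
      smul_mem' := fun r x hx => by
        have := Tendsto.const_smul hx r
        rw [smul_zero] at this
        exact this.congr fun i => (ContinuousLinearMap.comp_smul _ _ _).symm }
  have hP : IsClosed (P : Set (𝔎 →L[ℂ] X)) := by
    refine isClosed_of_closure_subset fun x hx => ?_
    change Tendsto (fun i => T i ∘L x) l (𝓝 0)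
    rw [tendsto_zero_iff_norm_tendsto_zero, Metric.tendsto_nhds]
    intro ε hε
    obtain ⟨z, hz, hxz⟩ := Metric.mem_closure_iff.1 hx (ε / 2) (half_pos hε)
    have hz' := Metric.tendsto_nhds.1 (tendsto_zero_iff_norm_tendsto_zero.1 hz) (ε / 2)
      (half_pos hε)
    refine hz'.mono fun i hi => ?_
    rw [Real.dist_eq, sub_zero, abs_of_nonneg (norm_nonneg _)] at hi ⊢
    have e : T i ∘L x = T i ∘L (x - z) + T i ∘L z := by
      rw [← ContinuousLinearMap.comp_add, sub_add_cancel]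
    rw [dist_eq_norm] at hxz
    rw [e]
    calc _ ≤ ‖T i ∘L (x - z)‖ + ‖T i ∘L z‖ := norm_add_le _ _
      _ ≤ 1 * ‖x - z‖ + ‖T i ∘L z‖ := by
          gcongr
          exact (opNorm_comp_le _ _).trans (by gcongr; exact hT i)
      _ < ε := by linarith
  exact tendsto_zero_iff_norm_tendsto_zero.1
    (clspan_le hP (fun x hx => tendsto_zero_iff_norm_tendsto_zero.2 (hS x hx)) hx)

theorem bra₂_comp_mem (μ : BaseModule a H) (β : BaseModule b H) (γ : BaseModule b.op K)
    (h : RhoStable β μ) (η : γ.space) (x : (ltri μ β γ h).space) :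
    (ket₂ β γ η)† ∘L (x : 𝔎 →L[ℂ] RT β γ) ∈ μ.space := by
  refine clspan_comp_left _ μ.isClosed_space ?_ x.2
  rintro _ ⟨η', ξ, hξ, rfl⟩
  rw [← ContinuousLinearMap.comp_assoc, ket₂_adjoint_comp]
  exact h.mem (γ.inner_mem η η') ⟨ξ, hξ⟩

theorem frameOp_ket₂_comp_mem {ι : Type*} [Fintype ι] (μ : BaseModule a H) (β : BaseModule b H)
    (γ : BaseModule b.op K) (h : RhoStable β μ) (y : ι → γ.space) (x : (ltri μ β γ h).space) :
    frameOp (fun i => ket₂ β γ (y i)) ∘L (x : 𝔎 →L[ℂ] RT β γ) ∈ (ltri μ β γ h).space := by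
  rw [frameOp, ContinuousLinearMap.finsetSum_comp]
  refine sum_mem fun i _ => ?_
  rw [ContinuousLinearMap.comp_assoc]
  exact ket₂_comp_mem_ltri μ β γ h (y i) ⟨_, bra₂_comp_mem μ β γ h (y i) x⟩

/-- The norm `‖∑ x_n* x_n‖` of a sequence in `α^∞`, the square of its norm as a column. -/
noncomputable def SqSeq.sqNorm {α : BaseModule a H} (x : SqSeq α) : ℝ :=
  ‖∑' n, (x.1 n : 𝔎 →L[ℂ] H)† ∘L (x.1 n : 𝔎 →L[ℂ] H)‖

open Filter Topology in
/-- For `x ∈ (μ ◁ γ)^∞` there is a finite family `y` in `γ` such that the contraction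
`U = ∑ |y_i⟩₂⟨y_i|₂` nearly fixes `x`. -/
theorem exists_frame_sub_sqNorm_le (μ : BaseModule a H) (β : BaseModule b H)
    (γ : BaseModule b.op K) (h : RhoStable β μ) (x : SqSeq (ltri μ β γ h)) {δ : ℝ} (hδ : 0 < δ) :
    ∃ (n : ℕ) (y : Fin n → γ.space) (x' : SqSeq (ltri μ β γ h)),
      ‖frameOp fun i => ket₂ β γ (y i)‖ ≤ 1 ∧
      (∀ k, (x'.1 k : 𝔎 →L[ℂ] RT β γ) =
        x.1 k - frameOp (fun i => ket₂ β γ (y i)) ∘L (x.1 k : 𝔎 →L[ℂ] RT β γ)) ∧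
      x'.sqNorm ≤ δ := by
  classical
  obtain ⟨n, y, h1, h2, h3⟩ := γ.exists_approx_unit
  let T : Finset γ.space × ℕ → RT β γ →L[ℂ] RT β γ := fun p =>
    1 - frameOp fun i => ket₂ β γ (y p i)
  have hT : ∀ p, ‖T p‖ ≤ 1 := fun p => (norm_one_sub_frameOp_ket₂_le β γ (y p)).trans (h2 p)
  have lim : ∀ k, Tendsto (fun p => ‖T p ∘L (x.1 k : 𝔎 →L[ℂ] RT β γ)‖) atTop (𝓝 0) := by
    intro k
    refine tendsto_norm_comp_of_mem_clspan hT ?_ (x.1 k).2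
    rintro _ ⟨η, ξ, -, rfl⟩
    have hlim : Tendsto (fun p => ‖(1 - frameOp fun i => (y p i : 𝔎 →L[ℂ] K)) ∘L
        (η : 𝔎 →L[ℂ] K)‖ * ‖ξ‖) atTop (𝓝 0) := by
      simpa only [zero_mul] using (h3 η).mul_const ‖ξ‖
    refine squeeze_zero (fun p => norm_nonneg _) (fun p => ?_) hlim
    rw [← ContinuousLinearMap.comp_assoc]
    refine (opNorm_comp_le _ _).trans ?_
    gcongr
    exact norm_one_sub_frameOp_comp_ket₂_le β γ (y p) η
  obtain ⟨s, hs⟩ := x.2.vanish (Real.sqrt_pos.2 (half_pos hδ))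
  have lim' : Tendsto (fun p => ∑ k ∈ s, ‖T p ∘L (x.1 k : 𝔎 →L[ℂ] RT β γ)‖ ^ 2) atTop
      (𝓝 0) := by
    have := tendsto_finsetSum s fun k _ => (lim k).pow 2
    simpa using this
  obtain ⟨p, hp⟩ := (lim'.eventually (gt_mem_nhds (half_pos hδ))).exists
  have hTx : ∀ k, T p ∘L (x.1 k : 𝔎 →L[ℂ] RT β γ) =
      x.1 k - frameOp (fun i => ket₂ β γ (y p i)) ∘L (x.1 k : 𝔎 →L[ℂ] RT β γ) := fun k => by
    rw [ContinuousLinearMap.sub_comp]; rfl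
  let x' : SqSeq (ltri μ β γ h) := ⟨fun k => ⟨T p ∘L (x.1 k : 𝔎 →L[ℂ] RT β γ), by
    rw [hTx]
    exact sub_mem (x.1 k).2 (frameOp_ket₂_comp_mem μ β γ h (y p) (x.1 k))⟩, x.2.comp_left (T p)⟩
  refine ⟨n p, y p, x', (norm_frameOp_ket₂_le β γ (y p)).trans (h1 p), hTx, ?_⟩
  refine le_of_tendsto (x'.2.hasSum.norm) (Eventually.of_forall fun t => ?_)
  rw [← Finset.sum_filter_add_sum_filter_not t (· ∈ s)]
  refine (norm_add_le _ _).trans ?_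
  rw [← add_halves δ]
  refine add_le_add ?_ ?_
  · refine le_trans ?_ hp.le
    refine (norm_sum_le _ _).trans ?_
    calc ∑ k ∈ t with k ∈ s, ‖(x'.1 k : 𝔎 →L[ℂ] RT β γ)† ∘L (x'.1 k : 𝔎 →L[ℂ] RT β γ)‖
        = ∑ k ∈ t with k ∈ s, ‖T p ∘L (x.1 k : 𝔎 →L[ℂ] RT β γ)‖ ^ 2 :=
          Finset.sum_congr rfl fun k _ => by rw [norm_adjoint_comp_self, sq]
      _ ≤ _ := Finset.sum_le_sum_of_subset_of_nonneg
          (fun k hk => (Finset.mem_filter.1 hk).2) fun k _ _ => sq_nonneg _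
  · rw [norm_colOp_sq, ← Real.sq_sqrt (half_pos hδ).le]
    gcongr
    refine le_trans ?_ (hs (t.filter fun k => ¬ k ∈ s)
      (Finset.disjoint_left.2 fun k hk => (Finset.mem_filter.1 hk).2))
    refine opNorm_le_bound _ (opNorm_nonneg _) fun v => ?_
    refine le_trans ?_ (le_opNorm _ _)
    rw [← sq_le_sq₀ (norm_nonneg _) (norm_nonneg _), norm_colOp_apply_sq, norm_colOp_apply_sq]
    refine Finset.sum_le_sum fun k _ => ?_
    gcongr
    exact ((T p).le_of_opNorm_le (hT p) _).trans (one_mul _).le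

end Factorization

/-! ### Functionals of the form `z ↦ ∑ x_k* (z ⊗ Id) y_k` -/

section Telescoping

variable {X E F G : Type*}
  [NormedAddCommGroup X] [InnerProductSpace ℂ X] [CompleteSpace X]
  [NormedAddCommGroup E] [InnerProductSpace ℂ E] [CompleteSpace E]
  [NormedAddCommGroup F] [InnerProductSpace ℂ F] [CompleteSpace F]
  [NormedAddCommGroup G] [InnerProductSpace ℂ G] [CompleteSpace G]

/-- Each block has a square sum of norm at most `|r_j|² ‖∑ (w_j)_k* (w_j)_k‖`, because the family
`A_j` is a column of norm at most one. -/
theorem SqSummable.sigma_smul_comp {ι : Type*} {κ : ℕ → Type*} [∀ j, Fintype (κ j)]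
    {w : ℕ → ι → X →L[ℂ] E} (hw : ∀ j, SqSummable (w j)) (A : ∀ j, κ j → E →L[ℂ] F)
    (hA : ∀ j, ‖∑ i, (A j i)† ∘L A j i‖ ≤ 1) (r : ℕ → ℂ) {c : ℕ → ℝ} (hc : Summable c)
    (h : ∀ j, ‖r j‖ ^ 2 * ‖∑' k, (w j k)† ∘L w j k‖ ≤ c j) :
    SqSummable fun p : Σ j, ι × κ j => r p.1 • (A p.1 p.2.2 ∘L w p.1 p.2.1) := by
  refine SqSummable.sigma
    (fun j => ((hw j).comp (SqSummable.of_finite (A j))).smul (r j)) hc fun j => ?_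
  have e := tsum_adjoint_smul_comp_smul (fun p : ι × κ j => A j p.2 ∘L w j p.1) (r j)
  refine (e.le.trans ?_).trans (h j)
  exact mul_le_mul_of_nonneg_left (norm_tsum_finite_family_le (hw j) (A j) (hA j)) (sq_nonneg _)

/-- One block of the telescoping sum: the weights `2^{-j}` and `2^j` cancel, and
`S P = S - S (1 - P)`. -/
theorem hasSum_block {ι κ : Type*} [Fintype κ] {x : ι → X →L[ℂ] E} (hx : SqSummable x)
    {v v' : ι → G →L[ℂ] E} (hv : SqSummable v) (hv' : SqSummable v') (A : κ → E →L[ℂ] F)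
    (T : F →L[ℂ] F) (S P : E →L[ℂ] E) (hS : ∑ i, (A i)† ∘L T ∘L A i = S ∘L P)
    (hP : ∀ k, v' k = v k - P ∘L v k) (j : ℕ) :
    HasSum (fun p : ι × κ => (((1 / 2 : ℂ) ^ j) • (A p.2 ∘L x p.1))† ∘L T ∘L
        (((2 : ℂ) ^ j) • (A p.2 ∘L v p.1)))
      (∑' k, (x k)† ∘L S ∘L v k - ∑' k, (x k)† ∘L S ∘L v' k) := by
  have hc : (starRingEnd ℂ) ((1 / 2 : ℂ) ^ j) * 2 ^ j = 1 := by
    rw [map_pow, ← mul_pow, map_div₀, map_one, map_ofNat]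
    norm_num
  have e1 : ∀ p : ι × κ, (((1 / 2 : ℂ) ^ j) • (A p.2 ∘L x p.1))† ∘L T ∘L
      (((2 : ℂ) ^ j) • (A p.2 ∘L v p.1)) = (A p.2 ∘L x p.1)† ∘L T ∘L (A p.2 ∘L v p.1) :=
    fun p => by
      rw [map_smulₛₗ, ContinuousLinearMap.smul_comp, ContinuousLinearMap.comp_smul,
        ContinuousLinearMap.comp_smul, smul_smul, hc, one_smul]
  have hA : SqSummable A := SqSummable.of_finite A
  have e2 : ∑' p : ι × κ, (A p.2 ∘L x p.1)† ∘L T ∘L (A p.2 ∘L v p.1) =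
      ∑' k, (x k)† ∘L S ∘L v k - ∑' k, (x k)† ∘L S ∘L v' k := by
    rw [tsum_finite_family hx hv A T, ← (hx.summable hv S).tsum_sub (hx.summable hv' S)]
    refine tsum_congr fun k => ?_
    rw [hS, hP, ContinuousLinearMap.comp_sub, ContinuousLinearMap.comp_sub, sub_sub_cancel,
      ContinuousLinearMap.comp_assoc]
  rw [← e2]
  exact ((hx.comp hA).summable (hv.comp hA) T).hasSum.congr_fun e1

theorem tendsto_tsum_of_geometric {ι : Type*} {x : ι → X →L[ℂ] E} (hx : SqSummable x)
    {w : ℕ → ι → G →L[ℂ] E} (hw : ∀ j, SqSummable (w j)) (S : E →L[ℂ] E) {C : ℝ}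
    (hC : ∀ j, ‖∑' k, (w j k)† ∘L w j k‖ ≤ C * (1 / 16) ^ j) :
    Filter.Tendsto (fun j => ∑' k, (x k)† ∘L S ∘L w j k) Filter.atTop (nhds 0) := by
  set D := ‖∑' k, (x k)† ∘L x k‖
  have hlim : Filter.Tendsto (fun j : ℕ => (√D * √(C * (1 / 16) ^ j)) * ‖S‖)
      Filter.atTop (nhds 0) := by
    have h1 := (tendsto_pow_atTop_nhds_zero_of_lt_one (r := (1 / 16 : ℝ)) (by norm_num)
      (by norm_num)).const_mul C
    have h2 := (h1.sqrt.const_mul (√D)).mul_const ‖S‖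
    simpa only [mul_zero, Real.sqrt_zero, zero_mul] using h2
  refine squeeze_zero_norm (fun j => (hx.norm_tsum_le (hw j) S).trans ?_) hlim
  exact mul_le_mul_of_nonneg_right (mul_le_mul_of_nonneg_left (Real.sqrt_le_sqrt (hC j))
    (Real.sqrt_nonneg _)) (norm_nonneg _)

/-- The sum over all blocks telescopes: the block `j` contributes the difference of
`∑ x_k* S (w_j)_k` and `∑ x_k* S (w_{j+1})_k`, and these sums tend to zero. -/
theorem eq_tsum_of_hasSum_blocks {ι : Type*} {κ : ℕ → Type*} [∀ j, Fintype (κ j)]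
    {x : ι → X →L[ℂ] E} (hx : SqSummable x) {w : ℕ → ι → G →L[ℂ] E}
    (hw : ∀ j, SqSummable (w j)) (A : ∀ j, κ j → E →L[ℂ] F)
    (T : F →L[ℂ] F) (S : E →L[ℂ] E) (P : ℕ → E →L[ℂ] E)
    (hS : ∀ j, ∑ i, (A j i)† ∘L T ∘L A j i = S ∘L P j)
    (hP : ∀ j k, w (j + 1) k = w j k - P j ∘L w j k) {C : ℝ}
    (hC : ∀ j, ‖∑' k, (w j k)† ∘L w j k‖ ≤ C * (1 / 16) ^ j) {D : G →L[ℂ] X}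
    (hD : HasSum (fun p : Σ j, ι × κ j => (((1 / 2 : ℂ) ^ p.1) • (A p.1 p.2.2 ∘L x p.2.1))† ∘L
      T ∘L (((2 : ℂ) ^ p.1) • (A p.1 p.2.2 ∘L w p.1 p.2.1))) D) :
    D = ∑' k, (x k)† ∘L S ∘L w 0 k := by
  have tele := (hD.sigma fun j => hasSum_block hx (hw j) (hw (j + 1)) (A j) T S (P j) (hS j)
    (hP j) j).tendsto_sum_nat
  simp only [Finset.sum_range_sub' fun j => ∑' k, (x k)† ∘L S ∘L w j k] at tele
  have lim := (tendsto_const_nhds (x := ∑' k, (x k)† ∘L S ∘L w 0 k)).sub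
    (tendsto_tsum_of_geometric hx hw S hC)
  rw [sub_zero] at lim
  exact tendsto_nhds_unique tele lim

end Telescoping

section SliceOfTensor

variable {𝔎 H K : Type*}
  [NormedAddCommGroup 𝔎] [InnerProductSpace ℂ 𝔎] [CompleteSpace 𝔎]
  [NormedAddCommGroup H] [InnerProductSpace ℂ H] [CompleteSpace H]
  [NormedAddCommGroup K] [InnerProductSpace ℂ K] [CompleteSpace K]

variable {a b c : CStarBase 𝔎}

theorem otimesLeft_comp_frameOp {ι : Type*} [Fintype ι] (β : BaseModule b H)
    (γ : BaseModule b.op K) {z : H →L[ℂ] H} (hz : z ∈ rhoCommutant β) (y : ι → γ.space) :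
    ∑ i, ((ket₂ β γ (y i))†)† ∘L z ∘L (ket₂ β γ (y i))† =
      otimesLeft β γ z ∘L frameOp (fun i => ket₂ β γ (y i)) := by
  rw [frameOp, ContinuousLinearMap.comp_finsetSum]
  refine Finset.sum_congr rfl fun i _ => ?_
  rw [adjoint_adjoint, ← ContinuousLinearMap.comp_assoc, ← ContinuousLinearMap.comp_assoc,
    otimesLeft_comp β γ hz]

theorem norm_sum_adjoint_ket₂_le {ι : Type*} [Fintype ι] (β : BaseModule b H)
    (γ : BaseModule b.op K) (y : ι → γ.space)
    (h : ‖frameOp fun i => ket₂ β γ (y i)‖ ≤ 1) :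
    ‖∑ i, ((ket₂ β γ (y i))†)† ∘L (ket₂ β γ (y i))†‖ ≤ 1 := by
  simpa only [adjoint_adjoint, frameOp] using h

/-- Iterated approximation: `x = ∑_j U_j w_j` with `w_0 = x` and `w_{j+1} = w_j - U_j w_j`, where
each `U_j` is the frame operator of a finite family of kets and `w_j` decays geometrically. The
rate `1/16` beats the factor `4^j` that the weights `2^j` bring in later. -/
theorem exists_iterated_frames (ν : BaseModule c H) (β : BaseModule b H)
    (γ : BaseModule b.op K) (h : RhoStable β ν) (x : SqSeq (ltri ν β γ h)) :
    ∃ (w : ℕ → SqSeq (ltri ν β γ h)) (n : ℕ → ℕ) (y : ∀ j, Fin (n j) → γ.space) (C : ℝ),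
      w 0 = x ∧ (∀ j, (w j).sqNorm ≤ C * (1 / 16) ^ j) ∧
      (∀ j, ‖frameOp fun i => ket₂ β γ (y j i)‖ ≤ 1) ∧
      ∀ j k, ((w (j + 1)).1 k : 𝔎 →L[ℂ] RT β γ) = (w j).1 k -
        frameOp (fun i => ket₂ β γ (y j i)) ∘L ((w j).1 k : 𝔎 →L[ℂ] RT β γ) := by
  choose n y x' h1 h2 h3 using fun p : SqSeq (ltri ν β γ h) × {δ : ℝ // 0 < δ} =>
    exists_frame_sub_sqNorm_le ν β γ h p.1 p.2.2
  have hx : 0 ≤ x.sqNorm := norm_nonneg _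
  let δ : ℕ → {δ : ℝ // 0 < δ} := fun j => ⟨(x.sqNorm + 1) * (1 / 16) ^ (j + 1), by positivity⟩
  let w : ℕ → SqSeq (ltri ν β γ h) := fun j => Nat.rec x (fun j v => x' (v, δ j)) j
  refine ⟨w, fun j => n (w j, δ j), fun j => y (w j, δ j), x.sqNorm + 1, rfl, fun j => ?_,
    fun j => h1 _, fun j k => h2 (w j, δ j) k⟩
  cases j with
  | zero => rw [pow_zero, mul_one]; exact (lt_add_one _).le
  | succ j => exact h3 (w j, δ j)

/-- The space `Ω_{μ,ν}` contains all `z ↦ ∑ x_k* (z ⊗ Id) y_k` with `x ∈ (μ ◁ γ)^∞` and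
`y ∈ (ν ◁ γ)^∞`. -/
theorem exists_omega_otimesLeft (μ : BaseModule a H) (ν : BaseModule c H) (β : BaseModule b H)
    (γ : BaseModule b.op K) (hμ : RhoStable β μ) (hν : RhoStable β ν)
    (x : SqSeq (ltri μ β γ hμ)) (y : SqSeq (ltri ν β γ hν)) :
    ∃ ω : Omega μ ν (rhoCommutant β), ∀ z : rhoCommutant β, ω.1 z =
      ∑' k, (x.1 k : 𝔎 →L[ℂ] RT β γ)† ∘L otimesLeft β γ z ∘L (y.1 k : 𝔎 →L[ℂ] RT β γ) := by
  obtain ⟨w, n, f, C, hw0, hwC, hf, hws⟩ := exists_iterated_frames ν β γ hν y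
  let A : ∀ j, Fin (n j) → RT β γ →L[ℂ] H := fun j i => (ket₂ β γ (f j i))†
  have hA1 : ∀ j, ‖∑ i, (A j i)† ∘L A j i‖ ≤ 1 := fun j =>
    norm_sum_adjoint_ket₂_le β γ (f j) (hf j)
  have hAμ : ∀ (p : Σ j, ℕ × Fin (n j)),
      A p.1 p.2.2 ∘L (x.1 p.2.1 : 𝔎 →L[ℂ] RT β γ) ∈ μ.space := fun p =>
    bra₂_comp_mem μ β γ hμ _ _
  have hAν : ∀ (p : Σ j, ℕ × Fin (n j)),
      A p.1 p.2.2 ∘L ((w p.1).1 p.2.1 : 𝔎 →L[ℂ] RT β γ) ∈ ν.space := fun p =>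
    bra₂_comp_mem ν β γ hν _ _
  -- The weights `2^{-j}` and `2^j` balance the decay of `w j` between the two families.
  have hξ : SqSummable fun p : Σ j, ℕ × Fin (n j) =>
      ((1 / 2 : ℂ) ^ p.1) • (A p.1 p.2.2 ∘L (x.1 p.2.1 : 𝔎 →L[ℂ] RT β γ)) := by
    refine SqSummable.sigma_smul_comp (w := fun _ k => (x.1 k : 𝔎 →L[ℂ] RT β γ))
      (fun _ => x.2) A hA1 (fun j => (1 / 2 : ℂ) ^ j) (c := fun j => (1 / 4 : ℝ) ^ j * x.sqNorm)
      ((summable_geometric_of_lt_one (by norm_num) (by norm_num)).mul_right _) fun j => ?_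
    have e : ‖(1 / 2 : ℂ) ^ j‖ ^ 2 = (1 / 4 : ℝ) ^ j := by
      rw [norm_pow, ← pow_mul, mul_comm, pow_mul]
      norm_num
    rw [e]
    exact le_rfl
  have hη : SqSummable fun p : Σ j, ℕ × Fin (n j) =>
      ((2 : ℂ) ^ p.1) • (A p.1 p.2.2 ∘L ((w p.1).1 p.2.1 : 𝔎 →L[ℂ] RT β γ)) := by
    refine SqSummable.sigma_smul_comp (w := fun j k => ((w j).1 k : 𝔎 →L[ℂ] RT β γ))
      (fun j => (w j).2) A hA1 (fun j => (2 : ℂ) ^ j) (c := fun j => C * (1 / 4 : ℝ) ^ j)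
      ((summable_geometric_of_lt_one (by norm_num) (by norm_num)).mul_left _) fun j => ?_
    have e : ‖(2 : ℂ) ^ j‖ ^ 2 = (4 : ℝ) ^ j := by
      rw [norm_pow, ← pow_mul, mul_comm, pow_mul]
      norm_num
    rw [e]
    calc _ ≤ (4 : ℝ) ^ j * (C * (1 / 16) ^ j) :=
          mul_le_mul_of_nonneg_left (hwC j) (by positivity)
      _ = C * (4 * (1 / 16)) ^ j := by rw [mul_pow]; ring
      _ = C * (1 / 4) ^ j := by norm_num
  obtain ⟨ω, hω⟩ := Omega.exists_of_countable (rhoCommutant β)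
    (fun p => ⟨_, μ.space.smul_mem ((1 / 2 : ℂ) ^ p.1) (hAμ p)⟩)
    (fun p => ⟨_, ν.space.smul_mem ((2 : ℂ) ^ p.1) (hAν p)⟩) hξ hη
  refine ⟨ω, fun z => ?_⟩
  have h := eq_tsum_of_hasSum_blocks (P := fun j => frameOp fun i => ket₂ β γ (f j i))
    (w := fun j k => ((w j).1 k : 𝔎 →L[ℂ] RT β γ)) x.2 (fun j => (w j).2) A (z : H →L[ℂ] H)
    (otimesLeft β γ z) (fun j => otimesLeft_comp_frameOp β γ z.2 (f j)) hws hwC (hω z)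
  rw [h, hw0]

end SliceOfTensor

/-! ### The pairing -/

section Pairing

variable {𝔎 H : Type*}
  [NormedAddCommGroup 𝔎] [InnerProductSpace ℂ 𝔎] [CompleteSpace 𝔎]
  [NormedAddCommGroup H] [InnerProductSpace ℂ H] [CompleteSpace H]

theorem MapsModule.symm_mem {X Y : Type*}
    [NormedAddCommGroup X] [InnerProductSpace ℂ X] [CompleteSpace X]
    [NormedAddCommGroup Y] [InnerProductSpace ℂ Y] [CompleteSpace Y] {a : CStarBase 𝔎}
    {U : X ≃ₗᵢ[ℂ] Y} {α : BaseModule a X} {α' : BaseModule a Y} (h : MapsModule U α α')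
    (ξ : α'.space) : (U.symm : Y →L[ℂ] X) ∘L (ξ : 𝔎 →L[ℂ] Y) ∈ α.space := by
  obtain ⟨η, hη, e⟩ := (Set.ext_iff.1 h ξ).2 ξ.2
  have : (U.symm : Y →L[ℂ] X) ∘L (ξ : 𝔎 →L[ℂ] Y) = η := by
    rw [← e]
    ext ζ
    exact U.symm_apply_apply _
  rw [this]
  exact hη

theorem otimesLeft_comp_rtFlip {X Y : Type*}
    [NormedAddCommGroup X] [InnerProductSpace ℂ X] [CompleteSpace X]
    [NormedAddCommGroup Y] [InnerProductSpace ℂ Y] [CompleteSpace Y] {b : CStarBase 𝔎}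
    (β : BaseModule b X) (γ : BaseModule b.op Y) {z : Y →L[ℂ] Y} (hz : z ∈ rhoCommutant γ) :
    otimesLeft (b := b.op) γ β z ∘L (rtFlip β γ : RT β γ →L[ℂ] RT (b := b.op) γ β) =
      (rtFlip β γ : RT β γ →L[ℂ] RT (b := b.op) γ β) ∘L otimesRight β γ z := by
  refine (total_ket₁ β γ).ext fun ξ => ?_
  have h := otimesLeft_comp (b := b.op) γ β hz ξ
  rw [ContinuousLinearMap.comp_assoc, rtFlip_comp_ket₁, h, ContinuousLinearMap.comp_assoc,
    otimesRight_comp β γ hz, ← ContinuousLinearMap.comp_assoc, rtFlip_comp_ket₁]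

theorem hasSum_comp_comp {ι : Type*} {f : ι → H →L[ℂ] H} {s : H →L[ℂ] H} (h : HasSum f s)
    (p : H →L[ℂ] 𝔎) (q : 𝔎 →L[ℂ] H) : HasSum (fun i => p ∘L f i ∘L q) (p ∘L s ∘L q) :=
  (h.mapL ((compL ℂ 𝔎 H H).flip q)).mapL (compL ℂ 𝔎 H 𝔎 p)

theorem eq_of_hasSum_prod {s t : ℕ → H →L[ℂ] H} {S T : H →L[ℂ] H} (hs : HasSum s S)
    (ht : HasSum t T) (p : H →L[ℂ] 𝔎) (q : 𝔎 →L[ℂ] H) {f : ℕ × ℕ → 𝔎 →L[ℂ] 𝔎} {D : 𝔎 →L[ℂ] 𝔎}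
    (hf : HasSum f D) (h : ∀ m n, f (m, n) = p ∘L (s m ∘L t n) ∘L q) :
    D = p ∘L (S ∘L T) ∘L q := by
  have inner : ∀ m, HasSum (fun n => f (m, n)) (p ∘L s m ∘L (T ∘L q)) := fun m =>
    (hasSum_comp_comp ht (p ∘L s m) q).congr_fun fun n => by
      rw [h, ContinuousLinearMap.comp_assoc, ContinuousLinearMap.comp_assoc]
  have outer := (hf.prod_fiberwise inner).unique (hasSum_comp_comp hs p (T ∘L q))
  rw [outer, ContinuousLinearMap.comp_assoc]

/-- The sequence `p, 0, 0, …` in `α^∞`. -/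
theorem SqSeq.exists_single {a : CStarBase 𝔎} {α : BaseModule a H} (p : α.space) :
    ∃ ξ : SqSeq α, ξ.1 0 = p ∧ ∀ n ≠ 0, ξ.1 n = 0 := by
  obtain ⟨ξ, h1, h2⟩ := SqSeq.exists_extend (f := fun _ : Unit => 0)
    (fun _ _ _ => rfl) (fun _ => p) (SqSummable.of_finite _)
  exact ⟨ξ, h1 (), fun n hn => h2 n fun ⟨_, h⟩ => hn h.symm⟩

namespace PMU

variable {b : CStarBase 𝔎} (W : PMU b H)

theorem hasSum_sliceFst (υ : W.omegaαβh) :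
    HasSum (fun n => W.sliceFst ((Omega.left υ).1 n) ((Omega.right υ).1 n))
      (⟨W.pi υ, W.pi_mem υ⟩ : rhoCommutant W.βh) :=
  (Topology.IsInducing.subtypeVal.hasSum_iff (g := (rhoCommutant W.βh).subtype) _ _).1
    ((SqSeq.ket₁ W.β (Omega.left υ)).summable (SqSeq.ket₁ (b := b.op) W.α (Omega.right υ))
      (W.V : RT (b := b.op) W.βh W.α →L[ℂ] RT W.α W.β)).hasSum

theorem hasSum_sliceSnd (ω : W.omegaβα) :
    HasSum (fun n => (W.sliceSnd ((Omega.left ω).1 n) ((Omega.right ω).1 n)).1) (W.hatPi ω) :=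
  ((SqSeq.ket₂ W.α (Omega.left ω)).summable (SqSeq.ket₂ (b := b.op) W.βh (Omega.right ω))
    (W.V : RT (b := b.op) W.βh W.α →L[ℂ] RT W.α W.β)).hasSum

theorem adjoint_hatPi_comp (ω : W.omegaβα) (p : W.α.space) (q : W.βh.space) :
    (p : 𝔎 →L[ℂ] H)† ∘L W.hatPi ω ∘L (q : 𝔎 →L[ℂ] H) = ω.1 (W.sliceFst p q) :=
  W.hatPi_test ω p q

theorem adjoint_pi_comp (υ : W.omegaαβh) (p : W.β.space) (q : W.α.space) :
    (p : 𝔎 →L[ℂ] H)† ∘L W.pi υ ∘L (q : 𝔎 →L[ℂ] H) = υ.1 (W.sliceSnd p q) :=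
  W.pi_test υ p q

/-- The two ways to evaluate the pairing agree: for `υ = ω_{η,ζ}`, the norm continuous map `ω`
can be applied to `π_V(υ) = ∑ ⟨η_n|₁ V |ζ_n⟩₁` term by term. -/
theorem omega_pi_eq (ω : W.omegaβα) (υ : W.omegaαβh) :
    ω.1 ⟨W.pi υ, W.pi_mem υ⟩ = υ.1 ⟨W.hatPi ω, W.hatPi_mem ω⟩ := by
  have h1 := (W.hasSum_sliceFst υ).mapL ω.1
  have h2 := hasSum_omega (rhoCommutant W.β) (Omega.left υ) (Omega.right υ)
    ⟨W.hatPi ω, W.hatPi_mem ω⟩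
  rw [Omega.eq υ]
  exact h1.unique (h2.congr_fun fun n => (W.adjoint_hatPi_comp ω _ _).symm)

/-- The coproduct `Δ_V` pulls `ω ⊠ ω'` back to an element of `Ω̃_{β,α}`. -/
theorem exists_boxβα_delta (ω ω' : W.omegaβα) : ∃ σ : W.omegaβα, ∀ z : rhoCommutant W.βh,
    σ.1 z = (W.boxβα ω ω').1 ⟨W.delta z, W.delta_mem z⟩ := by
  let θ := ltriSeq W.α W.α_β (Omega.left ω) (Omega.left ω')
  let θ' := rtriSeq W.β W.β_α (Omega.right ω) (Omega.right ω')
  obtain ⟨σ, hσ⟩ := exists_omega_otimesLeft (b := b.op) W.β W.α W.βh W.α W.βh_β W.βh_α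
    ⟨fun k => ⟨_, W.map_βα.symm_mem (θ.1 k)⟩, θ.2.comp_left _⟩
    ⟨fun k => ⟨_, W.map_αα.symm_mem (θ'.1 k)⟩, θ'.2.comp_left _⟩
  refine ⟨σ, fun z => (hσ z).trans (tsum_congr fun k => ?_)⟩
  have e := W.V.symm.adjoint_eq_symm
  change ((W.V.symm : RT W.α W.β →L[ℂ] RT (b := b.op) W.βh W.α) ∘L
    (θ.1 k : 𝔎 →L[ℂ] RT W.α W.β))† ∘L _ = _
  rw [adjoint_comp, e]
  rfl

/-- The coproduct `Δ̂_V` pulls `υ ⊠ υ'` back to an element of `Ω̃_{α,β̂}`. -/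
theorem exists_boxαβh_hatDelta (υ υ' : W.omegaαβh) :
    ∃ σ : W.omegaαβh, ∀ y : rhoCommutant W.β,
      σ.1 y = (W.boxαβh υ υ').1 ⟨W.hatDelta y, W.hatDelta_mem y⟩ := by
  let κ := ltriSeq (b := b.op) W.βh W.βh_α (Omega.left υ) (Omega.left υ')
  let κ' := rtriSeq (b := b.op) W.α W.α_βh (Omega.right υ) (Omega.right υ')
  let V : RT (b := b.op) W.βh W.α →L[ℂ] RT W.α W.β := W.V
  let S : RT W.α W.β →L[ℂ] RT (b := b.op) W.β W.α := rtFlip W.α W.β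
  -- The flip turns `Id ⊗ y` on `H_α ⊗ _βH` into `y ⊗ Id` on `H_β ⊗ _αH`.
  obtain ⟨σ, hσ⟩ := exists_omega_otimesLeft (b := b.op) W.α W.βh W.β W.α W.β_α W.β_βh
    ⟨fun k => ⟨S ∘L V ∘L (κ.1 k : 𝔎 →L[ℂ] RT (b := b.op) W.βh W.α),
      (flip_mapsModule W.α W.β W.α W.β_α).mem ⟨_, W.map_αα.mem (κ.1 k)⟩⟩,
      (κ.2.comp_left V).comp_left S⟩
    ⟨fun k => ⟨S ∘L V ∘L (κ'.1 k : 𝔎 →L[ℂ] RT (b := b.op) W.βh W.α),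
      (flip_mapsModule W.α W.β W.βh W.β_βh).mem ⟨_, W.map_βhβh.mem (κ'.1 k)⟩⟩,
      (κ'.2.comp_left V).comp_left S⟩
  refine ⟨σ, fun y => (hσ y).trans (tsum_congr fun k => ?_)⟩
  have e1 : V† = (W.V.symm : RT W.α W.β →L[ℂ] RT (b := b.op) W.βh W.α) :=
    W.V.adjoint_eq_symm
  have e2 : S† ∘L S = ContinuousLinearMap.id ℂ _ := adjoint_comp_unitary _
  have e3 : otimesLeft (b := b.op) W.β W.α y.1 ∘L S = S ∘L otimesRight W.α W.β y.1 :=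
    otimesLeft_comp_rtFlip W.α W.β y.2
  let k₁ : 𝔎 →L[ℂ] RT (b := b.op) W.βh W.α := κ.1 k
  let k₂ : 𝔎 →L[ℂ] RT (b := b.op) W.βh W.α := κ'.1 k
  calc (S ∘L V ∘L k₁)† ∘L otimesLeft (b := b.op) W.β W.α y.1 ∘L (S ∘L V ∘L k₂)
      = k₁† ∘L V† ∘L S† ∘L (otimesLeft (b := b.op) W.β W.α y.1 ∘L S) ∘L V ∘L k₂ := by
        rw [adjoint_comp, adjoint_comp]; rfl
    _ = k₁† ∘L V† ∘L (S† ∘L S) ∘L otimesRight W.α W.β y.1 ∘L V ∘L k₂ := by rw [e3]; rfl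
    _ = k₁† ∘L (V† ∘L otimesRight W.α W.β y.1 ∘L V) ∘L k₂ := by
        rw [e2, ContinuousLinearMap.id_comp]; rfl
    _ = k₁† ∘L W.hatDelta y ∘L k₂ := by rw [e1]; rfl

theorem hasSum_boxβα (ω ω' : W.omegaβα) (x : W.rangeCommutant) :
    HasSum (fun k : ℕ × ℕ => (ket₂ W.α W.β ((Omega.left ω').1 k.2) ∘L
        ((Omega.left ω).1 k.1 : 𝔎 →L[ℂ] H))† ∘L (x : RT W.α W.β →L[ℂ] RT W.α W.β) ∘L
          ket₁ W.α W.β ((Omega.right ω).1 k.1) ∘L ((Omega.right ω').1 k.2 : 𝔎 →L[ℂ] H))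
      ((W.boxβα ω ω').1 x) :=
  hasSum_box W.α_β W.β_α (Omega.left ω) (Omega.right ω) (Omega.left ω') (Omega.right ω') x

theorem hasSum_boxαβh (υ υ' : W.omegaαβh) (x : W.sourceCommutant) :
    HasSum (fun k : ℕ × ℕ => (ket₂ (b := b.op) W.βh W.α ((Omega.left υ').1 k.2) ∘L
        ((Omega.left υ).1 k.1 : 𝔎 →L[ℂ] H))† ∘L
          (x : RT (b := b.op) W.βh W.α →L[ℂ] RT (b := b.op) W.βh W.α) ∘L
            ket₁ (b := b.op) W.βh W.α ((Omega.right υ).1 k.1) ∘L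
              ((Omega.right υ').1 k.2 : 𝔎 →L[ℂ] H))
      ((W.boxαβh υ υ').1 x) :=
  hasSum_box (b := b.op) W.βh_α W.α_βh (Omega.left υ) (Omega.right υ) (Omega.left υ')
    (Omega.right υ') x

/-- On slices of `V`, the functional `(ω ⊠ ω') ∘ Δ_V` gives the matrix coefficients of
`π̂_V(ω) π̂_V(ω')`. -/
theorem boxβα_delta_sliceFst (ω ω' : W.omegaβα) (p : W.α.space) (q : W.βh.space) :
    (W.boxβα ω ω').1 ⟨W.delta (W.sliceFst p q), W.delta_mem _⟩ =
      (p : 𝔎 →L[ℂ] H)† ∘L (W.hatPi ω ∘L W.hatPi ω') ∘L (q : 𝔎 →L[ℂ] H) :=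
  eq_of_hasSum_prod (W.hasSum_sliceSnd ω) (W.hasSum_sliceSnd ω') _ _
    (W.hasSum_boxβα ω ω' ⟨W.delta (W.sliceFst p q), W.delta_mem _⟩)
    fun _ _ => W.delta_sliceFst p q _ _ _ _

/-- On slices of `V`, the functional `(υ ⊠ υ') ∘ Δ̂_V` gives the matrix coefficients of
`π_V(υ) π_V(υ')`. -/
theorem boxαβh_hatDelta_sliceSnd (υ υ' : W.omegaαβh) (p : W.β.space) (q : W.α.space) :
    (W.boxαβh υ υ').1 ⟨W.hatDelta (W.sliceSnd p q), W.hatDelta_mem _⟩ =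
      (p : 𝔎 →L[ℂ] H)† ∘L (W.pi υ ∘L W.pi υ') ∘L (q : 𝔎 →L[ℂ] H) :=
  eq_of_hasSum_prod ((W.hasSum_sliceFst υ).mapL (rhoCommutant W.βh).subtypeL)
    ((W.hasSum_sliceFst υ').mapL (rhoCommutant W.βh).subtypeL) _ _
    (W.hasSum_boxαβh υ υ' ⟨W.hatDelta (W.sliceSnd p q), W.hatDelta_mem _⟩)
    fun _ _ => W.hatDelta_sliceSnd p q _ _ _ _

theorem hatPi_eq_comp {ω ω' σ : W.omegaβα} (h : ∀ z : rhoCommutant W.βh,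
    σ.1 z = (W.boxβα ω ω').1 ⟨W.delta z, W.delta_mem z⟩) :
    W.hatPi σ = W.hatPi ω ∘L W.hatPi ω' :=
  W.βh.total_space.ext₂ W.α.total_space fun q p =>
    (W.adjoint_hatPi_comp σ p q).trans ((h _).trans (W.boxβα_delta_sliceFst ω ω' p q))

theorem pi_eq_comp {υ υ' σ : W.omegaαβh} (h : ∀ y : rhoCommutant W.β,
    σ.1 y = (W.boxαβh υ υ').1 ⟨W.hatDelta y, W.hatDelta_mem y⟩) :
    W.pi σ = W.pi υ ∘L W.pi υ' :=
  W.α.total_space.ext₂ W.β.total_space fun q p =>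
    (W.adjoint_pi_comp σ p q).trans ((h _).trans (W.boxαβh_hatDelta_sliceSnd υ υ' p q))

/-- An element of `A⁰_V` is `π_V(υ)` for some `υ`, and `ω(π_V(υ)) = υ(π̂_V(ω))` depends on `ω` only
through `π̂_V(ω)`. -/
theorem omega_eq_of_hatPi_eq {ω ω' : W.omegaβα} (h : W.hatPi ω = W.hatPi ω') (a : W.A0) :
    ω.1 ⟨a, W.A0_le a.2⟩ = ω'.1 ⟨a, W.A0_le a.2⟩ := by
  obtain ⟨_, υ, rfl⟩ := a
  have e1 := W.omega_pi_eq ω υ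
  have e2 := W.omega_pi_eq ω' υ
  refine e1.trans (Eq.trans ?_ e2.symm)
  congr 2

/-- The pairing `(π̂_V(ω) | a) = ω(a)` of the Fourier algebra with the dual Fourier algebra. It is
defined through a choice of `ω` over each element of `Â⁰_V`, which does not matter by
`omega_eq_of_hatPi_eq`. -/
noncomputable def pairing : W.hatA0 →ₗ[ℂ] W.A0 →ₗ[ℂ] (𝔎 →L[ℂ] 𝔎) :=
  LinearMap.mk₂ ℂ (fun x a => x.2.choose.1 ⟨a, W.A0_le a.2⟩)
    (fun x y a => W.omega_eq_of_hatPi_eq (ω := (x + y).2.choose)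
      (ω' := x.2.choose + y.2.choose) (by
        rw [map_add, (x + y).2.choose_spec, x.2.choose_spec, y.2.choose_spec]; rfl) a)
    (fun r x a => W.omega_eq_of_hatPi_eq (ω := (r • x).2.choose) (ω' := r • x.2.choose) (by
        rw [map_smul, (r • x).2.choose_spec, x.2.choose_spec]; rfl) a)
    (fun x a a' => (x.2.choose.1).map_add ⟨a, W.A0_le a.2⟩ ⟨a', W.A0_le a'.2⟩)
    (fun r x a => (x.2.choose.1).map_smul r ⟨a, W.A0_le a.2⟩)

theorem pairing_apply {x : W.hatA0} {ω : W.omegaβα} (h : W.hatPi ω = x) (a : W.A0) :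
    W.pairing x a = ω.1 ⟨a, W.A0_le a.2⟩ :=
  W.omega_eq_of_hatPi_eq (x.2.choose_spec.trans h.symm) a

theorem pairing_eq {a : W.A0} {υ : W.omegaαβh} (h : W.pi υ = a) (x : W.hatA0) :
    W.pairing x a = υ.1 ⟨x, W.hatA0_le x.2⟩ := by
  obtain ⟨_, ω, rfl⟩ := x
  obtain ⟨_, ha⟩ := a
  obtain rfl : W.pi υ = _ := h
  exact (W.pairing_apply rfl _).trans (W.omega_pi_eq ω υ)

theorem sliceFst_mem_A0 (p : W.α.space) (q : W.βh.space) : (W.sliceFst p q).1 ∈ W.A0 := by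
  obtain ⟨η, hη, -⟩ := SqSeq.exists_single p
  obtain ⟨ζ, hζ, hζ'⟩ := SqSeq.exists_single q
  refine ⟨Omega.mk _ η ζ, ((W.hasSum_pi η ζ).unique ?_)⟩
  have e : W.sliceFst (η.1 0) (ζ.1 0) = W.sliceFst p q := by rw [hη, hζ]
  rw [← e]
  refine hasSum_single 0 fun n hn => ?_
  rw [hζ' n hn]
  have h0 : ket₁ (b := b.op) W.βh W.α (0 : W.βh.space) = 0 := by
    refine W.α.total_space.ext fun c => ?_
    have h := ket_comm (b := b.op) W.βh W.α 0 c
    rw [← h, Submodule.coe_zero, ContinuousLinearMap.comp_zero, ContinuousLinearMap.zero_comp]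
  rw [h0, ContinuousLinearMap.comp_zero, ContinuousLinearMap.comp_zero]

theorem sliceSnd_mem_hatA0 (p : W.β.space) (q : W.α.space) :
    (W.sliceSnd p q).1 ∈ W.hatA0 := by
  obtain ⟨ξ, hξ, -⟩ := SqSeq.exists_single p
  obtain ⟨η, hη, hη'⟩ := SqSeq.exists_single q
  refine ⟨Omega.mk _ ξ η, ((W.hasSum_hatPi ξ η).unique ?_)⟩
  have e : W.sliceSnd (ξ.1 0) (η.1 0) = W.sliceSnd p q := by rw [hξ, hη]
  rw [← e]
  refine hasSum_single 0 fun n hn => ?_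
  rw [hη' n hn]
  have h0 : ket₂ (b := b.op) W.βh W.α (0 : W.α.space) = 0 := by
    refine W.βh.total_space.ext fun c => ?_
    have h := ket_comm (b := b.op) W.βh W.α c 0
    rw [h, Submodule.coe_zero, ContinuousLinearMap.comp_zero, ContinuousLinearMap.zero_comp]
  rw [h0, ContinuousLinearMap.comp_zero, ContinuousLinearMap.comp_zero]

/-- The pairing of `â` with `⟨p|₁ V |q⟩₁` is the matrix coefficient `p* â q`. -/
theorem exists_pairing_ne_zero_left (x : W.hatA0) (hx : x ≠ 0) :
    ∃ a : W.A0, W.pairing x a ≠ 0 := by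
  by_contra! h
  refine hx (Subtype.ext (W.βh.total_space.ext₂ W.α.total_space fun q p => ?_))
  obtain ⟨_, ω, rfl⟩ := x
  have h1 := h ⟨_, W.sliceFst_mem_A0 p q⟩
  rw [W.pairing_apply rfl] at h1
  refine (W.hatPi_test ω p q).trans (h1.trans ?_)
  rw [Submodule.coe_zero, ContinuousLinearMap.zero_comp, ContinuousLinearMap.comp_zero]

/-- The pairing of `⟨p|₂ V |q⟩₂` with `a` is the matrix coefficient `p* a q`. -/
theorem exists_pairing_ne_zero_right (a : W.A0) (ha : a ≠ 0) :
    ∃ x : W.hatA0, W.pairing x a ≠ 0 := by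
  by_contra! h
  refine ha (Subtype.ext (W.α.total_space.ext₂ W.β.total_space fun q p => ?_))
  obtain ⟨_, υ, rfl⟩ := a
  have h1 := h ⟨_, W.sliceSnd_mem_hatA0 p q⟩
  rw [W.pairing_eq rfl] at h1
  refine (W.pi_test υ p q).trans (h1.trans ?_)
  rw [Submodule.coe_zero, ContinuousLinearMap.zero_comp, ContinuousLinearMap.comp_zero]

end PMU

end Pairing

end CPMU

theorem mainTheorem5 {𝔎 H : Type*}
    [NormedAddCommGroup 𝔎] [InnerProductSpace ℂ 𝔎] [CompleteSpace 𝔎]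
    [NormedAddCommGroup H] [InnerProductSpace ℂ H] [CompleteSpace H]
    (b : CPMU.CStarBase 𝔎) (W : CPMU.PMU b H) :
    ∃ P : W.hatA0 →ₗ[ℂ] W.A0 →ₗ[ℂ] (𝔎 →L[ℂ] 𝔎),
      (∀ (ω : W.omegaβα) (υ : W.omegaαβh),
        ω.1 ⟨W.pi υ, W.pi_mem υ⟩ = P ⟨W.hatPi ω, ω, rfl⟩ ⟨W.pi υ, υ, rfl⟩ ∧
        P ⟨W.hatPi ω, ω, rfl⟩ ⟨W.pi υ, υ, rfl⟩ = υ.1 ⟨W.hatPi ω, W.hatPi_mem ω⟩) ∧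
      (∀ x : W.hatA0, x ≠ 0 → ∃ a : W.A0, P x a ≠ 0) ∧
      (∀ a : W.A0, a ≠ 0 → ∃ x : W.hatA0, P x a ≠ 0) ∧
      (∀ (ω ω' : W.omegaβα) (a : W.A0),
        ∃ hm : W.hatPi ω ∘L W.hatPi ω' ∈ W.hatA0,
          P ⟨W.hatPi ω ∘L W.hatPi ω', hm⟩ a =
            (W.boxβα ω ω').1 ⟨W.delta ⟨a, W.A0_le a.2⟩, W.delta_mem _⟩) ∧
      (∀ (υ υ' : W.omegaαβh) (x : W.hatA0),
        ∃ hm : W.pi υ ∘L W.pi υ' ∈ W.A0,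
          P x ⟨W.pi υ ∘L W.pi υ', hm⟩ =
            (W.boxαβh υ υ').1 ⟨W.hatDelta ⟨x, W.hatA0_le x.2⟩, W.hatDelta_mem _⟩) := by
  refine ⟨W.pairing, fun ω υ => ⟨(W.pairing_apply (x := ⟨_, ω, rfl⟩) (ω := ω) rfl ⟨_, υ, rfl⟩).symm,
      W.pairing_eq (a := ⟨_, υ, rfl⟩) (υ := υ) rfl ⟨_, ω, rfl⟩⟩,
    W.exists_pairing_ne_zero_left, W.exists_pairing_ne_zero_right, fun ω ω' a => ?_,
    fun υ υ' x => ?_⟩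
  · obtain ⟨σ, hσ⟩ := W.exists_boxβα_delta ω ω'
    have e := W.hatPi_eq_comp hσ
    exact ⟨⟨σ, e⟩, (W.pairing_apply e a).trans (hσ _)⟩
  · obtain ⟨σ, hσ⟩ := W.exists_boxαβh_hatDelta υ υ'
    have e := W.pi_eq_comp hσ
    exact ⟨⟨σ, e⟩, (W.pairing_eq e x).trans (hσ _)⟩
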